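/- Let $d\ge 2$, $m\ge 1$, and let $\Omega\subset\mathbb{R}^d$ be a bounded Lipschitz domain with surface measure $dS$ on $\partial\Omega$. Equip $L^\infty(\Omega;\mathbb{C}^{d\times d})$ with the norm $\|B\|=\operatorname{ess\,sup}_{x\in\Omega}\|B(x)\|_2$ (spectral norm), and let $L^\infty_+(\Omega)$ be the set of those $A\in L^\infty(\Omega;\mathbb{C}^{d\times d})$ for which there is a constant $c_A>0$ such that, for every $\xi\in\mathbb{C}^d$, $\operatorname{Re}[(A(x)\xi)\cdot\overline{\xi}]\ge c_A|\xi|^2$ for almost every $x\in\Omega$. Let $E_1,\dots,E_m\subset\partial\Omega$ be nonempty, connected and relatively open with mutually disjoint closures, and put $E=\bigcup_j E_j$. Let $\zeta\in L^\infty(\partial\Omega)$ satisfy $\operatorname{Re}\zeta\ge 0$ a.e. and $\zeta=0$ a.e. on $\partial\Omega\setminus E$, and suppose that there are $c_\zeta>0$ and nonempty relatively open sets $\mathcal{E}_j\subset E_j$ such that $\operatorname{Re}\zeta\ge c_\zeta$ a.e. on $\mathcal{E}=\bigcup_j\mathcal{E}_j$. Write $\mathbb{C}^m_\diamond=\{W\in\mathbb{C}^m: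 \sum_j W_j=0\}$ and $\mathbf{1}=(1,\dots,1)\in\mathbb{C}^m$; identify $V\in\mathbb{C}^m$ with the function $\sum_j V_j\chi_{E_j}$ on $\partial\Omega$; and let $\widetilde{T}:H^1(\Omega)\to L^2(\partial\Omega)$ be the Dirichlet trace operator, i.e. the unique bounded linear operator that maps the restriction to $\Omega$ of each smooth function on $\mathbb{R}^d$ to its restriction to $\partial\Omega$. Let $\mathcal{H}=(H^1(\Omega)\oplus\mathbb{C}^m)/\mathbb{C}$ be the quotient by the pairs $(c,c\mathbf{1})$, $c\in\mathbb{C}$. On it $$\|(v,V)\|_{\mathcal{H}}^2=\int_\Omega|\nabla v|^2\,dx+\|\widetilde{T}v-V\|_{L^2(\mathcal{E})}^2$$ is a norm, equivalent to the quotient norm $\inf_{c\in\mathbb{C}}(\|v-c\|_{H^1(\Omega)}^2+|V-c\mathbf{1}|^2)^{1/2}$. Let $T_1:\mathcal{H}\to H^1(\Omega)$ and $T_2:\mathcal{H}\to\mathbb{C}^m_\diamond$ be the bounded operators that send a class to the two components of its unique representative $(\tilde v,\widetilde V)$ with $\widetilde V\in\mathbb{C}^m_\diamond$. For $B\in L^\infty(\Omega;\mathbb{C}^{d\times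 d})$ put $\langle w,v\rangle_B=\int_\Omega(B\nabla w)\cdot\overline{\nabla v}\,dx$, and $$a_A[(w,W),(v,V)]=\langle w,v\rangle_A+\int_{\partial\Omega}\zeta\,(\widetilde{T}w-W)\,\overline{(\widetilde{T}v-V)}\,dS .$$ For every $A\in L^\infty_+(\Omega)$, each of the following problems has a unique solution in $\mathcal{H}$, and these solutions define bounded linear operators $N_E(A)\in\mathscr{L}(\mathbb{C}^m_\diamond,\mathcal{H})$ and $P_{E,A}\in\mathscr{L}(L^\infty(\Omega;\mathbb{C}^{d\times d}),\mathscr{L}(\mathcal{H}))$: $$a_A[N_E(A)I,(v,V)]=I\cdot\overline{V},\qquad a_A[P_{E,A}(B)(y,Y),(v,V)]=-\langle y,v\rangle_B\qquad\forall (v,V)\in\mathcal{H}.$$ Put $F_E(A)=T_1N_E(A)\in\mathscr{L}(\mathbb{C}^m_\diamond,H^1(\Omega))$ and $\Lambda_E(A)=T_2N_E(A)\in\mathscr{L}(\mathbb{C}^m_\diamond)$. Then $N_E$, $F_E$ and $\Lambda_E$ are infinitely many times continuously (complex) Fréchet differentiable and analytic on the open set $L^\infty_+(\Omega)$. For all $A\in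 L^\infty_+(\Omega)$, $k\in\mathbb{N}_0$ and $B_1,\dots,B_k\in L^\infty(\Omega;\mathbb{C}^{d\times d})$, $$D^kN_E(A;B_1,\dots,B_k)=\Bigl[\sum_{\alpha}P_{E,A}(B_{\alpha_1})\cdots P_{E,A}(B_{\alpha_k})\Bigr]N_E(A),$$ where $\alpha$ runs over all permutations of $\{1,\dots,k\}$, and $D^kF_E(A)=T_1D^kN_E(A)$, $D^k\Lambda_E(A)=T_2D^kN_E(A)$. Moreover, whenever $A\in L^\infty_+(\Omega)$ with ellipticity constant $c_A$ and $\|B\|<\min\{c_A,c_\zeta\}$, one has $A+B\in L^\infty_+(\Omega)$ and, with convergence in operator norm, \begin{align*} N_E(A+B)&=\sum_{k=0}^\infty\frac{1}{k!}D^kN_E(A;B,\dots,B)=\sum_{k=0}^\infty P_{E,A}(B)^kN_E(A),\\ F_E(A+B)&=\sum_{k=0}^\infty\frac{1}{k!}D^kF_E(A;B,\dots,B)=T_1\sum_{k=0}^\infty P_{E,A}(B)^kN_E(A),\\ \Lambda_E(A+B)&=\sum_{k=0}^\infty\frac{1}{k!}D^k\Lambda_E(A;B,\dots,B)=T_2\sum_{k=0}^\infty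 P_{E,A}(B)^kN_E(A). \end{align*} -/

import Mathlib

open MeasureTheory Set
open scoped ENNReal ContDiff

namespace SCEM

noncomputable section

/-- `ℝ^d` with the Euclidean norm. -/
abbrev RSpace (d : ℕ) : Type := EuclideanSpace ℝ (Fin d)

/-- `ℂ^n` with the Euclidean norm. -/
abbrev CSpace (n : ℕ) : Type := EuclideanSpace ℂ (Fin n)

/-- `ℂ^{d×d}`, realised as linear maps of `ℂ^d`, so that the norm is the spectral norm. -/
abbrev CMat (d : ℕ) : Type := CSpace d →L[ℂ] CSpace d

/-- A bounded Lipschitz domain in `ℝ^d`: a bounded, nonempty, connected open set that near every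
boundary point is, in suitable orthonormal coordinates with last axis `e`, the strict epigraph of
a Lipschitz function of the remaining coordinates. -/
structure LipschitzDomain (d : ℕ) where
  carrier : Set (RSpace d)
  isOpen : IsOpen carrier
  isConnected : IsConnected carrier
  isBounded : Bornology.IsBounded carrier
  lipschitz : ∀ x ∈ frontier carrier, ∃ U : Set (RSpace d), IsOpen U ∧ x ∈ U ∧
    ∃ e : RSpace d, ‖e‖ = 1 ∧
      ∃ γ : (ℝ ∙ e)ᗮ → ℝ, (∃ K : NNReal, LipschitzWith K γ) ∧
        carrier ∩ U = {y | γ ((ℝ ∙ e)ᗮ.orthogonalProjectionOnto y) < inner ℝ e y} ∩ U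

variable {d : ℕ}

namespace LipschitzDomain

/-- Lebesgue measure on `Ω`. -/
abbrev vol (Ω : LipschitzDomain d) : Measure (RSpace d) := volume.restrict Ω.carrier

/-- The surface measure `dS` on `∂Ω`: the `(d-1)`-dimensional Hausdorff measure, normalised to agree
with Lebesgue measure on hyperplanes. -/
abbrev surface (Ω : LipschitzDomain d) : Measure (RSpace d) := μHE[d - 1].restrict (frontier Ω.carrier)

end LipschitzDomain

instance (Ω : LipschitzDomain d) : IsFiniteMeasure Ω.vol :=
  ⟨by simpa using Ω.isBounded.measure_lt_top⟩

/-- `g` is the weak gradient of `u` in `Ω`. -/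
def IsWeakGradient (Ω : LipschitzDomain d) (u : Lp ℂ 2 Ω.vol) (g : Lp (CSpace d) 2 Ω.vol) : Prop :=
  ∀ φ : RSpace d → ℝ, ContDiff ℝ ∞ φ → HasCompactSupport φ → tsupport φ ⊆ Ω.carrier →
    ∀ i : Fin d, ∫ x, (fderiv ℝ φ x (EuclideanSpace.single i 1) : ℂ) * u x ∂Ω.vol
      = - ∫ x, (φ x : ℂ) * g x i ∂Ω.vol

lemma memLp_test (Ω : LipschitzDomain d) {φ : RSpace d → ℝ} (h : Continuous φ)
    (hc : HasCompactSupport φ) : MemLp (fun x => (φ x : ℂ)) 2 Ω.vol :=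
  (Complex.continuous_ofReal.comp h).memLp_of_hasCompactSupport
    (hc.comp_left (g := fun r : ℝ => (r : ℂ)) Complex.ofReal_zero)

lemma memLp_test_deriv (Ω : LipschitzDomain d) {φ : RSpace d → ℝ} (h : ContDiff ℝ ∞ φ)
    (hc : HasCompactSupport φ) (e : RSpace d) :
    MemLp (fun x => (fderiv ℝ φ x e : ℂ)) 2 Ω.vol :=
  memLp_test Ω ((h.continuous_fderiv (by simp)).clm_apply continuous_const)
    ((hc.fderiv ℝ).comp_left (g := fun L : RSpace d →L[ℝ] ℝ => L e) (by simp))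

lemma memLp_coord (Ω : LipschitzDomain d) (g : Lp (CSpace d) 2 Ω.vol) (i : Fin d) :
    MemLp (fun x => g x i) 2 Ω.vol :=
  (EuclideanSpace.proj (𝕜 := ℂ) i).comp_memLp' (Lp.memLp g)

/-- The pairs `(u, ∇u)` in `L² × L²`. -/
def H1Sub (Ω : LipschitzDomain d) :
    Submodule ℂ (WithLp 2 (Lp ℂ 2 Ω.vol × Lp (CSpace d) 2 Ω.vol)) where
  carrier := {p | IsWeakGradient Ω p.fst p.snd}
  zero_mem' := by
    intro φ _ _ _ i
    have h1 : (fun x => (fderiv ℝ φ x (EuclideanSpace.single i 1) : ℂ) *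
        (0 : Lp ℂ 2 Ω.vol) x) =ᵐ[Ω.vol] 0 := by
      filter_upwards [Lp.coeFn_zero ℂ 2 Ω.vol] with x hx
      rw [hx]
      simp
    have h2 : (fun x => (φ x : ℂ) * (0 : Lp (CSpace d) 2 Ω.vol) x i) =ᵐ[Ω.vol] 0 := by
      filter_upwards [Lp.coeFn_zero (CSpace d) 2 Ω.vol] with x hx
      rw [hx]
      simp
    simp only [WithLp.zero_fst, WithLp.zero_snd]
    rw [integral_congr_ae h1, integral_congr_ae h2]
    simp
  add_mem' := by
    intro p q hp hq φ h1 h2 h3 i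
    have hd := memLp_test_deriv Ω h1 h2 (EuclideanSpace.single i 1)
    have hφ := memLp_test Ω h1.continuous h2
    have e1 : (fun x => (fderiv ℝ φ x (EuclideanSpace.single i 1) : ℂ) * (p.fst + q.fst) x)
        =ᵐ[Ω.vol] fun x => (fderiv ℝ φ x (EuclideanSpace.single i 1) : ℂ) * p.fst x
          + (fderiv ℝ φ x (EuclideanSpace.single i 1) : ℂ) * q.fst x := by
      filter_upwards [Lp.coeFn_add p.fst q.fst] with x hx
      rw [hx]
      simp [mul_add]
    have e2 : (fun x => (φ x : ℂ) * (p.snd + q.snd) x i)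
        =ᵐ[Ω.vol] fun x => (φ x : ℂ) * p.snd x i + (φ x : ℂ) * q.snd x i := by
      filter_upwards [Lp.coeFn_add p.snd q.snd] with x hx
      rw [hx]
      simp [mul_add]
    simp only [WithLp.add_fst, WithLp.add_snd]
    have s1 := integral_add (hd.integrable_mul (Lp.memLp p.fst))
      (hd.integrable_mul (Lp.memLp q.fst))
    have s2 := integral_add (hφ.integrable_mul (memLp_coord Ω p.snd i))
      (hφ.integrable_mul (memLp_coord Ω q.snd i))
    simp only [Pi.mul_apply] at s1 s2
    rw [integral_congr_ae e1, integral_congr_ae e2, s1, s2, hp φ h1 h2 h3 i, hq φ h1 h2 h3 i]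
    ring
  smul_mem' := by
    intro c p hp φ h1 h2 h3 i
    have e1 : (fun x => (fderiv ℝ φ x (EuclideanSpace.single i 1) : ℂ) * (c • p.fst) x)
        =ᵐ[Ω.vol] fun x => c * ((fderiv ℝ φ x (EuclideanSpace.single i 1) : ℂ) * p.fst x) := by
      filter_upwards [Lp.coeFn_smul c p.fst] with x hx
      rw [hx]
      simp [mul_left_comm]
    have e2 : (fun x => (φ x : ℂ) * (c • p.snd) x i)
        =ᵐ[Ω.vol] fun x => c * ((φ x : ℂ) * p.snd x i) := by
      filter_upwards [Lp.coeFn_smul c p.snd] with x hx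
      rw [hx]
      simp [mul_left_comm]
    simp only [WithLp.smul_fst, WithLp.smul_snd]
    rw [integral_congr_ae e1, integral_congr_ae e2, integral_const_mul, integral_const_mul,
      hp φ h1 h2 h3 i]
    ring

/-- The Sobolev space `H¹(Ω)` of complex functions, an element being stored together with its weak
gradient; the norm is `(‖u‖² + ‖∇u‖²)^{1/2}`. -/
def H1 (Ω : LipschitzDomain d) : Type := H1Sub Ω

instance (Ω : LipschitzDomain d) : NormedAddCommGroup (H1 Ω) :=
  inferInstanceAs (NormedAddCommGroup (H1Sub Ω))

instance (Ω : LipschitzDomain d) : InnerProductSpace ℂ (H1 Ω) :=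
  inferInstanceAs (InnerProductSpace ℂ (H1Sub Ω))

/-- The function underlying an element of `H¹(Ω)`. -/
def H1.val {Ω : LipschitzDomain d} (v : H1 Ω) : Lp ℂ 2 Ω.vol := (Subtype.val v).fst

/-- The weak gradient of an element of `H¹(Ω)`. -/
def H1.grad {Ω : LipschitzDomain d} (v : H1 Ω) : Lp (CSpace d) 2 Ω.vol := (Subtype.val v).snd

/-- The constant function `1` in `H¹(Ω)`. -/
def H1.one (Ω : LipschitzDomain d) : H1 Ω :=
  ⟨WithLp.toLp 2 (Lp.const 2 Ω.vol (1 : ℂ), 0), by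
    intro φ h1 h2 h3 i
    have e1 : (fun x => (fderiv ℝ φ x (EuclideanSpace.single i 1) : ℂ) *
        (Lp.const 2 Ω.vol (1 : ℂ)) x) =ᵐ[Ω.vol]
        fun x => ((fderiv ℝ φ x (EuclideanSpace.single i 1) : ℝ) : ℂ) := by
      filter_upwards [Lp.coeFn_const (p := 2) (μ := Ω.vol) (1 : ℂ)] with x hx
      rw [hx]
      simp
    have e2 : (fun x => (φ x : ℂ) * (0 : Lp (CSpace d) 2 Ω.vol) x i) =ᵐ[Ω.vol] 0 := by
      filter_upwards [Lp.coeFn_zero (CSpace d) 2 Ω.vol] with x hx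
      rw [hx]
      simp
    have hint : Integrable (fun x => fderiv ℝ φ x (EuclideanSpace.single i (1 : ℝ))) volume :=
      ((h1.continuous_fderiv (by simp)).clm_apply continuous_const).integrable_of_hasCompactSupport
        ((h2.fderiv ℝ).comp_left (g := fun L : RSpace d →L[ℝ] ℝ => L _) (by simp))
    have hz : ∫ x, fderiv ℝ φ x (EuclideanSpace.single i (1 : ℝ)) = 0 := by
      have := integral_mul_fderiv_eq_neg_fderiv_mul_of_integrable (μ := volume)
        (f := fun _ : RSpace d => (1 : ℝ)) (g := φ) (v := EuclideanSpace.single i (1 : ℝ))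
        (by simp) (by simpa using hint)
        (by simpa using h1.continuous.integrable_of_hasCompactSupport h2)
        (by fun_prop) (fun x _ => h1.differentiable (by simp) x)
      simpa using this
    change ∫ x, (fderiv ℝ φ x (EuclideanSpace.single i 1) : ℂ) *
        (Lp.const 2 Ω.vol (1 : ℂ)) x ∂Ω.vol
      = - ∫ x, (φ x : ℂ) * (0 : Lp (CSpace d) 2 Ω.vol) x i ∂Ω.vol
    rw [integral_congr_ae e1, integral_congr_ae e2, integral_complex_ofReal,
      setIntegral_eq_integral_of_forall_compl_eq_zero, hz]
    · simp
    · intro x hx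
      rw [image_eq_zero_of_notMem_tsupport
        (fun h => hx (h3 (tsupport_fderiv_subset ℝ h)))]
      simp⟩

/-- `T` is the Dirichlet trace operator `H¹(Ω) → L²(∂Ω)`: the bounded linear operator that restricts
functions smooth up to the boundary to `∂Ω`. -/
def IsTraceOp (Ω : LipschitzDomain d) (T : H1 Ω →L[ℂ] Lp ℂ 2 Ω.surface) : Prop :=
  ∀ φ : RSpace d → ℂ, ContDiff ℝ ∞ φ → ∀ v : H1 Ω, H1.val v =ᵐ[Ω.vol] φ → T v =ᵐ[Ω.surface] φ

open Classical in
/-- The Dirichlet trace operator (existence and uniqueness are part of the theorem below). -/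
def trace (Ω : LipschitzDomain d) : H1 Ω →L[ℂ] Lp ℂ 2 Ω.surface :=
  if h : ∃ T, IsTraceOp Ω T then h.choose else 0

/-- `L^∞(Ω; ℂ^{d×d})` with the essential supremum of the spectral norm. -/
abbrev LInf (Ω : LipschitzDomain d) : Type := Lp (CMat d) ∞ Ω.vol

/-- `c` is an admissible ellipticity constant `c_A` of the coefficient `A`. -/
def IsEllipticConst (Ω : LipschitzDomain d) (A : LInf Ω) (c : ℝ) : Prop :=
  0 < c ∧ ∀ ξ : CSpace d, ∀ᵐ x ∂Ω.vol, c * ‖ξ‖ ^ 2 ≤ (inner ℂ ξ (A x ξ)).re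

/-- `L^∞_+(Ω)`. -/
def LInfPos (Ω : LipschitzDomain d) : Set (LInf Ω) := {A | ∃ c, IsEllipticConst Ω A c}

/-- `⟨w, v⟩_B = ∫_Ω (B∇w)·conj(∇v) dx`. -/
def gradForm {Ω : LipschitzDomain d} (B : LInf Ω) (w v : H1 Ω) : ℂ :=
  ∫ x, inner ℂ (H1.grad v x) (B x (H1.grad w x)) ∂Ω.vol

/-- Electrodes `E_j ⊆ ∂Ω`, a contact admittance `ζ ∈ L^∞(∂Ω)` and nonempty relatively open patches
`𝓔_j ⊆ E_j` (here `core j`) on which `Re ζ ≥ c_ζ > 0`. -/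
structure ElectrodeModel (Ω : LipschitzDomain d) (m : ℕ) where
  E : Fin m → Set (RSpace d)
  core : Fin m → Set (RSpace d)
  ζ : Lp ℂ ∞ Ω.surface
  cζ : ℝ
  E_relOpen : ∀ j, ∃ U, IsOpen U ∧ E j = U ∩ frontier Ω.carrier
  E_connected : ∀ j, IsConnected (E j)
  E_disjoint : ∀ i j, i ≠ j → Disjoint (closure (E i)) (closure (E j))
  core_subset : ∀ j, core j ⊆ E j
  core_nonempty : ∀ j, (core j).Nonempty
  core_relOpen : ∀ j, ∃ U, IsOpen U ∧ core j = U ∩ frontier Ω.carrier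
  ζ_re_nonneg : ∀ᵐ x ∂Ω.surface, 0 ≤ (ζ x).re
  ζ_eq_zero : ∀ᵐ x ∂Ω.surface, x ∉ (⋃ j, E j) → ζ x = 0
  cζ_pos : 0 < cζ
  cζ_le : ∀ᵐ x ∂Ω.surface, x ∈ (⋃ j, core j) → cζ ≤ (ζ x).re

/-- `ℂ^m_⋄`, the mean free vectors in `ℂ^m`. -/
def CDiamond (m : ℕ) : Submodule ℂ (CSpace m) where
  carrier := {W | ∑ j, W j = 0}
  zero_mem' := by simp
  add_mem' := by
    intro a b ha hb
    simp only [mem_ofPred_eq, PiLp.add_apply, Finset.sum_add_distrib] at *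
    rw [ha, hb, add_zero]
  smul_mem' := by
    intro c a ha
    simp only [mem_ofPred_eq, PiLp.smul_apply, ← Finset.smul_sum] at *
    rw [ha, smul_zero]

/-- The vector `𝟏 ∈ ℂ^m`. -/
def allOnes (m : ℕ) : CSpace m := WithLp.toLp 2 fun _ => 1

/-- `H¹(Ω) ⊕ ℂ^m`. -/
abbrev Pair (Ω : LipschitzDomain d) (m : ℕ) : Type := WithLp 2 (H1 Ω × CSpace m)

/-- The pairs `(c, c𝟏)`, `c ∈ ℂ`. -/
def constants (Ω : LipschitzDomain d) (m : ℕ) : Submodule ℂ (Pair Ω m) :=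
  ℂ ∙ (WithLp.toLp 2 (H1.one Ω, allOnes m) : Pair Ω m)

instance (Ω : LipschitzDomain d) (m : ℕ) : IsClosed (constants Ω m : Set (Pair Ω m)) :=
  Submodule.closed_of_finiteDimensional (ℂ ∙ (WithLp.toLp 2 (H1.one Ω, allOnes m) : Pair Ω m))

/-- `𝓗 = (H¹(Ω) ⊕ ℂ^m)/ℂ`. As a normed space it carries the quotient norm
`inf_c (‖v - c‖²_{H¹} + |V - c𝟏|²)^{1/2}`; its equivalence with the norm `energyNorm` below is part
of the theorem, and Fréchet derivatives, analyticity and sums depend only on the topology. -/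
abbrev HSpace (Ω : LipschitzDomain d) (m : ℕ) : Type := Pair Ω m ⧸ constants Ω m

instance (Ω : LipschitzDomain d) (m : ℕ) : NormedAddCommGroup (HSpace Ω m) :=
  Submodule.Quotient.normedAddCommGroup (constants Ω m)

instance (Ω : LipschitzDomain d) (m : ℕ) : NormedSpace ℂ (HSpace Ω m) :=
  Submodule.Quotient.normedSpace (constants Ω m) ℂ

/-- The equivalence class in `𝓗` of a pair `(v, V)`. -/
abbrev toH {Ω : LipschitzDomain d} {m : ℕ} (w : Pair Ω m) : HSpace Ω m := Submodule.Quotient.mk w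

/-- The average of the entries of `V ∈ ℂ^m`. -/
def mean (m : ℕ) : CSpace m →L[ℂ] ℂ :=
  (m : ℂ)⁻¹ • ∑ j, EuclideanSpace.proj (𝕜 := ℂ) j

lemma mean_apply (m : ℕ) (V : CSpace m) : mean m V = (m : ℂ)⁻¹ * ∑ j, V j := by
  simp [mean]

lemma mean_allOnes (m : ℕ) [NeZero m] : mean m (allOnes m) = 1 := by
  simp [mean_apply, allOnes, NeZero.ne m]

/-- `(v, V) ↦ v - mean V`, on representatives. -/
def T1pre (Ω : LipschitzDomain d) (m : ℕ) : Pair Ω m →L[ℂ] H1 Ω :=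
  WithLp.fstL 2 ℂ (H1 Ω) (CSpace m)
    - ((mean m).comp (WithLp.sndL 2 ℂ (H1 Ω) (CSpace m))).smulRight (H1.one Ω)

/-- `(v, V) ↦ V - (mean V) 𝟏`, on representatives. -/
def T2pre (Ω : LipschitzDomain d) (m : ℕ) [NeZero m] : Pair Ω m →L[ℂ] CDiamond m :=
  (WithLp.sndL 2 ℂ (H1 Ω) (CSpace m)
    - ((mean m).comp (WithLp.sndL 2 ℂ (H1 Ω) (CSpace m))).smulRight (allOnes m)).codRestrict
    (CDiamond m) (by
      intro p
      change ∑ j, (p.snd - mean m p.snd • allOnes m) j = 0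
      have : (m : ℂ) ≠ 0 := by exact_mod_cast NeZero.ne m
      simp [mean_apply, allOnes, this])

/-- `T₁ : 𝓗 → H¹(Ω)`, the first component of the representative with mean free second component. -/
def T1 (Ω : LipschitzDomain d) (m : ℕ) [NeZero m] : HSpace Ω m →L[ℂ] H1 Ω :=
  (constants Ω m).liftQL (T1pre Ω m) (by
    rw [constants, Submodule.span_singleton_le_iff_mem]
    change H1.one Ω - mean m (allOnes m) • H1.one Ω = 0
    simp [mean_allOnes])

/-- `T₂ : 𝓗 → ℂ^m_⋄`, the second component of that representative. -/
def T2 (Ω : LipschitzDomain d) (m : ℕ) [NeZero m] : HSpace Ω m →L[ℂ] CDiamond m :=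
  (constants Ω m).liftQL (T2pre Ω m) (by
    rw [constants, Submodule.span_singleton_le_iff_mem]
    apply Subtype.ext
    change allOnes m - mean m (allOnes m) • allOnes m = 0
    simp [mean_allOnes])

namespace ElectrodeModel

variable {Ω : LipschitzDomain d} {m : ℕ} (M : ElectrodeModel Ω m)

/-- The piecewise constant function `∑ V_j χ_{E_j}` on `∂Ω`. -/
def piecewise (V : CSpace m) (x : RSpace d) : ℂ := ∑ j, (M.E j).indicator (fun _ => V j) x

/-- The function `T̃v - V` on `∂Ω`. -/
def jump (w : Pair Ω m) (x : RSpace d) : ℂ := trace Ω w.fst x - M.piecewise w.snd x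

/-- `‖(v, V)‖_𝓗 = (‖∇v‖²_{L²(Ω)} + ‖T̃v - V‖²_{L²(𝓔)})^{1/2}`, on representatives. -/
def energyNorm (w : Pair Ω m) : ℝ :=
  √(∫ x, ‖H1.grad w.fst x‖ ^ 2 ∂Ω.vol + ∫ x in ⋃ j, M.core j, ‖M.jump w x‖ ^ 2 ∂Ω.surface)

/-- The sesquilinear form `a_A[(w, W), (v, V)]`, on representatives. -/
def form (A : LInf Ω) (w v : Pair Ω m) : ℂ :=
  gradForm A w.fst v.fst
    + ∫ x, M.ζ x * M.jump w x * (starRingEnd ℂ) (M.jump v x) ∂Ω.surface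

/-- The class `x ∈ 𝓗` solves the weak problem `a_A[x, (v, V)] = I·conj V` for all `(v, V)`. -/
def IsSolution (A : LInf Ω) (I : CDiamond m) (x : HSpace Ω m) : Prop :=
  ∀ w : Pair Ω m, toH w = x → ∀ v : Pair Ω m,
    M.form A w v = ∑ j, (I : CSpace m) j * (starRingEnd ℂ) (v.snd j)

/-- The class `x ∈ 𝓗` solves `a_A[x, (v, V)] = -⟨y, v⟩_B` for all `(v, V)`. -/
def IsPerturbation (A B : LInf Ω) (y x : HSpace Ω m) : Prop :=
  ∀ w z : Pair Ω m, toH w = x → toH z = y → ∀ v : Pair Ω m,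
    M.form A w v = - gradForm B z.fst v.fst

open Classical in
/-- `N_E(A) : ℂ^m_⋄ → 𝓗`, the solution operator; for `A ∈ L^∞_+(Ω)` its defining property is part of
the theorem, elsewhere the value is irrelevant. -/
def N (A : LInf Ω) : CDiamond m →L[ℂ] HSpace Ω m :=
  if h : ∃ S : CDiamond m →L[ℂ] HSpace Ω m, ∀ I, M.IsSolution A I (S I) then h.choose else 0

open Classical in
/-- `P_{E,A} : L^∞(Ω; ℂ^{d×d}) → 𝓛(𝓗)`; for `A ∈ L^∞_+(Ω)` its defining property is part of the
theorem, elsewhere the value is irrelevant. -/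
def P (A : LInf Ω) : LInf Ω →L[ℂ] (HSpace Ω m →L[ℂ] HSpace Ω m) :=
  if h : ∃ S : LInf Ω →L[ℂ] (HSpace Ω m →L[ℂ] HSpace Ω m),
    ∀ B y, M.IsPerturbation A B y (S B y) then h.choose else 0

/-- `F_E(A) = T₁ N_E(A)`. -/
def F [NeZero m] (A : LInf Ω) : CDiamond m →L[ℂ] H1 Ω := (T1 Ω m).comp (M.N A)

/-- `Λ_E(A) = T₂ N_E(A)`. -/
def Lam [NeZero m] (A : LInf Ω) : CDiamond m →L[ℂ] CDiamond m := (T2 Ω m).comp (M.N A)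

end ElectrodeModel

end

end SCEM

open MeasureTheory Set
open scoped ENNReal ContDiff

namespace SCEM

noncomputable section

variable {d : ℕ}

/-! The heart of the matter is a resolvent identity. The form is affine in the coefficient, a_{A+B}
= a_A + ⟨·,·⟩_B, so the solution for A+B solves the A-problem with the extra load -⟨·,·⟩_B. This
gives N(A+B) = N(A) + P_A(B) N(A+B) (`resolvent_identity`), that is (1 - P_A(B)) N(A+B) = N(A). For
small B the factor is inverted by its Neumann series, and since P_A is linear in B this series is a
power series in B (`hasFPowerSeriesAt_of_resolvent_identity`). Analyticity follows, and the k-th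
derivative is the symmetrisation of the k-th term, which produces the sum over permutations. `F` and
`Lam` inherit everything by composing with the fixed operators `T1` and `T2`.

The explicit radius comes from the energy norm. There the operator of a_A is coercive with constant
min(c_A, c_ζ) (`formOp_coercive`) while the operator of ⟨·,·⟩_B has norm at most ‖B‖
(`norm_gradOp_le`), so P_A(B) contracts by the factor ‖B‖ / min(c_A, c_ζ). The quotient norm carries
no such sharp bound. The geometric series is therefore summed on `EnergySpace` and carried back by
an isomorphism (`hasSum_pow_comp_of_resolvent_identity`). The same coercivity gives unique
solvability of both weak problems, in the manner of Lax–Milgram.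

What remains is the analysis behind that isomorphism, namely `exists_norm_le_energyMap`. It rests on
density of smooth functions in H¹ (`denseRange_ofSmooth`), the trace inequality
(`exists_trace_bound`), the Poincaré inequality (`exists_poincareOn`) and positive surface measure
of the patches (`surface_core_pos`). All four come from the local graph description of ∂Ω. Density
and Poincaré use the interior cone it provides: a shift along the cone axis moves points near the
boundary inside Ω. The Poincaré inequality is thereby proved by transporting it along translations,
with no compact embedding. -/

/-! ### Smooth functions as elements of `H¹(Ω)` -/

/-- The classical gradient of a complex function on `ℝ^d`. -/
def classicalGrad (φ : RSpace d → ℂ) (x : RSpace d) : CSpace d :=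
  WithLp.toLp 2 fun i => fderiv ℝ φ x (EuclideanSpace.single i 1)

@[simp]
lemma classicalGrad_apply (φ : RSpace d → ℂ) (x : RSpace d) (i : Fin d) :
    classicalGrad φ x i = fderiv ℝ φ x (EuclideanSpace.single i 1) := rfl

lemma continuous_classicalGrad {φ : RSpace d → ℂ} (h : ContDiff ℝ ∞ φ) :
    Continuous (classicalGrad φ) := by
  refine (PiLp.continuous_toLp 2 _).comp (continuous_pi fun i => ?_)
  exact (h.continuous_fderiv (by simp)).clm_apply continuous_const

lemma norm_fderiv_apply_le (φ : RSpace d → ℂ) (x h : RSpace d) :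
    ‖fderiv ℝ φ x h‖ ≤ ‖classicalGrad φ x‖ * ‖h‖ := by
  have hh : h = ∑ i, h i • EuclideanSpace.single i (1 : ℝ) := by
    ext j
    simp [Finset.sum_apply, Pi.single_apply]
  have e : fderiv ℝ φ x h = ∑ i, (h i : ℂ) * classicalGrad φ x i := by
    conv_lhs => rw [hh]
    simp only [map_sum, map_smul, classicalGrad_apply, Complex.real_smul]
  rw [e]
  calc ‖∑ i, (h i : ℂ) * classicalGrad φ x i‖
      ≤ ∑ i, ‖classicalGrad φ x i‖ * ‖h i‖ := by
        refine (norm_sum_le _ _).trans (le_of_eq (Finset.sum_congr rfl fun i _ => ?_))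
        rw [norm_mul, Complex.norm_real, mul_comm]
    _ ≤ √(∑ i, ‖classicalGrad φ x i‖ ^ 2) * √(∑ i, ‖h i‖ ^ 2) :=
        Real.sum_mul_le_sqrt_mul_sqrt _ _ _
    _ = ‖classicalGrad φ x‖ * ‖h‖ := by
        rw [EuclideanSpace.norm_eq, EuclideanSpace.norm_eq]

lemma LipschitzDomain.isCompact_closure (Ω : LipschitzDomain d) : IsCompact (closure Ω.carrier) :=
  Ω.isBounded.isCompact_closure

lemma memLp_vol_of_continuous (Ω : LipschitzDomain d) {F : Type*} [NormedAddCommGroup F]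
    {f : RSpace d → F} (hf : Continuous f) (p : ℝ≥0∞) : MemLp f p Ω.vol := by
  obtain ⟨C, hC⟩ := Ω.isCompact_closure.exists_bound_of_continuousOn hf.continuousOn
  refine MemLp.of_bound ?_ C ?_
  · exact hf.aestronglyMeasurable
  · filter_upwards [ae_restrict_mem Ω.isOpen.measurableSet] with x hx
    exact hC x (subset_closure hx)

/-- Integration by parts on all of ℝ^d: the test function is supported in Ω, so both integrals may
be extended from Ω to the whole space. -/
lemma isWeakGradient_of_contDiff (Ω : LipschitzDomain d) {φ : RSpace d → ℂ} (hφ : ContDiff ℝ ∞ φ)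
    {u : Lp ℂ 2 Ω.vol} {g : Lp (CSpace d) 2 Ω.vol} (hu : u =ᵐ[Ω.vol] φ)
    (hg : g =ᵐ[Ω.vol] classicalGrad φ) : IsWeakGradient Ω u g := by
  intro ψ h1 h2 h3 i
  set e : RSpace d := EuclideanSpace.single i 1
  have hc1 : HasCompactSupport fun x => fderiv ℝ ψ x e :=
    (h2.fderiv ℝ).comp_left (g := fun L : RSpace d →L[ℝ] ℝ => L e) (by simp)
  have hc1' : HasCompactSupport fun x => (fderiv ℝ ψ x e : ℂ) :=
    hc1.comp_left (g := fun r : ℝ => (r : ℂ)) Complex.ofReal_zero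
  have hc2 : HasCompactSupport fun x => (ψ x : ℂ) :=
    h2.comp_left (g := fun r : ℝ => (r : ℂ)) Complex.ofReal_zero
  have hψc : ContDiff ℝ ∞ fun x => (ψ x : ℂ) := Complex.ofRealCLM.contDiff.comp h1
  have hfd : ∀ x, fderiv ℝ (fun x => (ψ x : ℂ)) x e = (fderiv ℝ ψ x e : ℂ) := by
    intro x
    have := (Complex.ofRealCLM.hasFDerivAt.comp x
      (h1.differentiable (by simp) x).hasFDerivAt).fderiv
    change fderiv ℝ (Complex.ofRealCLM ∘ ψ) x e = _
    rw [this]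
    rfl
  have hcont1 : Continuous fun x => (fderiv ℝ ψ x e : ℂ) :=
    Complex.continuous_ofReal.comp ((h1.continuous_fderiv (by simp)).clm_apply continuous_const)
  have hcont2 : Continuous fun x => fderiv ℝ φ x e :=
    (hφ.continuous_fderiv (by simp)).clm_apply continuous_const
  have e1 : (fun x => (fderiv ℝ ψ x e : ℂ) * u x) =ᵐ[Ω.vol]
      fun x => (fderiv ℝ ψ x e : ℂ) * φ x := by
    filter_upwards [hu] with x hx
    rw [hx]
  have e2 : (fun x => (ψ x : ℂ) * g x i) =ᵐ[Ω.vol] fun x => (ψ x : ℂ) * fderiv ℝ φ x e := by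
    filter_upwards [hg] with x hx
    rw [hx]
    rfl
  rw [integral_congr_ae e1, integral_congr_ae e2,
    setIntegral_eq_integral_of_forall_compl_eq_zero, setIntegral_eq_integral_of_forall_compl_eq_zero]
  · have := integral_mul_fderiv_eq_neg_fderiv_mul_of_integrable (μ := volume)
      (f := φ) (g := fun x => (ψ x : ℂ)) (v := e)
      ((hcont2.mul hψc.continuous).integrable_of_hasCompactSupport hc2.mul_left)
      (by
        simp only [hfd]
        exact (hφ.continuous.mul hcont1).integrable_of_hasCompactSupport hc1'.mul_left)
      ((hφ.continuous.mul hψc.continuous).integrable_of_hasCompactSupport hc2.mul_left)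
      (fun x _ => hφ.differentiable (by simp) x) (fun x _ => hψc.differentiable (by simp) x)
    simp only [hfd] at this
    simp only [mul_comm _ (φ _), mul_comm (ψ _ : ℂ)]
    exact this
  · intro x hx
    rw [image_eq_zero_of_notMem_tsupport (fun h => hx (h3 h))]
    simp
  · intro x hx
    rw [image_eq_zero_of_notMem_tsupport
      (fun h => hx (h3 (tsupport_fderiv_subset ℝ h)))]
    simp

lemma isWeakGradient_unique (Ω : LipschitzDomain d) {u : Lp ℂ 2 Ω.vol}
    {g g' : Lp (CSpace d) 2 Ω.vol} (hg : IsWeakGradient Ω u g) (hg' : IsWeakGradient Ω u g') :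
    g = g' := by
  have key : ∀ i : Fin d, ∀ᵐ x ∂Ω.vol, g x i = g' x i := by
    intro i
    have hInt : Integrable (fun x => g x i - g' x i) Ω.vol :=
      ((memLp_coord Ω g i).sub (memLp_coord Ω g' i)).integrable (by norm_num)
    have := Ω.isOpen.ae_eq_zero_of_integral_contDiff_smul_eq_zero (μ := volume)
      (f := fun x => g x i - g' x i)
      (IntegrableOn.locallyIntegrableOn hInt) (by
        intro φ h1 h2 h3
        have a := hg φ h1 h2 h3 i
        have b := hg' φ h1 h2 h3 i
        rw [a, neg_inj] at b
        have hφ := memLp_test Ω h1.continuous h2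
        have s := integral_sub (hφ.integrable_mul (memLp_coord Ω g i))
          (hφ.integrable_mul (memLp_coord Ω g' i))
        simp only [Pi.mul_apply] at s
        rw [b, sub_self] at s
        rw [← s, setIntegral_eq_integral_of_forall_compl_eq_zero]
        · simp [mul_sub]
        · intro x hx
          rw [image_eq_zero_of_notMem_tsupport (fun h => hx (h3 h))]
          simp)
    rw [ae_restrict_iff' Ω.isOpen.measurableSet]
    filter_upwards [this] with x hx hxΩ
    exact sub_eq_zero.1 (hx hxΩ)
  refine Lp.ext ?_
  filter_upwards [ae_all_iff.2 key] with x hx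
  ext i
  exact hx i

lemma H1.isWeakGradient {Ω : LipschitzDomain d} (v : H1 Ω) :
    IsWeakGradient Ω (H1.val v) (H1.grad v) := v.2

/-- Weak gradients are unique, so storing the gradient adds no information. Identities in H¹ may
then be checked on the underlying functions alone. -/
lemma H1.ext_val {Ω : LipschitzDomain d} {v w : H1 Ω} (h : H1.val v = H1.val w) : v = w := by
  have hg : H1.grad v = H1.grad w :=
    isWeakGradient_unique Ω v.isWeakGradient (h ▸ w.isWeakGradient)
  exact Subtype.ext (WithLp.ofLp_injective 2 (Prod.ext h hg))

/-- `u ↦ u` as a bounded operator `H¹(Ω) → L²(Ω)`. -/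
def H1.valL (Ω : LipschitzDomain d) : H1 Ω →L[ℂ] Lp ℂ 2 Ω.vol :=
  (WithLp.fstL 2 ℂ (Lp ℂ 2 Ω.vol) (Lp (CSpace d) 2 Ω.vol)).comp (H1Sub Ω).subtypeL

/-- `u ↦ ∇u` as a bounded operator `H¹(Ω) → L²(Ω)`. -/
def H1.gradL (Ω : LipschitzDomain d) : H1 Ω →L[ℂ] Lp (CSpace d) 2 Ω.vol :=
  (WithLp.sndL 2 ℂ (Lp ℂ 2 Ω.vol) (Lp (CSpace d) 2 Ω.vol)).comp (H1Sub Ω).subtypeL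

@[simp] lemma H1.valL_apply {Ω : LipschitzDomain d} (v : H1 Ω) : H1.valL Ω v = H1.val v := rfl

@[simp] lemma H1.gradL_apply {Ω : LipschitzDomain d} (v : H1 Ω) : H1.gradL Ω v = H1.grad v := rfl

lemma H1.norm_sq {Ω : LipschitzDomain d} (v : H1 Ω) :
    ‖v‖ ^ 2 = ‖H1.val v‖ ^ 2 + ‖H1.grad v‖ ^ 2 :=
  WithLp.prod_norm_sq_eq_of_L2 (Subtype.val v)

/-- Build an element of `H¹(Ω)` from a function and its weak gradient. -/
def H1.mk {Ω : LipschitzDomain d} (u : Lp ℂ 2 Ω.vol) (g : Lp (CSpace d) 2 Ω.vol)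
    (h : IsWeakGradient Ω u g) : H1 Ω := ⟨WithLp.toLp 2 (u, g), h⟩

/-- The smooth complex functions on `ℝ^d`. -/
def Smooth (d : ℕ) : Submodule ℂ (RSpace d → ℂ) where
  carrier := {φ | ContDiff ℝ ∞ φ}
  zero_mem' := (contDiff_const : ContDiff ℝ ∞ fun _ : RSpace d => (0 : ℂ))
  add_mem' := by
    intro a b ha hb
    rw [mem_ofPred_eq] at *
    exact ha.add hb
  smul_mem' := by
    intro c a ha
    rw [mem_ofPred_eq] at *
    exact ha.const_smul c

lemma Smooth.contDiff (φ : Smooth d) : ContDiff ℝ ∞ (φ : RSpace d → ℂ) := φ.2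

lemma Smooth.memLp (Ω : LipschitzDomain d) (φ : Smooth d) :
    MemLp (φ : RSpace d → ℂ) 2 Ω.vol :=
  memLp_vol_of_continuous Ω (Smooth.contDiff φ).continuous 2

lemma Smooth.memLp_grad (Ω : LipschitzDomain d) (φ : Smooth d) :
    MemLp (classicalGrad (φ : RSpace d → ℂ)) 2 Ω.vol :=
  memLp_vol_of_continuous Ω (continuous_classicalGrad (Smooth.contDiff φ)) 2

/-- The restriction to `Ω` of a smooth function, as an element of `H¹(Ω)`. -/
def ofSmooth (Ω : LipschitzDomain d) : Smooth d →ₗ[ℂ] H1 Ω where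
  toFun φ := H1.mk ((Smooth.memLp Ω φ).toLp _)
    ((Smooth.memLp_grad Ω φ).toLp _)
    (isWeakGradient_of_contDiff Ω (Smooth.contDiff φ) (MemLp.coeFn_toLp _) (MemLp.coeFn_toLp _))
  map_add' φ ψ := H1.ext_val (MemLp.toLp_add (Smooth.memLp Ω φ) (Smooth.memLp Ω ψ))
  map_smul' c φ := H1.ext_val (MemLp.toLp_const_smul c (Smooth.memLp Ω φ))

lemma val_ofSmooth (Ω : LipschitzDomain d) (φ : Smooth d) :
    H1.val (ofSmooth Ω φ) =ᵐ[Ω.vol] φ :=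
  MemLp.coeFn_toLp (Smooth.memLp Ω φ)

lemma grad_ofSmooth (Ω : LipschitzDomain d) (φ : Smooth d) :
    H1.grad (ofSmooth Ω φ) =ᵐ[Ω.vol] classicalGrad φ :=
  MemLp.coeFn_toLp (Smooth.memLp_grad Ω φ)

lemma eq_ofSmooth {Ω : LipschitzDomain d} {v : H1 Ω} {φ : Smooth d}
    (h : H1.val v =ᵐ[Ω.vol] φ) : v = ofSmooth Ω φ :=
  H1.ext_val (Lp.ext (h.trans (val_ofSmooth Ω φ).symm))

/-- The constant function `1` as a smooth function. -/
def Smooth.one (d : ℕ) : Smooth d := 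
  ⟨fun _ => 1, (contDiff_const : ContDiff ℝ ∞ fun _ : RSpace d => (1 : ℂ))⟩

lemma ofSmooth_one (Ω : LipschitzDomain d) : ofSmooth Ω (Smooth.one d) = H1.one Ω := by
  refine (eq_ofSmooth ?_).symm
  exact Lp.coeFn_const (p := 2) (μ := Ω.vol) (1 : ℂ)

lemma grad_one (Ω : LipschitzDomain d) : H1.grad (H1.one Ω) = 0 := rfl

lemma integral_ofReal_mul_eq_inner (Ω : LipschitzDomain d) {f : RSpace d → ℝ}
    (hf : MemLp (fun x => (f x : ℂ)) 2 Ω.vol) (u : Lp ℂ 2 Ω.vol) :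
    ∫ x, (f x : ℂ) * u x ∂Ω.vol = inner ℂ (hf.toLp _) u := by
  rw [L2.inner_def]
  refine integral_congr_ae ?_
  filter_upwards [hf.coeFn_toLp] with x hx
  rw [hx]
  simp [mul_comm]

/-- For a fixed test function both sides of the defining equation are inner products with a fixed L²
function, so each equation cuts out a closed set. Completeness of H¹ follows. -/
lemma isClosed_H1Sub (Ω : LipschitzDomain d) :
    IsClosed (H1Sub Ω : Set (WithLp 2 (Lp ℂ 2 Ω.vol × Lp (CSpace d) 2 Ω.vol))) := by
  have : (H1Sub Ω : Set (WithLp 2 (Lp ℂ 2 Ω.vol × Lp (CSpace d) 2 Ω.vol))) =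
      {p | ∀ φ : RSpace d → ℝ, ContDiff ℝ ∞ φ → HasCompactSupport φ → tsupport φ ⊆ Ω.carrier →
        ∀ i : Fin d, ∫ x, (fderiv ℝ φ x (EuclideanSpace.single i 1) : ℂ) * p.fst x ∂Ω.vol
          = - ∫ x, (φ x : ℂ) * p.snd x i ∂Ω.vol} := rfl
  rw [this]
  simp only [ofPred_forall]
  refine isClosed_iInter fun φ => isClosed_iInter fun h1 => isClosed_iInter fun h2 =>
    isClosed_iInter fun h3 => isClosed_iInter fun i => ?_
  have e : ∀ p : WithLp 2 (Lp ℂ 2 Ω.vol × Lp (CSpace d) 2 Ω.vol),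
      ∫ x, (φ x : ℂ) * p.snd x i ∂Ω.vol
        = ∫ x, (φ x : ℂ) * ((EuclideanSpace.proj (𝕜 := ℂ) i).compLp p.snd) x ∂Ω.vol := by
    intro p
    refine integral_congr_ae ?_
    filter_upwards [(EuclideanSpace.proj (𝕜 := ℂ) i : CSpace d →L[ℂ] ℂ).coeFn_compLp p.snd]
      with x hx
    rw [hx]
    rfl
  simp only [e]
  simp only [integral_ofReal_mul_eq_inner Ω (memLp_test_deriv Ω h1 h2 (EuclideanSpace.single i 1)),
    integral_ofReal_mul_eq_inner Ω (memLp_test Ω h1.continuous h2)]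
  refine isClosed_eq ?_ ?_
  · exact continuous_const.inner (WithLp.fstL 2 ℂ _ _).continuous
  · exact (continuous_const.inner
      (((EuclideanSpace.proj (𝕜 := ℂ) i : CSpace d →L[ℂ] ℂ).compLpL 2 Ω.vol).continuous.comp
        (WithLp.sndL 2 ℂ _ _).continuous)).neg

instance (Ω : LipschitzDomain d) : CompleteSpace (H1 Ω) :=
  (isClosed_H1Sub Ω).completeSpace_coe

/-! ### Squared norms as lower integrals -/

section Lintegral

variable {α F : Type*} {mα : MeasurableSpace α} [NormedAddCommGroup F]

/-- Cauchy–Schwarz against the constant 1. Estimating in `ℝ≥0∞` lets Tonelli be used without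
integrability hypotheses. -/
lemma sq_lintegral_le (μ : Measure α) {g : α → ℝ≥0∞} (hg : AEMeasurable g μ) :
    (∫⁻ x, g x ∂μ) ^ 2 ≤ μ univ * ∫⁻ x, g x ^ 2 ∂μ := by
  have h := ENNReal.lintegral_mul_le_Lp_mul_Lq μ Real.HolderConjugate.two_two
    (f := fun _ => 1) (g := g) aemeasurable_const hg
  simp only [Pi.mul_apply, one_mul, ENNReal.one_rpow, lintegral_const] at h
  have h2 : (∫⁻ x, g x ∂μ) ^ 2 ≤
      (μ univ ^ (1 / (2 : ℝ)) * (∫⁻ x, g x ^ (2 : ℝ) ∂μ) ^ (1 / (2 : ℝ))) ^ 2 :=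
    pow_le_pow_left' h 2
  refine h2.trans (le_of_eq ?_)
  rw [mul_pow, ← ENNReal.rpow_mul_natCast, ← ENNReal.rpow_mul_natCast]
  norm_num

lemma eLpNorm_two_sq (f : α → F) (μ : Measure α) :
    eLpNorm f 2 μ ^ 2 = ∫⁻ x, ‖f x‖ₑ ^ 2 ∂μ := by
  rw [eLpNorm_eq_lintegral_rpow_enorm_toReal (by norm_num) (by norm_num),
    ← ENNReal.rpow_mul_natCast]
  norm_num

lemma enorm_sq_eq_lintegral {μ : Measure α} (f : Lp F 2 μ) :
    ‖f‖ₑ ^ 2 = ∫⁻ x, ‖f x‖ₑ ^ 2 ∂μ := by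
  rw [Lp.enorm_def, eLpNorm_two_sq]

lemma enorm_add_sq_le (a b : F) : ‖a + b‖ₑ ^ 2 ≤ 2 * ‖a‖ₑ ^ 2 + 2 * ‖b‖ₑ ^ 2 := by
  have h1 : ‖a + b‖₊ ^ 2 ≤ 2 * ‖a‖₊ ^ 2 + 2 * ‖b‖₊ ^ 2 := by
    rw [← NNReal.coe_le_coe]
    push_cast
    nlinarith [norm_add_le a b, norm_nonneg (a + b), sq_nonneg (‖a‖ - ‖b‖)]
  simp only [enorm_eq_nnnorm]
  exact_mod_cast h1

end Lintegral

/-! ### Mollification in `L²` -/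

section Mollify

variable {F : Type*} [NormedAddCommGroup F] [NormedSpace ℝ F] [CompleteSpace F]

open scoped Convolution
open ContinuousLinearMap (lsmul)

/-- The error ρ ⋆ f - f is the average of the translation errors f(· - t) - f against the
probability measure ρ dt; Cauchy–Schwarz in t and Tonelli finish. Only shifts t with ρ t ≠ 0 enter,
and the kernel need not be centred at the origin. The off-centre case is the one used below. -/
lemma eLpNorm_mollify_sub_le {f : RSpace d → F} (hf : MemLp f 2 volume) {ρ : RSpace d → ℝ}
    (hρc : Continuous ρ) (hρs : HasCompactSupport ρ) (hρ0 : ∀ t, 0 ≤ ρ t) (hρ1 : ∫ t, ρ t = 1)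
    {η : ℝ≥0∞} (h : ∀ t, ρ t ≠ 0 → eLpNorm (fun x => f (x - t) - f x) 2 volume ≤ η) :
    eLpNorm (fun x => (ρ ⋆[lsmul ℝ ℝ, volume] f) x - f x) 2 volume ≤ η := by
  have hloc : LocallyIntegrable f volume := hf.locallyIntegrable (by norm_num)
  have hρi : Integrable ρ volume := hρc.integrable_of_hasCompactSupport hρs
  have hex : ConvolutionExists ρ f (lsmul ℝ ℝ) volume :=
    hρs.convolutionExists_left _ hρc hloc
  have hρl : ∫⁻ t, ENNReal.ofReal (ρ t) = 1 := by
    rw [← ofReal_integral_eq_lintegral_ofReal hρi (ae_of_all _ hρ0), hρ1, ENNReal.ofReal_one]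
  set ν : Measure (RSpace d) := volume.withDensity fun t => ENNReal.ofReal (ρ t) with hν
  have hρm : Measurable fun t => ENNReal.ofReal (ρ t) := hρc.measurable.ennreal_ofReal
  have hνu : ν univ = 1 := by
    rw [hν, withDensity_apply _ MeasurableSet.univ, setLIntegral_univ, hρl]
  have hνac : ν ≪ volume := withDensity_absolutelyContinuous _ _
  have hsub : AEStronglyMeasurable (fun p : RSpace d × RSpace d => f (p.1 - p.2))
      ((volume : Measure (RSpace d)).prod volume) :=
    hf.1.comp_quasiMeasurePreserving (quasiMeasurePreserving_sub_of_right_invariant volume volume)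
  have hjoint : AEStronglyMeasurable (fun p : RSpace d × RSpace d => f (p.1 - p.2) - f p.1)
      ((volume : Measure (RSpace d)).prod volume) := hsub.sub hf.1.comp_fst
  have hpt : ∀ᵐ x ∂(volume : Measure (RSpace d)),
      ‖(ρ ⋆[lsmul ℝ ℝ, volume] f) x - f x‖ₑ ^ 2 ≤
        ∫⁻ t, ENNReal.ofReal (ρ t) * ‖f (x - t) - f x‖ₑ ^ 2 := by
    have hsec : ∀ᵐ x ∂(volume : Measure (RSpace d)),
        AEStronglyMeasurable (fun t => f (x - t) - f x) volume := hjoint.prodMk_left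
    filter_upwards [hsec] with x hx
    have e1 : (ρ ⋆[lsmul ℝ ℝ, volume] f) x - f x = ∫ t, ρ t • (f (x - t) - f x) := by
      have : f x = ∫ t, ρ t • f x := by rw [integral_smul_const, hρ1, one_smul]
      conv_lhs => rw [this]
      rw [convolution_def]
      simp only [ContinuousLinearMap.lsmul_apply]
      have hx' : Integrable (fun t => ρ t • f (x - t)) volume := hex x
      rw [← integral_sub hx' (hρi.smul_const _)]
      simp only [smul_sub]
    have e2 : ‖∫ t, ρ t • (f (x - t) - f x)‖ₑ ≤ ∫⁻ t, ‖f (x - t) - f x‖ₑ ∂ν := by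
      refine (enorm_integral_le_lintegral_enorm _).trans (le_of_eq ?_)
      rw [hν, lintegral_withDensity_eq_lintegral_mul₀ hρm.aemeasurable hx.enorm]
      refine lintegral_congr fun t => ?_
      rw [enorm_smul, Real.enorm_eq_ofReal (hρ0 t)]
      rfl
    rw [e1]
    calc _ ≤ (∫⁻ t, ‖f (x - t) - f x‖ₑ ∂ν) ^ 2 := pow_le_pow_left' e2 2
      _ ≤ ν univ * ∫⁻ t, ‖f (x - t) - f x‖ₑ ^ 2 ∂ν :=
          sq_lintegral_le ν (hx.mono_ac hνac).enorm
      _ = _ := by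
          rw [hνu, one_mul, hν,
            lintegral_withDensity_eq_lintegral_mul₀ hρm.aemeasurable (hx.enorm.pow_const 2)]
          rfl
  have hsq : eLpNorm (fun x => (ρ ⋆[lsmul ℝ ℝ, volume] f) x - f x) 2 volume ^ 2 ≤ η ^ 2 := by
    rw [eLpNorm_two_sq]
    calc _ ≤ ∫⁻ x, ∫⁻ t, ENNReal.ofReal (ρ t) * ‖f (x - t) - f x‖ₑ ^ 2 :=
          lintegral_mono_ae hpt
      _ = ∫⁻ t, ∫⁻ x, ENNReal.ofReal (ρ t) * ‖f (x - t) - f x‖ₑ ^ 2 :=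
          lintegral_lintegral_swap ((hρm.comp measurable_snd).aemeasurable.mul
            (hjoint.enorm.pow_const 2))
      _ ≤ ∫⁻ t, ENNReal.ofReal (ρ t) * η ^ 2 := by
          refine lintegral_mono fun t => ?_
          rw [lintegral_const_mul' _ _ ENNReal.ofReal_ne_top]
          by_cases ht : ρ t = 0
          · simp [ht]
          · gcongr
            rw [← eLpNorm_two_sq]
            exact pow_le_pow_left' (h t ht) 2
      _ = η ^ 2 := by rw [lintegral_mul_const _ hρm, hρl, one_mul]
  exact (ENNReal.pow_le_pow_left_iff (by norm_num)).1 hsq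

end Mollify

lemma exists_translate_lt {F : Type*} [NormedAddCommGroup F] {f : RSpace d → F}
    (hf : MemLp f 2 volume) {η : ℝ≥0∞} (hη : 0 < η) :
    ∃ r > 0, ∀ t : RSpace d, ‖t‖ ≤ r → eLpNorm (fun x => f (x - t) - f x) 2 volume ≤ η := by
  have : Fact ((2 : ℝ≥0∞) ≠ ⊤) := ⟨by norm_num⟩
  have hc : Continuous fun t : RSpace d =>
      (DomAddAct.mk (-t) +ᵥ hf.toLp f : Lp F 2 (volume : Measure (RSpace d))) := by
    have : Continuous fun t : RSpace d => DomAddAct.mk (-t) :=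
      DomAddAct.continuous_mk.comp continuous_neg
    exact this.vadd continuous_const
  have h0 : (DomAddAct.mk (-(0 : RSpace d)) +ᵥ hf.toLp f : Lp F 2 (volume : Measure (RSpace d)))
      = hf.toLp f := by simp
  have := (EMetric.tendsto_nhds.1 (hc.tendsto 0)) η hη
  rw [h0] at this
  obtain ⟨r, hr, hball⟩ := Metric.eventually_nhds_iff.1 this
  refine ⟨r / 2, by positivity, fun t ht => ?_⟩
  have hlt := hball (y := t) (by rw [dist_zero_right]; linarith)
  rw [DomAddAct.mk_vadd_toLp, Lp.edist_toLp_toLp] at hlt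
  refine le_of_eq_of_le (eLpNorm_congr_ae (ae_of_all _ fun x => ?_)) hlt.le
  simp [sub_eq_neg_add]

/-! ### The interior cone condition -/

/-- The cone directed along `e` with opening `δ` and height `ε₀` at every point of `Ω` near `p` stays
inside `Ω`. -/
lemma exists_cone (Ω : LipschitzDomain d) {p : RSpace d} (hp : p ∈ closure Ω.carrier) :
    ∃ r > 0, ∃ e : RSpace d, ∃ δ > 0, ∃ ε₀ > 0, ∀ x ∈ Ω.carrier ∩ Metric.ball p r,
      ∀ ε ∈ Ioc (0 : ℝ) ε₀, Metric.closedBall (x + ε • e) (ε * δ) ⊆ Ω.carrier := by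
  by_cases hpi : p ∈ Ω.carrier
  · obtain ⟨R, hR, hball⟩ := Metric.isOpen_iff.1 Ω.isOpen p hpi
    -- An interior point needs no preferred direction, so the axis is 0 and the cone is a family of
    -- balls about x.
    refine ⟨R / 2, by positivity, 0, 1, one_pos, R / 2, by positivity, ?_⟩
    rintro x ⟨-, hx⟩ ε ⟨-, hε⟩ y hy
    apply hball
    rw [Metric.mem_ball] at *
    rw [Metric.mem_closedBall] at hy
    simp only [smul_zero, add_zero, mul_one] at hy
    linarith [dist_triangle y x p]
  · have hpf : p ∈ frontier Ω.carrier := by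
      rw [frontier, Ω.isOpen.interior_eq]
      exact ⟨hp, hpi⟩
    obtain ⟨U, hU, hpU, e, he, γ, ⟨K, hK⟩, hγ⟩ := Ω.lipschitz p hpf
    obtain ⟨R, hR, hball⟩ := Metric.isOpen_iff.1 hU p hpU
    -- A displacement h with ‖h‖ ≤ εδ lowers the height by at most εδ and raises γ by at most Kεδ,
    -- while the step εe gains ε. The choice δ = 1/(K+1) makes (K+1)δ = 1, and strictness is
    -- inherited from x ∈ Ω. The bound ε ≤ R/4 keeps y in the chart, since then ε + εδ ≤ R/2.
    refine ⟨R / 2, by positivity, e, 1 / (K + 1), by positivity, R / 4, by positivity, ?_⟩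
    rintro x ⟨hxΩ, hx⟩ ε ⟨hε0, hε⟩ y hy
    rw [Metric.mem_ball] at hx
    rw [Metric.mem_closedBall, dist_eq_norm] at hy
    set h : RSpace d := y - (x + ε • e) with hh
    have hy' : y = x + ε • e + h := by rw [hh]; abel
    set δ : ℝ := 1 / (K + 1) with hδ
    have hK0 : (0 : ℝ) ≤ K := K.2
    have hδK : K * δ = 1 - δ := by rw [hδ]; field_simp; ring
    have hδ0 : 0 < δ := by positivity
    have hδ1 : δ ≤ 1 := by nlinarith
    have hyp : dist y p < R := by
      have h1 : dist y x ≤ ε + ε * δ := by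
        rw [dist_eq_norm, hy', add_assoc, add_sub_cancel_left]
        refine (norm_add_le _ _).trans (add_le_add ?_ hy)
        rw [norm_smul, he, mul_one, Real.norm_of_nonneg hε0.le]
      nlinarith [dist_triangle y x p]
    have hyU : y ∈ U := hball hyp
    have hxU : x ∈ U := hball (by rw [Metric.mem_ball]; linarith)
    have hxγ : x ∈ {y | γ ((ℝ ∙ e)ᗮ.orthogonalProjectionOnto y) < inner ℝ e y} ∩ U := by
      rw [← hγ]
      exact ⟨hxΩ, hxU⟩
    have hx1 : γ ((ℝ ∙ e)ᗮ.orthogonalProjectionOnto x) < inner ℝ e x := hxγ.1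
    have hproj : (ℝ ∙ e)ᗮ.orthogonalProjectionOnto y - (ℝ ∙ e)ᗮ.orthogonalProjectionOnto x
        = (ℝ ∙ e)ᗮ.orthogonalProjectionOnto h := by
      rw [← map_sub, hy', add_assoc, add_sub_cancel_left, map_add, map_smul,
        Submodule.orthogonalProjectionOnto_orthogonal_apply_eq_zero
          (Submodule.mem_span_singleton_self e), smul_zero, zero_add]
    have hL : γ ((ℝ ∙ e)ᗮ.orthogonalProjectionOnto y)
        ≤ γ ((ℝ ∙ e)ᗮ.orthogonalProjectionOnto x) + K * (ε * δ) := by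
      have h1 := hK.dist_le_mul ((ℝ ∙ e)ᗮ.orthogonalProjectionOnto y)
        ((ℝ ∙ e)ᗮ.orthogonalProjectionOnto x)
      rw [dist_eq_norm, dist_eq_norm, hproj] at h1
      have h2 : ‖(ℝ ∙ e)ᗮ.orthogonalProjectionOnto h‖ ≤ ε * δ :=
        (Submodule.norm_orthogonalProjectionOnto_apply_le _ h).trans hy
      have h3 := (Real.le_norm_self _).trans h1
      nlinarith
    have hin : inner ℝ e x + ε - ε * δ ≤ inner ℝ e y := by
      rw [hy', inner_add_right, inner_add_right, inner_smul_right, real_inner_self_eq_norm_sq, he]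
      have := (neg_le_abs (inner ℝ e h)).trans (abs_real_inner_le_norm e h)
      rw [he, one_mul] at this
      linarith
    have hmem : y ∈ Ω.carrier ∩ U := by
      rw [hγ]
      refine ⟨?_, hyU⟩
      change γ ((ℝ ∙ e)ᗮ.orthogonalProjectionOnto y) < inner ℝ e y
      have : K * (ε * δ) = ε - ε * δ := by
        rw [mul_left_comm, hδK]; ring
      linarith
    exact hmem.1

/-! ### Multiplication by a cutoff function -/

lemma memLp_mul_test (Ω : LipschitzDomain d) {F : Type*} [NormedAddCommGroup F] [NormedSpace ℂ F]
    {χ : RSpace d → ℝ} (hc : Continuous χ) {f : RSpace d → F} (hf : MemLp f 2 Ω.vol) :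
    MemLp (fun x => (χ x : ℂ) • f x) 2 Ω.vol := by
  obtain ⟨C, hC⟩ := Ω.isCompact_closure.exists_bound_of_continuousOn hc.continuousOn
  refine MemLp.of_le_mul (c := C) hf ?_ ?_
  · exact (Complex.continuous_ofReal.comp hc).aestronglyMeasurable.smul hf.1
  · filter_upwards [ae_restrict_mem Ω.isOpen.measurableSet] with x hx
    rw [norm_smul, Complex.norm_real]
    exact mul_le_mul_of_nonneg_right (hC x (subset_closure hx)) (norm_nonneg _)

/-- The gradient of `χ u` in terms of the gradient of `u`. -/
def productGrad (χ : RSpace d → ℝ) (u : RSpace d → ℂ) (g : RSpace d → CSpace d) (x : RSpace d) :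
    CSpace d :=
  (χ x : ℂ) • g x + ∑ i, ((fderiv ℝ χ x (EuclideanSpace.single i 1) : ℝ) : ℂ) •
    u x • EuclideanSpace.single i (1 : ℂ)

lemma productGrad_apply (χ : RSpace d → ℝ) (u : RSpace d → ℂ) (g : RSpace d → CSpace d)
    (x : RSpace d) (i : Fin d) : productGrad χ u g x i =
      (χ x : ℂ) * g x i + (fderiv ℝ χ x (EuclideanSpace.single i 1) : ℂ) * u x := by
  simp [productGrad, Finset.sum_apply, Pi.single_apply]

lemma memLp_productGrad (Ω : LipschitzDomain d) {χ : RSpace d → ℝ} (hχ : ContDiff ℝ ∞ χ)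
    (u : Lp ℂ 2 Ω.vol) (g : Lp (CSpace d) 2 Ω.vol) : MemLp (productGrad χ u g) 2 Ω.vol := by
  refine (memLp_mul_test Ω hχ.continuous (Lp.memLp g)).add (memLp_finsetSum _ fun i _ => ?_)
  refine memLp_mul_test Ω ((hχ.continuous_fderiv (by simp)).clm_apply continuous_const) ?_
  refine MemLp.of_le_mul (c := 1) (Lp.memLp u) ((Lp.memLp u).1.smul_const _) (ae_of_all _ fun x => ?_)
  simp [norm_smul]

/-- The product of a smooth real function with an element of `H¹(Ω)`. -/
def H1.cutoff {Ω : LipschitzDomain d} (χ : RSpace d → ℝ) (hχ : ContDiff ℝ ∞ χ) (v : H1 Ω) : H1 Ω :=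
  H1.mk ((memLp_mul_test Ω hχ.continuous (Lp.memLp (H1.val v))).toLp _)
    ((memLp_productGrad Ω hχ (H1.val v) (H1.grad v)).toLp _) (by
    intro φ h1 h2 h3 i
    set e : RSpace d := EuclideanSpace.single i 1
    have e1 := (memLp_mul_test Ω hχ.continuous (Lp.memLp (H1.val v))).coeFn_toLp
    have e2 := (memLp_productGrad Ω hχ (H1.val v) (H1.grad v)).coeFn_toLp
    have hp : ContDiff ℝ ∞ fun x => φ x * χ x := h1.mul hχ
    have hpc : HasCompactSupport fun x => φ x * χ x := h2.mul_right
    have hfd : ∀ x, fderiv ℝ (fun x => φ x * χ x) x e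
        = φ x * fderiv ℝ χ x e + χ x * fderiv ℝ φ x e := by
      intro x
      rw [fderiv_fun_mul (h1.differentiable (by simp) x) (hχ.differentiable (by simp) x)]
      simp
    -- The weak equation of v is tested with φχ; the product rule for this test function supplies
    -- the additional term φ ∂χ · u.
    have key := v.isWeakGradient (fun x => φ x * χ x) hp hpc
      ((tsupport_mul_subset_left).trans h3) i
    have hcχ : Continuous fun x => fderiv ℝ χ x e :=
      (hχ.continuous_fderiv (by simp)).clm_apply continuous_const
    have hm1 := memLp_test Ω (h1.continuous.mul hcχ) (h2.mul_right (f' := fun x => fderiv ℝ χ x e))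
    have i1 := hm1.integrable_mul (Lp.memLp (H1.val v))
    have i2 := (memLp_test_deriv Ω hp hpc e).integrable_mul (Lp.memLp (H1.val v))
    have i3 := (memLp_test Ω hp.continuous hpc).integrable_mul (memLp_coord Ω (H1.grad v) i)
    have c1 : ∫ x, (fderiv ℝ φ x e : ℂ) * ((memLp_mul_test Ω hχ.continuous
        (Lp.memLp (H1.val v))).toLp _ : RSpace d → ℂ) x ∂Ω.vol
        = ∫ x, (fderiv ℝ (fun x => φ x * χ x) x e : ℂ) * H1.val v x ∂Ω.vol
          - ∫ x, ((φ x * fderiv ℝ χ x e : ℝ) : ℂ) * H1.val v x ∂Ω.vol := by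
      simp only [Pi.mul_def] at i1 i2
      rw [← integral_sub i2 i1]
      refine integral_congr_ae ?_
      filter_upwards [e1] with x hx
      rw [hx, hfd]
      push_cast
      simp only [smul_eq_mul]
      ring
    have c2 : ∫ x, (φ x : ℂ) * ((memLp_productGrad Ω hχ (H1.val v) (H1.grad v)).toLp _ :
        RSpace d → CSpace d) x i ∂Ω.vol
        = ∫ x, ((φ x * χ x : ℝ) : ℂ) * H1.grad v x i ∂Ω.vol
          + ∫ x, ((φ x * fderiv ℝ χ x e : ℝ) : ℂ) * H1.val v x ∂Ω.vol := by
      simp only [Pi.mul_def] at i1 i3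
      rw [← integral_add i3 i1]
      refine integral_congr_ae ?_
      filter_upwards [e2] with x hx
      rw [hx, productGrad_apply]
      push_cast
      ring
    rw [c1, c2, key]
    ring)

lemma H1.val_cutoff {Ω : LipschitzDomain d} (χ : RSpace d → ℝ) (hχ : ContDiff ℝ ∞ χ) (v : H1 Ω) :
    H1.val (H1.cutoff χ hχ v) =ᵐ[Ω.vol] fun x => (χ x : ℂ) • H1.val v x :=
  (memLp_mul_test Ω hχ.continuous (Lp.memLp (H1.val v))).coeFn_toLp

lemma H1.grad_cutoff {Ω : LipschitzDomain d} (χ : RSpace d → ℝ) (hχ : ContDiff ℝ ∞ χ) (v : H1 Ω) :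
    H1.grad (H1.cutoff χ hχ v) =ᵐ[Ω.vol] productGrad χ (H1.val v) (H1.grad v) :=
  (memLp_productGrad Ω hχ (H1.val v) (H1.grad v)).coeFn_toLp

/-! ### Density of smooth functions -/

section Density

open scoped Convolution
open ContinuousLinearMap (lsmul)

/-- The derivative of a mollification of the extension by zero, expressed by the weak gradient,
at points whose mollification neighbourhood either stays in `Ω` or misses the support. -/
lemma classicalGrad_mollify {Ω : LipschitzDomain d} (w : H1 Ω) {S : Set (RSpace d)}
    (hS0 : ∀ᵐ x ∂Ω.vol, x ∉ S → H1.val w x = 0 ∧ H1.grad w x = 0)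
    {ρ : RSpace d → ℝ} (hρ : ContDiff ℝ ∞ ρ) (hρs : HasCompactSupport ρ) {x : RSpace d}
    (hx : (∀ t ∈ tsupport ρ, x - t ∈ Ω.carrier) ∨ (∀ t ∈ tsupport ρ, x - t ∉ S)) :
    classicalGrad (ρ ⋆[lsmul ℝ ℝ, volume] Ω.carrier.indicator (H1.val w)) x
      = (ρ ⋆[lsmul ℝ ℝ, volume] Ω.carrier.indicator (H1.grad w)) x := by
  have hΩm := Ω.isOpen.measurableSet
  have hu : LocallyIntegrable (Ω.carrier.indicator (H1.val w)) volume :=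
    ((integrable_indicator_iff hΩm).2 ((Lp.memLp (H1.val w)).integrable (by norm_num))).locallyIntegrable
  have hg : LocallyIntegrable (Ω.carrier.indicator (H1.grad w)) volume :=
    ((integrable_indicator_iff hΩm).2 ((Lp.memLp (H1.grad w)).integrable (by norm_num))).locallyIntegrable
  ext i
  set e : RSpace d := EuclideanSpace.single i 1 with he
  have hρ1 : ContDiff ℝ 1 ρ := hρ.of_le (by simp)
  have hρ'c : Continuous fun t => fderiv ℝ ρ t := hρ.continuous_fderiv (by simp)
  -- The derivative of the convolution falls on ρ, so the claim at x is the weak gradient equation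
  -- with test function ρ(x - ·). In the first case this function is supported in Ω; in the second
  -- both sides vanish, because the support avoids S.
  set ψ : RSpace d → ℝ := fun y => ρ (x - y) with hψ
  have hψd : ContDiff ℝ ∞ ψ := hρ.comp (contDiff_const.sub contDiff_id)
  have hψs : HasCompactSupport ψ := hρs.comp_homeomorph (Homeomorph.subLeft x)
  have hψsupp : ∀ y ∈ tsupport ψ, x - y ∈ tsupport ρ := by
    intro y hy
    have : tsupport ψ = (Homeomorph.subLeft x) ⁻¹' tsupport ρ :=
      tsupport_comp_eq_preimage ρ (Homeomorph.subLeft x)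
    rw [this] at hy
    exact hy
  have hψ' : ∀ y, fderiv ℝ ψ y e = - fderiv ℝ ρ (x - y) e := by
    intro y
    have h1 : HasFDerivAt (fun y : RSpace d => x - y) (-ContinuousLinearMap.id ℝ (RSpace d)) y := by
      simpa using (hasFDerivAt_id y).const_sub x
    have h2 := ((hρ.differentiable (by simp) (x - y)).hasFDerivAt.comp y h1).fderiv
    change fderiv ℝ (ρ ∘ fun y => x - y) y e = _
    rw [h2]
    simp
  have hInt' : Integrable (fun t => ((lsmul ℝ ℝ : ℝ →L[ℝ] ℂ →L[ℝ] ℂ).precompL (RSpace d))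
      (fderiv ℝ ρ (x - t)) (Ω.carrier.indicator (H1.val w) t)) volume :=
    ((hρs.fderiv ℝ).convolutionExists_left _ hρ'c hu x).integrable_swap
  have eL : classicalGrad (ρ ⋆[lsmul ℝ ℝ, volume] Ω.carrier.indicator (H1.val w)) x i
      = - ∫ y, (fderiv ℝ ψ y e : ℂ) * H1.val w y ∂Ω.vol := by
    rw [classicalGrad_apply, (hρs.hasFDerivAt_convolution_left (lsmul ℝ ℝ) hρ1 hu x).fderiv,
      convolution_eq_swap,
      ContinuousLinearMap.integral_apply hInt',
      ← integral_neg, ← integral_indicator hΩm]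
    refine integral_congr_ae (ae_of_all _ fun y => ?_)
    by_cases hy : y ∈ Ω.carrier
    · simp only [hψ', indicator_of_mem hy]
      simp [he]
    · simp [hy]
  have eR : (ρ ⋆[lsmul ℝ ℝ, volume] Ω.carrier.indicator (H1.grad w)) x i
      = ∫ y, (ψ y : ℂ) * H1.grad w y i ∂Ω.vol := by
    rw [convolution_eq_swap, ← integral_indicator hΩm]
    have hInt : Integrable (fun t => (lsmul ℝ ℝ) (ρ (x - t)) (Ω.carrier.indicator (H1.grad w) t))
        volume := by
      have := (hρs.convolutionExists_left (lsmul ℝ ℝ) hρ.continuous hg) x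
      exact this.integrable_swap
    have hc := ((EuclideanSpace.proj (𝕜 := ℂ) i : CSpace d →L[ℂ] ℂ)).integral_comp_comm hInt
    rw [show ∀ z : CSpace d, z i = (EuclideanSpace.proj (𝕜 := ℂ) i : CSpace d →L[ℂ] ℂ) z from
      fun _ => rfl, ← hc]
    refine integral_congr_ae (ae_of_all _ fun y => ?_)
    by_cases hy : y ∈ Ω.carrier
    · simp [hy, hψ]
    · simp [hy]
  rw [eL, eR]
  rcases hx with hx | hx
  · have hsub : tsupport ψ ⊆ Ω.carrier := by
      intro y hy
      simpa using hx _ (hψsupp y hy)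
    rw [w.isWeakGradient ψ hψd hψs hsub i, neg_neg]
  · have z1 : (fun y => (fderiv ℝ ψ y e : ℂ) * H1.val w y) =ᵐ[Ω.vol] 0 := by
      filter_upwards [hS0] with y hy
      by_cases hyS : y ∈ S
      · have : y ∉ tsupport ψ := fun h => hx _ (hψsupp y h) (by simpa using hyS)
        rw [image_eq_zero_of_notMem_tsupport (fun h => this (tsupport_fderiv_subset ℝ h))]
        simp
      · simp [(hy hyS).1]
    have z2 : (fun y => (ψ y : ℂ) * H1.grad w y i) =ᵐ[Ω.vol] 0 := by
      filter_upwards [hS0] with y hy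
      by_cases hyS : y ∈ S
      · have : y ∉ tsupport ψ := fun h => hx _ (hψsupp y h) (by simpa using hyS)
        rw [image_eq_zero_of_notMem_tsupport this]
        simp
      · simp [(hy hyS).2]
    rw [integral_congr_ae z1, integral_congr_ae z2]
    simp

lemma H1.enorm_sq {Ω : LipschitzDomain d} (v : H1 Ω) :
    ‖v‖ₑ ^ 2 = ‖H1.val v‖ₑ ^ 2 + ‖H1.grad v‖ₑ ^ 2 := by
  have h : ‖v‖₊ ^ 2 = ‖H1.val v‖₊ ^ 2 + ‖H1.grad v‖₊ ^ 2 := by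
    rw [← NNReal.coe_inj]
    push_cast
    exact v.norm_sq
  simp only [enorm_eq_nnnorm]
  exact_mod_cast h

lemma enorm_sub_le_of_eLpNorm_sub_le {Ω : LipschitzDomain d} {F : Type*} [NormedAddCommGroup F]
    {a b : Lp F 2 Ω.vol} {f : RSpace d → F} {η : ℝ≥0∞} (hb : b =ᵐ[Ω.vol] f)
    (h : eLpNorm (fun x => f x - Ω.carrier.indicator a x) 2 volume ≤ η) : ‖a - b‖ₑ ≤ η := by
  rw [← enorm_neg, neg_sub, Lp.enorm_def]
  refine le_trans (le_of_eq_of_le (eLpNorm_congr_ae (g := fun x => f x - Ω.carrier.indicator a x)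
    ?_) (eLpNorm_mono_measure _ Measure.restrict_le_self)) h
  filter_upwards [Lp.coeFn_sub b a, hb, ae_restrict_mem Ω.isOpen.measurableSet] with x h1 h2 h3
  rw [h1, Pi.sub_apply, h2, indicator_of_mem h3]

/-- Mollification of the zero extension fails near ∂Ω if the kernel is centred, because it sees the
jump across the boundary. Centring the kernel at -εe makes it sample w around x + εe, inside Ω by
the cone condition. Points of Ω outside U are too far from S to be affected. -/
lemma mem_closure_range_ofSmooth_of_cone {Ω : LipschitzDomain d} (w : H1 Ω) {S : Set (RSpace d)}
    (hS : IsCompact S) (hS0 : ∀ᵐ x ∂Ω.vol, x ∉ S → H1.val w x = 0 ∧ H1.grad w x = 0)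
    {U : Set (RSpace d)} (hU : IsOpen U) (hSU : S ⊆ U) {e : RSpace d} {δ ε₀ : ℝ} (hδ : 0 < δ)
    (hε₀ : 0 < ε₀) (hcone : ∀ x ∈ Ω.carrier ∩ U, ∀ ε ∈ Ioc (0 : ℝ) ε₀,
      Metric.closedBall (x + ε • e) (ε * δ) ⊆ Ω.carrier) :
    w ∈ closure (range (ofSmooth Ω)) := by
  have hΩm := Ω.isOpen.measurableSet
  have hu : MemLp (Ω.carrier.indicator (H1.val w)) 2 volume :=
    (memLp_indicator_iff_restrict hΩm).2 (Lp.memLp (H1.val w))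
  have hg : MemLp (Ω.carrier.indicator (H1.grad w)) 2 volume :=
    (memLp_indicator_iff_restrict hΩm).2 (Lp.memLp (H1.grad w))
  rw [EMetric.mem_closure_iff]
  intro η hη
  obtain ⟨κ, hκ, hκη⟩ : ∃ κ : ℝ≥0∞, 0 < κ ∧ κ + κ < η := by
    obtain ⟨κ, hκ, h⟩ := ENNReal.lt_iff_exists_nnreal_btwn.1 hη
    refine ⟨κ / 2, ENNReal.half_pos (by simpa using hκ.ne'), ?_⟩
    rwa [ENNReal.add_halves]
  obtain ⟨r₁, hr₁, h₁⟩ := exists_translate_lt hu hκ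
  obtain ⟨r₂, hr₂, h₂⟩ := exists_translate_lt hg hκ
  obtain ⟨r₃, hr₃, h₃⟩ := hS.exists_thickening_subset_open hU hSU
  -- Every t in the support of the kernel has ‖t‖ ≤ ε(‖e‖ + δ). This is kept below the two
  -- translation thresholds and below the width r₃ of the margin around S inside U.
  obtain ⟨ε, hε, hε', hεr⟩ : ∃ ε > 0, ε ≤ ε₀ ∧ ε * (‖e‖ + δ) < min r₁ (min r₂ r₃) := by
    set m := min r₁ (min r₂ r₃)
    have hm : 0 < m := lt_min hr₁ (lt_min hr₂ hr₃)
    have hp : 0 < ‖e‖ + δ := by positivity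
    refine ⟨min ε₀ (m / (2 * (‖e‖ + δ))), by positivity, min_le_left _ _, ?_⟩
    calc min ε₀ (m / (2 * (‖e‖ + δ))) * (‖e‖ + δ) ≤ m / (2 * (‖e‖ + δ)) * (‖e‖ + δ) := by
          gcongr
          exact min_le_right _ _
      _ = m / 2 := by field_simp
      _ < m := by linarith
  let b : ContDiffBump (-(ε • e)) := ⟨ε * δ / 2, ε * δ, by positivity, by nlinarith [mul_pos hε hδ]⟩
  set ρ : RSpace d → ℝ := b.normed volume with hρ
  have hρd : ContDiff ℝ ∞ ρ := b.contDiff_normed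
  have hρs : HasCompactSupport ρ := b.hasCompactSupport_normed
  have hts : tsupport ρ = Metric.closedBall (-(ε • e)) (ε * δ) := b.tsupport_normed_eq
  have hsmall : ∀ t ∈ tsupport ρ, ‖t‖ < min r₁ (min r₂ r₃) := by
    intro t ht
    rw [hts, Metric.mem_closedBall, dist_eq_norm, sub_neg_eq_add] at ht
    refine lt_of_le_of_lt ?_ hεr
    calc ‖t‖ = ‖(t + ε • e) - ε • e‖ := by rw [add_sub_cancel_right]
      _ ≤ ε * δ + ε * ‖e‖ := by
          refine (norm_sub_le _ _).trans (add_le_add ht ?_)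
          rw [norm_smul, Real.norm_of_nonneg hε.le]
      _ = _ := by ring
  set φ : Smooth d := ⟨ρ ⋆[lsmul ℝ ℝ, volume] Ω.carrier.indicator (H1.val w),
    hρs.contDiff_convolution_left _ hρd (hu.locallyIntegrable (by norm_num))⟩ with hφ
  refine ⟨ofSmooth Ω φ, ⟨φ, rfl⟩, ?_⟩
  have hgrad : H1.grad (ofSmooth Ω φ) =ᵐ[Ω.vol]
      ρ ⋆[lsmul ℝ ℝ, volume] Ω.carrier.indicator (H1.grad w) := by
    filter_upwards [grad_ofSmooth Ω φ, ae_restrict_mem hΩm] with x hx hxΩ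
    rw [hx]
    refine classicalGrad_mollify w hS0 hρd hρs ?_
    by_cases hxU : x ∈ U
    · left
      intro t ht
      refine hcone x ⟨hxΩ, hxU⟩ ε ⟨hε, hε'⟩ ?_
      rw [hts, Metric.mem_closedBall, dist_eq_norm, sub_neg_eq_add] at ht
      rw [Metric.mem_closedBall, dist_eq_norm, ← norm_neg]
      rw [show -(x - t - (x + ε • e)) = t + ε • e by abel]
      exact ht
    · right
      intro t ht hxt
      refine hxU (h₃ (Metric.mem_thickening_iff.2 ⟨x - t, hxt, ?_⟩))
      rw [dist_eq_norm, sub_sub_cancel]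
      exact (hsmall t ht).trans_le ((min_le_right _ _).trans (min_le_right _ _))
  have n1 : ‖H1.val w - H1.val (ofSmooth Ω φ)‖ₑ ≤ κ := by
    refine enorm_sub_le_of_eLpNorm_sub_le (val_ofSmooth Ω φ) ?_
    refine eLpNorm_mollify_sub_le hu hρd.continuous hρs (fun t => b.nonneg_normed t)
      b.integral_normed fun t ht => h₁ t ?_
    exact ((hsmall t (subset_tsupport _ ht)).trans_le (min_le_left _ _)).le
  have n2 : ‖H1.grad w - H1.grad (ofSmooth Ω φ)‖ₑ ≤ κ := by
    refine enorm_sub_le_of_eLpNorm_sub_le hgrad ?_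
    refine eLpNorm_mollify_sub_le hg hρd.continuous hρs (fun t => b.nonneg_normed t)
      b.integral_normed fun t ht => h₂ t ?_
    exact ((hsmall t (subset_tsupport _ ht)).trans_le
      ((min_le_right _ _).trans (min_le_left _ _))).le
  rw [edist_eq_enorm_sub]
  refine lt_of_le_of_lt ?_ hκη
  rw [← ENNReal.pow_le_pow_left_iff (n := 2) (by norm_num), H1.enorm_sq]
  calc ‖H1.val w - H1.val (ofSmooth Ω φ)‖ₑ ^ 2 + ‖H1.grad w - H1.grad (ofSmooth Ω φ)‖ₑ ^ 2
      ≤ κ ^ 2 + κ ^ 2 := add_le_add (pow_le_pow_left' n1 2) (pow_le_pow_left' n2 2)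
    _ ≤ κ ^ 2 + κ ^ 2 + 2 * κ * κ := le_self_add
    _ = (κ + κ) ^ 2 := by ring

/-- A partition of unity on the closure of Ω, subordinate to balls in which a cone is available,
splits v into finitely many pieces to which the off-centre mollification applies. -/
theorem denseRange_ofSmooth (Ω : LipschitzDomain d) : DenseRange (ofSmooth Ω) := by
  intro v
  choose! r hr e δ hδ ε₀ hε₀ hcone using fun (p : RSpace d) (hp : p ∈ closure Ω.carrier) =>
    exists_cone Ω hp
  obtain ⟨t, ht, hcov⟩ := Ω.isCompact_closure.elim_nhds_subcover (fun p => Metric.ball p (r p))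
    fun p hp => Metric.ball_mem_nhds p (hr p hp)
  obtain ⟨f, hf⟩ := SmoothPartitionOfUnity.exists_isSubordinate (modelWithCornersSelf ℝ (RSpace d))
    (isClosed_closure (s := Ω.carrier)) (fun p : t => Metric.ball (p : RSpace d) (r p))
    (fun _ => Metric.isOpen_ball) (by
      intro x hx
      obtain ⟨p, hp, hxp⟩ := mem_iUnion₂.1 (hcov hx)
      exact mem_iUnion.2 ⟨⟨p, hp⟩, hxp⟩)
  have hfs : ∀ p : t, ContDiff ℝ ∞ (f p) := fun p => (f p).contMDiff.contDiff
  have hsum : v = ∑ p : t, H1.cutoff (f p) (hfs p) v := by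
    apply H1.ext_val
    have e1 : H1.val (∑ p : t, H1.cutoff (f p) (hfs p) v)
        = ∑ p : t, H1.val (H1.cutoff (f p) (hfs p) v) := by
      simp only [← H1.valL_apply, map_sum]
    rw [e1]
    refine Lp.ext ?_
    have e2 := ae_all_iff.2 fun p : t => H1.val_cutoff (f p) (hfs p) v
    filter_upwards [e2, ae_restrict_mem Ω.isOpen.measurableSet,
      Lp.coeFn_finsetSum Finset.univ fun p : t => H1.val (H1.cutoff (f p) (hfs p) v)]
      with x hx hxΩ hs
    rw [hs, Finset.sum_apply]
    simp only [hx, ← Finset.sum_smul]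
    have := f.sum_eq_one (subset_closure hxΩ)
    rw [finsum_eq_sum_of_fintype] at this
    rw [← Complex.ofReal_sum, this]
    simp
  have hmem : v ∈ (LinearMap.range (ofSmooth Ω)).topologicalClosure := by
    rw [hsum]
    refine Submodule.sum_mem _ fun p _ => ?_
    have hp := ht p.1 p.2
    have hcs : IsCompact (tsupport (f p)) :=
      Metric.isCompact_of_isClosed_isBounded (isClosed_tsupport _)
        (Metric.isBounded_ball.subset (hf p))
    refine mem_closure_range_ofSmooth_of_cone _ hcs ?_ Metric.isOpen_ball (hf p)
      (hδ p hp) (hε₀ p hp) (hcone p hp)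
    filter_upwards [H1.val_cutoff (f p) (hfs p) v, H1.grad_cutoff (f p) (hfs p) v] with x h1 h2 hx
    have hx1 : f p x = 0 := image_eq_zero_of_notMem_tsupport hx
    have hx2 : fderiv ℝ (f p) x = 0 :=
      image_eq_zero_of_notMem_tsupport fun h => hx (tsupport_fderiv_subset ℝ h)
    rw [h1, h2]
    refine ⟨by simp [hx1], ?_⟩
    ext i
    simp [productGrad_apply, hx1, hx2]
  exact hmem

end Density

/-! ### Lipschitz graphs -/

section Graph

variable {e : RSpace d} {γ : (ℝ ∙ e)ᗮ → ℝ}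

/-- The parametrisation of the graph of `γ` over the hyperplane orthogonal to `e`. -/
def graphMap (e : RSpace d) (γ : (ℝ ∙ e)ᗮ → ℝ) (y : (ℝ ∙ e)ᗮ) : RSpace d := y + γ y • e

lemma inner_coe_orthogonal (y : (ℝ ∙ e)ᗮ) : inner ℝ e (y : RSpace d) = 0 :=
  Submodule.mem_orthogonal_singleton_iff_inner_right.1 y.2

lemma proj_graphMap_add (y : (ℝ ∙ e)ᗮ) (t : ℝ) :
    (ℝ ∙ e)ᗮ.orthogonalProjectionOnto (graphMap e γ y + t • e) = y := by
  rw [graphMap, add_assoc, ← add_smul, map_add, map_smul,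
    Submodule.orthogonalProjectionOnto_orthogonal_apply_eq_zero
      (Submodule.mem_span_singleton_self e), smul_zero, add_zero,
    Submodule.orthogonalProjectionOnto_mem_subspace_eq_self]

lemma proj_graphMap (y : (ℝ ∙ e)ᗮ) :
    (ℝ ∙ e)ᗮ.orthogonalProjectionOnto (graphMap e γ y) = y := by
  simpa using proj_graphMap_add (γ := γ) y 0

lemma inner_graphMap_add (he : ‖e‖ = 1) (y : (ℝ ∙ e)ᗮ) (t : ℝ) :
    inner ℝ e (graphMap e γ y + t • e) = γ y + t := by
  rw [graphMap, add_assoc, ← add_smul, inner_add_right, inner_smul_right, inner_coe_orthogonal,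
    real_inner_self_eq_norm_sq, he]
  ring

lemma eq_proj_add (he : ‖e‖ = 1) (x : RSpace d) :
    x = ((ℝ ∙ e)ᗮ.orthogonalProjectionOnto x : RSpace d) + inner ℝ e x • e := by
  have h1 := Submodule.starProjection_add_starProjection_orthogonal (K := ℝ ∙ e) x
  rw [Submodule.starProjection_unit_singleton ℝ he] at h1
  rw [add_comm]
  exact h1.symm

lemma eq_graphMap (he : ‖e‖ = 1) {x : RSpace d}
    (hx : inner ℝ e x = γ ((ℝ ∙ e)ᗮ.orthogonalProjectionOnto x)) :
    graphMap e γ ((ℝ ∙ e)ᗮ.orthogonalProjectionOnto x) = x := by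
  rw [graphMap, ← hx, ← eq_proj_add he]

lemma lipschitzWith_graphMap (he : ‖e‖ = 1) {K : NNReal} (hK : LipschitzWith K γ) :
    LipschitzWith (1 + K) (graphMap e γ) := by
  refine LipschitzWith.add (LipschitzWith.subtype_val _) ?_
  refine LipschitzWith.of_dist_le_mul fun x y => ?_
  rw [dist_eq_norm, ← sub_smul, norm_smul, he, mul_one, ← dist_eq_norm]
  exact hK.dist_le_mul x y

lemma finrank_orthogonal_span (he : ‖e‖ = 1) : Module.finrank ℝ (ℝ ∙ e)ᗮ = d - 1 := by
  have h := Submodule.finrank_add_finrank_orthogonal (ℝ ∙ e)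
  rw [finrank_span_singleton (fun h0 => by simp [h0] at he), finrank_euclideanSpace_fin] at h
  omega

lemma euclideanHausdorffMeasure_image_le_of_lipschitzWith {X Y : Type*} [EMetricSpace X]
    [EMetricSpace Y] [MeasurableSpace X] [BorelSpace X] [MeasurableSpace Y] [BorelSpace Y]
    {f : X → Y} {L : NNReal} (hf : LipschitzWith L f) (n : ℕ) (s : Set X) :
    μHE[n] (f '' s) ≤ (L : ℝ≥0∞) ^ n * μHE[n] s := by
  rw [Measure.euclideanHausdorffMeasure_def, Measure.euclideanHausdorffMeasure_def,
    Measure.smul_apply, Measure.smul_apply, mul_smul_comm]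
  gcongr
  have := hf.hausdorffMeasure_image_le (d := n) (Nat.cast_nonneg n) s
  simpa using this

/-- The graph map is (1+K)-Lipschitz. Together with the reverse inequality below this replaces the
area formula: only comparability of surface measure with Lebesgue measure on the hyperplane is
needed. -/
lemma hausdorff_image_graphMap_le (he : ‖e‖ = 1) {K : NNReal} (hK : LipschitzWith K γ)
    (s : Set (ℝ ∙ e)ᗮ) :
    μHE[d - 1] (graphMap e γ '' s) ≤ ((1 + K : NNReal) : ℝ≥0∞) ^ (d - 1) * volume s := by
  refine (euclideanHausdorffMeasure_image_le_of_lipschitzWith (lipschitzWith_graphMap he hK) _ s).trans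
    (le_of_eq ?_)
  rw [← InnerProductSpace.euclideanHausdorffMeasure_eq_volume, finrank_orthogonal_span he]

/-- The orthogonal projection is 1-Lipschitz and inverts the graph map. -/
lemma volume_le_hausdorff_image_graphMap (he : ‖e‖ = 1) (s : Set (ℝ ∙ e)ᗮ) :
    volume s ≤ μHE[d - 1] (graphMap e γ '' s) := by
  have hL : LipschitzWith 1 ((ℝ ∙ e)ᗮ.orthogonalProjectionOnto) :=
    Submodule.lipschitzWith_orthogonalProjectionOnto _
  have h := euclideanHausdorffMeasure_image_le_of_lipschitzWith hL (d - 1) (graphMap e γ '' s)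
  rw [image_image] at h
  simp only [proj_graphMap, image_id', ENNReal.coe_one, one_pow, one_mul] at h
  rwa [← InnerProductSpace.euclideanHausdorffMeasure_eq_volume, finrank_orthogonal_span he]

/-- Flattening the graph is a shear, a translation on each fibre, followed by the orthogonal
splitting of ℝ^d. It preserves volume, even though γ need not be differentiable. -/
lemma measurePreserving_graphMap_add (he : ‖e‖ = 1) (hγ : Measurable γ) :
    MeasurePreserving (fun q : (ℝ ∙ e)ᗮ × ℝ => graphMap e γ q.1 + q.2 • e)
      (volume.prod volume) volume := by
  have h1 : MeasurePreserving (fun q : (ℝ ∙ e)ᗮ × ℝ => (q.1, γ q.1 + q.2))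
      (volume.prod volume) (volume.prod volume) := by
    refine (MeasurePreserving.id (volume : Measure (ℝ ∙ e)ᗮ)).skew_product
      (g := fun y t => γ y + t) ?_ (ae_of_all _ fun y => ?_)
    · exact (hγ.comp measurable_fst).add measurable_snd
    · exact (measurePreserving_add_left volume (γ y)).map_eq
  have h2 : MeasurePreserving (Prod.map id (LinearIsometryEquiv.toSpanUnitSingleton (𝕜 := ℝ) e he))
      ((volume : Measure (ℝ ∙ e)ᗮ).prod volume) (volume.prod volume) :=
    (MeasurePreserving.id _).prod (LinearIsometryEquiv.measurePreserving _)
  have h3 : MeasurePreserving Prod.swap ((volume : Measure (ℝ ∙ e)ᗮ).prod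
      (volume : Measure (ℝ ∙ e))) (volume.prod volume) := Measure.measurePreserving_swap
  have h4 := (Submodule.measurePreserving_measurableEquivProd (ℝ ∙ e) (0 : RSpace d)).symm
  rw [InnerProductSpace.euclideanHausdorffMeasure_eq_volume] at h4
  have h := h4.comp (h3.comp (h2.comp h1))
  have hfun : (fun q : (ℝ ∙ e)ᗮ × ℝ => graphMap e γ q.1 + q.2 • e) =
      ((ℝ ∙ e).measurableEquivProd (0 : RSpace d)).symm ∘ Prod.swap ∘
        Prod.map id (LinearIsometryEquiv.toSpanUnitSingleton (𝕜 := ℝ) e he) ∘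
          fun q : (ℝ ∙ e)ᗮ × ℝ => (q.1, γ q.1 + q.2) := by
    funext q
    simp only [Function.comp_apply, Prod.map_apply, id_eq, Prod.swap_prod_mk,
      Submodule.measurableEquivProd_symm_apply, LinearIsometryEquiv.toSpanUnitSingleton_apply,
      graphMap, add_smul, vadd_eq_add, add_zero]
    abel
  rw [hfun]
  exact h

end Graph

/-! ### Boundary charts -/

/-- A point strictly below the graph has a neighbourhood missing Ω, and a point on the graph is the
limit of the points x + te of Ω as t decreases to 0. -/
lemma mem_frontier_iff_of_chart (Ω : LipschitzDomain d) {U : Set (RSpace d)} (hU : IsOpen U)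
    {e : RSpace d} (he : ‖e‖ = 1) {γ : (ℝ ∙ e)ᗮ → ℝ} (hγc : Continuous γ)
    (hγ : Ω.carrier ∩ U = {y | γ ((ℝ ∙ e)ᗮ.orthogonalProjectionOnto y) < inner ℝ e y} ∩ U)
    {x : RSpace d} (hx : x ∈ U) :
    x ∈ frontier Ω.carrier ↔ inner ℝ e x = γ ((ℝ ∙ e)ᗮ.orthogonalProjectionOnto x) := by
  have hmem : ∀ y ∈ U, (y ∈ Ω.carrier ↔
      γ ((ℝ ∙ e)ᗮ.orthogonalProjectionOnto y) < inner ℝ e y) := by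
    intro y hy
    have := Set.ext_iff.1 hγ y
    simpa [hy] using this
  have c1 : Continuous fun y : RSpace d => γ ((ℝ ∙ e)ᗮ.orthogonalProjectionOnto y) :=
    hγc.comp (ContinuousLinearMap.continuous _)
  have c2 : Continuous fun y : RSpace d => inner ℝ e y := continuous_const.inner continuous_id
  rw [frontier, Ω.isOpen.interior_eq, mem_sdiff, hmem x hx, not_lt]
  constructor
  · rintro ⟨hcl, hle⟩
    refine le_antisymm hle (not_lt.1 fun hlt => ?_)
    have hopen : IsOpen (U ∩ {y | inner ℝ e y < γ ((ℝ ∙ e)ᗮ.orthogonalProjectionOnto y)}) :=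
      hU.inter (isOpen_lt c2 c1)
    obtain ⟨y, ⟨hyU, hy⟩, hyΩ⟩ := mem_closure_iff.1 hcl _ hopen ⟨hx, hlt⟩
    exact lt_asymm ((hmem y hyU).1 hyΩ) hy
  · intro heq
    refine ⟨?_, heq.le⟩
    have ht : Filter.Tendsto (fun t : ℝ => x + t • e) (nhdsWithin 0 (Ioi 0)) (nhds x) := by
      have : Continuous fun t : ℝ => x + t • e := by fun_prop
      have h := this.tendsto 0
      simp only [zero_smul, add_zero] at h
      exact h.mono_left nhdsWithin_le_nhds
    refine mem_closure_of_tendsto ht ?_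
    filter_upwards [ht (hU.mem_nhds hx), self_mem_nhdsWithin] with t htU ht0
    rw [hmem _ htU, ← eq_graphMap he heq, proj_graphMap_add, inner_graphMap_add he]
    exact lt_add_of_pos_right _ ht0

/-! ### The fundamental theorem of calculus along segments -/

/-- The fundamental theorem of calculus along the segment, then Cauchy–Schwarz in the parameter. -/
lemma enorm_sub_sq_le_lintegral {φ : RSpace d → ℂ} (hφ : ContDiff ℝ ∞ φ) (x h : RSpace d) {t : ℝ}
    (ht : 0 ≤ t) : ‖φ (x + t • h) - φ x‖ₑ ^ 2 ≤
      ENNReal.ofReal t * ‖h‖ₑ ^ 2 * ∫⁻ s in Ioc 0 t, ‖classicalGrad φ (x + s • h)‖ₑ ^ 2 := by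
  have hl : Continuous fun s : ℝ => x + s • h := by fun_prop
  have hder : ∀ s : ℝ, HasDerivAt (fun s : ℝ => φ (x + s • h)) (fderiv ℝ φ (x + s • h) h) s := by
    intro s
    have h1 : HasDerivAt (fun s : ℝ => x + s • h) h s := by
      simpa using ((hasDerivAt_id s).smul_const h).const_add x
    exact ((hφ.differentiable (by simp) _).hasFDerivAt).comp_hasDerivAt s h1
  have hcont : Continuous fun s : ℝ => fderiv ℝ φ (x + s • h) h :=
    ((hφ.continuous_fderiv (by simp)).comp hl).clm_apply continuous_const
  have hftc := intervalIntegral.integral_eq_sub_of_hasDerivAt (a := 0) (b := t)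
    (fun s _ => hder s) (hcont.intervalIntegrable _ _)
  simp only [zero_smul, add_zero] at hftc
  rw [← hftc, intervalIntegral.integral_of_le ht]
  have hm : Measurable fun s : ℝ => ‖classicalGrad φ (x + s • h)‖ₑ :=
    ((continuous_classicalGrad hφ).comp hl).measurable.enorm
  calc ‖∫ s in Ioc 0 t, fderiv ℝ φ (x + s • h) h‖ₑ ^ 2
      ≤ (∫⁻ s in Ioc 0 t, ‖classicalGrad φ (x + s • h)‖ₑ * ‖h‖ₑ) ^ 2 := by
        refine pow_le_pow_left' ((enorm_integral_le_lintegral_enorm _).trans ?_) 2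
        refine lintegral_mono fun s => ?_
        have := norm_fderiv_apply_le φ (x + s • h) h
        rw [← ofReal_norm, ← ofReal_norm, ← ofReal_norm, ← ENNReal.ofReal_mul (norm_nonneg _)]
        exact ENNReal.ofReal_le_ofReal this
    _ ≤ (volume.restrict (Ioc 0 t)) univ *
        ∫⁻ s in Ioc 0 t, (‖classicalGrad φ (x + s • h)‖ₑ * ‖h‖ₑ) ^ 2 :=
        sq_lintegral_le _ (hm.mul_const _).aemeasurable
    _ = _ := by
        simp only [mul_pow]
        rw [lintegral_mul_const _ (hm.pow_const 2), Measure.restrict_apply_univ, Real.volume_Ioc,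
          sub_zero]
        ring

/-! ### The trace inequality -/

/-- A boundary value φ(G y) is compared with the values φ(G y + te) above it and averaged over 0 < t
≤ r. The volume-preserving flattening then turns the integrals over y and t into integrals over part
of Ω. -/
lemma exists_trace_bound_near (Ω : LipschitzDomain d) {p : RSpace d}
    (hp : p ∈ frontier Ω.carrier) :
    ∃ r > 0, ∃ C : ℝ≥0∞, C ≠ ⊤ ∧ ∀ φ : RSpace d → ℂ, ContDiff ℝ ∞ φ →
      ∫⁻ x in Metric.ball p r ∩ frontier Ω.carrier, ‖φ x‖ₑ ^ 2 ∂μHE[d - 1] ≤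
        C * (∫⁻ x, ‖φ x‖ₑ ^ 2 ∂Ω.vol + ∫⁻ x, ‖classicalGrad φ x‖ₑ ^ 2 ∂Ω.vol) := by
  obtain ⟨U, hU, hpU, e, he, γ, ⟨K, hK⟩, hγ⟩ := Ω.lipschitz p hp
  obtain ⟨R, hR, hball⟩ := Metric.isOpen_iff.1 hU p hpU
  -- Half the chart radius, so that a graph point within r of p stays in the chart after being
  -- lifted by at most r.
  set r : ℝ := R / 2 with hr
  have hr0 : 0 < r := by positivity
  set G := graphMap e γ with hG
  have hGc : Continuous G := (lipschitzWith_graphMap he hK).continuous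
  set D : Set (ℝ ∙ e)ᗮ := G ⁻¹' Metric.ball p r with hD
  have hDm : MeasurableSet D := (Metric.isOpen_ball.preimage hGc).measurableSet
  have hAm : MeasurableSet (Metric.ball p r ∩ frontier Ω.carrier) :=
    Metric.isOpen_ball.measurableSet.inter isClosed_frontier.measurableSet
  set Λ : ℝ≥0∞ := ((1 + K : NNReal) : ℝ≥0∞) ^ (d - 1) with hΛ
  have hmeas : μHE[d - 1].restrict (Metric.ball p r ∩ frontier Ω.carrier)
      ≤ Λ • Measure.map G (volume.restrict D) := by
    refine Measure.le_iff.2 fun s hs => ?_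
    rw [Measure.restrict_apply hs, Measure.smul_apply, Measure.map_apply hGc.measurable hs,
      Measure.restrict_apply (hGc.measurable hs), smul_eq_mul]
    refine le_trans (measure_mono ?_) (hausdorff_image_graphMap_le he hK _)
    rintro x ⟨hxs, hxb, hxf⟩
    have hxU : x ∈ U := hball (Metric.ball_subset_ball (by linarith) hxb)
    have heq := eq_graphMap he ((mem_frontier_iff_of_chart Ω hU he hK.continuous hγ hxU).1 hxf)
    refine ⟨(ℝ ∙ e)ᗮ.orthogonalProjectionOnto x, ⟨?_, ?_⟩, heq⟩
    · rw [mem_preimage, hG, heq]; exact hxs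
    · rw [hD, mem_preimage, hG, heq]; exact hxb
  have hin : ∀ y ∈ D, ∀ t ∈ Ioc 0 r, G y + t • e ∈ Ω.carrier := by
    intro y hy t ht
    have hU' : G y + t • e ∈ U := by
      apply hball
      rw [hD, mem_preimage, Metric.mem_ball] at hy
      rw [Metric.mem_ball]
      have h1 : dist (G y + t • e) (G y) = t := by
        rw [dist_eq_norm, add_sub_cancel_left, norm_smul, he, mul_one, Real.norm_of_nonneg ht.1.le]
      have := ht.2
      linarith [dist_triangle (G y + t • e) (G y) p]
    have : G y + t • e ∈ Ω.carrier ∩ U := by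
      rw [hγ]
      refine ⟨?_, hU'⟩
      change γ ((ℝ ∙ e)ᗮ.orthogonalProjectionOnto (G y + t • e)) < inner ℝ e (G y + t • e)
      rw [hG, proj_graphMap_add, inner_graphMap_add he]
      linarith [ht.1]
    exact this.1
  have hΨ := measurePreserving_graphMap_add he hK.continuous.measurable
  have hfub : ∀ f : RSpace d → ℝ≥0∞, Measurable f →
      ∫⁻ y in D, ∫⁻ t in Ioc 0 r, f (G y + t • e) ≤ ∫⁻ x, f x ∂Ω.vol := by
    intro f hf
    rw [← lintegral_prod (μ := volume.restrict D) (ν := volume.restrict (Ioc 0 r))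
      (fun q : (ℝ ∙ e)ᗮ × ℝ => f (G q.1 + q.2 • e)) (hf.comp hΨ.measurable).aemeasurable,
      Measure.prod_restrict, ← hΨ.setLIntegral_comp_preimage Ω.isOpen.measurableSet hf]
    refine lintegral_mono_set ?_
    rintro ⟨y, t⟩ ⟨hy, ht⟩
    exact hin y hy t ht
  -- Averaging multiplies the boundary term by r, whence the inverse. The gradient term gets r once
  -- from Cauchy–Schwarz and once from the average. Λ compares surface measure with the hyperplane.
  refine ⟨r, hr0, Λ * ((ENNReal.ofReal r)⁻¹ * (2 + 2 * ENNReal.ofReal r ^ 2)), ?_, ?_⟩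
  · have : ENNReal.ofReal r ≠ 0 := by simpa using hr0
    finiteness
  intro φ hφ
  have hφm : Measurable fun x => ‖φ x‖ₑ ^ 2 := hφ.continuous.measurable.enorm.pow_const 2
  have hgm : Measurable fun x => ‖classicalGrad φ x‖ₑ ^ 2 :=
    (continuous_classicalGrad hφ).measurable.enorm.pow_const 2
  have hpt : ∀ y, ‖φ (G y)‖ₑ ^ 2 * ENNReal.ofReal r ≤
      2 * (∫⁻ t in Ioc 0 r, ‖φ (G y + t • e)‖ₑ ^ 2) +
        2 * ENNReal.ofReal r ^ 2 * ∫⁻ t in Ioc 0 r, ‖classicalGrad φ (G y + t • e)‖ₑ ^ 2 := by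
    intro y
    set Q := ∫⁻ t in Ioc 0 r, ‖classicalGrad φ (G y + t • e)‖ₑ ^ 2
    have hmy : Measurable fun t : ℝ => ‖φ (G y + t • e)‖ₑ ^ 2 :=
      hφm.comp (Continuous.measurable (by fun_prop))
    calc ‖φ (G y)‖ₑ ^ 2 * ENNReal.ofReal r = ∫⁻ t in Ioc 0 r, ‖φ (G y)‖ₑ ^ 2 := by
          rw [setLIntegral_const, Real.volume_Ioc, sub_zero]
      _ ≤ ∫⁻ t in Ioc 0 r, (2 * ‖φ (G y + t • e)‖ₑ ^ 2 + 2 * (ENNReal.ofReal r * Q)) := by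
          refine setLIntegral_mono' measurableSet_Ioc fun t ht => ?_
          have h1 := enorm_add_sq_le (φ (G y + t • e)) (-(φ (G y + t • e) - φ (G y)))
          rw [enorm_neg, neg_sub, add_sub_cancel] at h1
          refine h1.trans ?_
          gcongr
          refine (enorm_sub_sq_le_lintegral hφ (G y) e ht.1.le).trans ?_
          have he1 : ‖e‖ₑ = 1 := by rw [← ofReal_norm, he, ENNReal.ofReal_one]
          rw [he1, one_pow, mul_one]
          exact mul_le_mul' (ENNReal.ofReal_le_ofReal ht.2)
            (lintegral_mono_set (Ioc_subset_Ioc_right ht.2))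
      _ = _ := by
          rw [lintegral_add_right _ measurable_const, lintegral_const_mul _ hmy, setLIntegral_const,
            Real.volume_Ioc, sub_zero]
          ring
  have hr1 : ENNReal.ofReal r ≠ 0 := by simpa using hr0
  set X := ∫⁻ x, ‖φ x‖ₑ ^ 2 ∂Ω.vol
  set Y := ∫⁻ x, ‖classicalGrad φ x‖ₑ ^ 2 ∂Ω.vol
  have hjm : ∀ f : RSpace d → ℝ≥0∞, Measurable f →
      Measurable fun y => ∫⁻ t in Ioc 0 r, f (G y + t • e) := fun f hf =>
    Measurable.lintegral_prod_right' (ν := volume.restrict (Ioc 0 r))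
      (f := fun q : (ℝ ∙ e)ᗮ × ℝ => f (G q.1 + q.2 • e)) (hf.comp hΨ.measurable)
  have hD' : (∫⁻ y in D, ‖φ (G y)‖ₑ ^ 2) * ENNReal.ofReal r ≤
      2 * X + 2 * ENNReal.ofReal r ^ 2 * Y := by
    rw [← lintegral_mul_const' _ _ ENNReal.ofReal_ne_top]
    refine (lintegral_mono hpt).trans ?_
    rw [lintegral_add_left ((hjm _ hφm).const_mul 2), lintegral_const_mul _ (hjm _ hφm),
      lintegral_const_mul _ (hjm _ hgm)]
    exact add_le_add (mul_le_mul_right (hfub _ hφm) _) (mul_le_mul_right (hfub _ hgm) _)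
  calc ∫⁻ x in Metric.ball p r ∩ frontier Ω.carrier, ‖φ x‖ₑ ^ 2 ∂μHE[d - 1]
      ≤ Λ * ∫⁻ y in D, ‖φ (G y)‖ₑ ^ 2 := by
        refine (lintegral_mono' hmeas le_rfl).trans (le_of_eq ?_)
        rw [lintegral_smul_measure, lintegral_map hφm hGc.measurable, smul_eq_mul]
    _ ≤ Λ * ((ENNReal.ofReal r)⁻¹ * (2 * X + 2 * ENNReal.ofReal r ^ 2 * Y)) := by
        gcongr
        rw [mul_comm, ← div_eq_mul_inv, ENNReal.le_div_iff_mul_le (Or.inl hr1)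
          (Or.inl ENNReal.ofReal_ne_top)]
        exact hD'
    _ ≤ Λ * ((ENNReal.ofReal r)⁻¹ * ((2 + 2 * ENNReal.ofReal r ^ 2) * (X + Y))) := by
        gcongr
        calc 2 * X + 2 * ENNReal.ofReal r ^ 2 * Y
            ≤ 2 * X + 2 * ENNReal.ofReal r ^ 2 * Y + (2 * Y + 2 * ENNReal.ofReal r ^ 2 * X) :=
              le_self_add
          _ = _ := by ring
    _ = _ := by ring

theorem exists_trace_bound (Ω : LipschitzDomain d) :
    ∃ C : ℝ≥0∞, C ≠ ⊤ ∧ ∀ φ : RSpace d → ℂ, ContDiff ℝ ∞ φ →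
      ∫⁻ x, ‖φ x‖ₑ ^ 2 ∂Ω.surface ≤
        C * (∫⁻ x, ‖φ x‖ₑ ^ 2 ∂Ω.vol + ∫⁻ x, ‖classicalGrad φ x‖ₑ ^ 2 ∂Ω.vol) := by
  have hcpt : IsCompact (frontier Ω.carrier) :=
    Ω.isCompact_closure.of_isClosed_subset isClosed_frontier frontier_subset_closure
  refine IsCompact.induction_on (p := fun s => ∃ C : ℝ≥0∞, C ≠ ⊤ ∧ ∀ φ : RSpace d → ℂ,
    ContDiff ℝ ∞ φ → ∫⁻ x in s, ‖φ x‖ₑ ^ 2 ∂μHE[d - 1] ≤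
        C * (∫⁻ x, ‖φ x‖ₑ ^ 2 ∂Ω.vol + ∫⁻ x, ‖classicalGrad φ x‖ₑ ^ 2 ∂Ω.vol)) hcpt ?_ ?_ ?_ ?_
  · exact ⟨0, ENNReal.zero_ne_top, fun φ _ => by simp⟩
  · rintro s t hst ⟨C, hC, h⟩
    exact ⟨C, hC, fun φ hφ => (lintegral_mono_set hst).trans (h φ hφ)⟩
  · rintro s t ⟨C, hC, h⟩ ⟨C', hC', h'⟩
    refine ⟨C + C', ENNReal.add_ne_top.2 ⟨hC, hC'⟩, fun φ hφ => ?_⟩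
    rw [add_mul]
    exact (lintegral_union_le _ _ _).trans (add_le_add (h φ hφ) (h' φ hφ))
  · intro p hp
    obtain ⟨r, hr, h⟩ := exists_trace_bound_near Ω hp
    exact ⟨_, Filter.inter_mem (mem_nhdsWithin_of_mem_nhds (Metric.ball_mem_nhds p hr))
      self_mem_nhdsWithin, h⟩

/-- The trace inequality for φ = 1 bounds the surface area by a multiple of the volume. -/
instance (Ω : LipschitzDomain d) : IsFiniteMeasure Ω.surface := by
  obtain ⟨C, hC, h⟩ := exists_trace_bound Ω
  have h1 := h (fun _ => 1) contDiff_const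
  have h0 : ∀ x, classicalGrad (fun _ : RSpace d => (1 : ℂ)) x = 0 := by
    intro x
    ext i
    simp
  simp only [h0, enorm_one, one_pow, lintegral_const, one_mul, enorm_zero, ne_eq,
    OfNat.ofNat_ne_zero, not_false_eq_true, zero_pow, zero_mul, add_zero] at h1
  exact ⟨h1.trans_lt (ENNReal.mul_lt_top hC.lt_top (measure_lt_top _ _))⟩

/-! ### The trace operator -/

lemma memLp_surface_of_continuous (Ω : LipschitzDomain d) {f : RSpace d → ℂ} (hf : Continuous f) :
    MemLp f 2 Ω.surface := by
  have hcpt : IsCompact (frontier Ω.carrier) :=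
    Ω.isCompact_closure.of_isClosed_subset isClosed_frontier frontier_subset_closure
  obtain ⟨C, hC⟩ := hcpt.exists_bound_of_continuousOn hf.continuousOn
  refine MemLp.of_bound hf.aestronglyMeasurable C ?_
  filter_upwards [ae_restrict_mem isClosed_frontier.measurableSet] with x hx
  exact hC x hx

/-- Restriction of smooth functions to `∂Ω`. -/
def smoothTrace (Ω : LipschitzDomain d) : Smooth d →ₗ[ℂ] Lp ℂ 2 Ω.surface where
  toFun φ := (memLp_surface_of_continuous Ω (Smooth.contDiff φ).continuous).toLp _
  map_add' φ ψ := MemLp.toLp_add (memLp_surface_of_continuous Ω (Smooth.contDiff φ).continuous)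
    (memLp_surface_of_continuous Ω (Smooth.contDiff ψ).continuous)
  map_smul' c φ :=
    MemLp.toLp_const_smul c (memLp_surface_of_continuous Ω (Smooth.contDiff φ).continuous)

lemma smoothTrace_coe (Ω : LipschitzDomain d) (φ : Smooth d) :
    smoothTrace Ω φ =ᵐ[Ω.surface] φ :=
  (memLp_surface_of_continuous Ω (Smooth.contDiff φ).continuous).coeFn_toLp

lemma enorm_ofSmooth_sq (Ω : LipschitzDomain d) (φ : Smooth d) : ‖ofSmooth Ω φ‖ₑ ^ 2 =
    ∫⁻ x, ‖(φ : RSpace d → ℂ) x‖ₑ ^ 2 ∂Ω.vol + ∫⁻ x, ‖classicalGrad φ x‖ₑ ^ 2 ∂Ω.vol := by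
  rw [H1.enorm_sq, enorm_sq_eq_lintegral, enorm_sq_eq_lintegral]
  congr 1
  · refine lintegral_congr_ae ?_
    filter_upwards [val_ofSmooth Ω φ] with x hx
    rw [hx]
  · refine lintegral_congr_ae ?_
    filter_upwards [grad_ofSmooth Ω φ] with x hx
    rw [hx]

lemma norm_sq_le_of_enorm_sq_le {E F : Type*} [NormedAddCommGroup E] [NormedAddCommGroup F]
    {x : E} {y : F} {C : ℝ≥0∞} (hC : C ≠ ⊤) (h : ‖x‖ₑ ^ 2 ≤ C * ‖y‖ₑ ^ 2) :
    ‖x‖ ≤ √C.toReal * ‖y‖ := by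
  have h1 := ENNReal.toReal_mono (by finiteness) h
  simp only [ENNReal.toReal_pow, ENNReal.toReal_mul, toReal_enorm] at h1
  rw [← Real.sqrt_sq (norm_nonneg x), ← Real.sqrt_sq (norm_nonneg y),
    ← Real.sqrt_mul ENNReal.toReal_nonneg]
  exact Real.sqrt_le_sqrt h1

lemma exists_norm_smoothTrace_le (Ω : LipschitzDomain d) :
    ∃ C, ∀ φ : Smooth d, ‖smoothTrace Ω φ‖ ≤ C * ‖ofSmooth Ω φ‖ := by
  obtain ⟨C, hC, h⟩ := exists_trace_bound Ω
  refine ⟨√C.toReal, fun φ => norm_sq_le_of_enorm_sq_le hC ?_⟩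
  rw [enorm_ofSmooth_sq, enorm_sq_eq_lintegral]
  refine le_of_eq_of_le (lintegral_congr_ae ?_) (h φ (Smooth.contDiff φ))
  filter_upwards [smoothTrace_coe Ω φ] with x hx
  rw [hx]

/-- An element of H¹ that agrees a.e. with a smooth φ is `ofSmooth` of φ, so the defining property
amounts to T ∘ `ofSmooth` = `smoothTrace`. The trace inequality and density then give a unique
bounded extension. The inequality also covers the fact that `ofSmooth` forgets φ outside Ω: the
boundary values depend only on the class in H¹. -/
theorem existsUnique_isTraceOp (Ω : LipschitzDomain d) : ∃! T, IsTraceOp Ω T := by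
  have hiff : ∀ T : H1 Ω →L[ℂ] Lp ℂ 2 Ω.surface,
      IsTraceOp Ω T ↔ T.toLinearMap ∘ₗ ofSmooth Ω = smoothTrace Ω := by
    intro T
    constructor
    · intro h
      ext1 φ
      refine Lp.ext ((h φ (Smooth.contDiff φ) _ (val_ofSmooth Ω φ)).trans
        (smoothTrace_coe Ω φ).symm)
    · intro h φ hφ v hv
      have hv' : v = ofSmooth Ω (⟨φ, hφ⟩ : Smooth d) := eq_ofSmooth hv
      have h1 : T v = smoothTrace Ω (⟨φ, hφ⟩ : Smooth d) := by
        rw [hv', ← h]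
        rfl
      rw [h1]
      exact smoothTrace_coe Ω (⟨φ, hφ⟩ : Smooth d)
  obtain ⟨C, hC⟩ := exists_norm_smoothTrace_le Ω
  refine ⟨(smoothTrace Ω).extendOfNorm (ofSmooth Ω), ?_, ?_⟩
  · refine (hiff _).2 (LinearMap.ext fun φ => ?_)
    exact LinearMap.extendOfNorm_eq (denseRange_ofSmooth Ω) ⟨C, hC⟩ φ
  · intro T hT
    exact (LinearMap.extendOfNorm_unique (denseRange_ofSmooth Ω) C hC T ((hiff T).1 hT)).symm

lemma isTraceOp_trace (Ω : LipschitzDomain d) : IsTraceOp Ω (trace Ω) := by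
  have h : ∃ T, IsTraceOp Ω T := (existsUnique_isTraceOp Ω).exists
  rw [trace, dif_pos h]
  exact h.choose_spec

lemma trace_one (Ω : LipschitzDomain d) : trace Ω (H1.one Ω) =ᵐ[Ω.surface] fun _ => 1 :=
  isTraceOp_trace Ω (fun _ => 1) contDiff_const _ (Lp.coeFn_const (p := 2) (μ := Ω.vol) (1 : ℂ))

/-! ### Positivity of the surface measure -/

lemma surface_pos_of_relOpen (Ω : LipschitzDomain d) {V : Set (RSpace d)} (hV : IsOpen V)
    (hne : (V ∩ frontier Ω.carrier).Nonempty) : 0 < Ω.surface V := by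
  obtain ⟨p, hpV, hp⟩ := hne
  obtain ⟨U, hU, hpU, e, he, γ, ⟨K, hK⟩, hγ⟩ := Ω.lipschitz p hp
  have hGc : Continuous (graphMap e γ) := (lipschitzWith_graphMap he hK).continuous
  have hpG := eq_graphMap he ((mem_frontier_iff_of_chart Ω hU he hK.continuous hγ hpU).1 hp)
  set D : Set (ℝ ∙ e)ᗮ := graphMap e γ ⁻¹' (U ∩ V) with hD
  have hDo : IsOpen D := (hU.inter hV).preimage hGc
  have hDne : D.Nonempty := ⟨(ℝ ∙ e)ᗮ.orthogonalProjectionOnto p, by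
    rw [hD, mem_preimage, hpG]; exact ⟨hpU, hpV⟩⟩
  rw [LipschitzDomain.surface, Measure.restrict_apply hV.measurableSet]
  refine (hDo.measure_pos volume hDne).trans_le
    ((volume_le_hausdorff_image_graphMap (γ := γ) he D).trans (measure_mono ?_))
  rintro _ ⟨y, ⟨hyU, hyV⟩, rfl⟩
  refine ⟨hyV, (mem_frontier_iff_of_chart Ω hU he hK.continuous hγ hyU).2 ?_⟩
  have := inner_graphMap_add (γ := γ) he y 0
  simp only [zero_smul, add_zero] at this
  rw [this, proj_graphMap]

/-! ### The Poincaré inequality -/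

/-- The fundamental theorem along h and Tonelli reduce the claim to the translates S + sh, each of
which lies in Ω and so contributes at most the full gradient integral. -/
lemma lintegral_translate_sub_le (Ω : LipschitzDomain d) {φ : RSpace d → ℂ} (hφ : ContDiff ℝ ∞ φ)
    {S : Set (RSpace d)} (hS : MeasurableSet S) {h : RSpace d}
    (hSh : ∀ x ∈ S, ∀ s ∈ Ioc (0 : ℝ) 1, x + s • h ∈ Ω.carrier) :
    ∫⁻ x in S, ‖φ (x + h) - φ x‖ₑ ^ 2 ≤ ‖h‖ₑ ^ 2 * ∫⁻ x, ‖classicalGrad φ x‖ₑ ^ 2 ∂Ω.vol := by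
  set f : RSpace d → ℝ≥0∞ := fun x => ‖classicalGrad φ x‖ₑ ^ 2 with hf
  have hfm : Measurable f := (continuous_classicalGrad hφ).measurable.enorm.pow_const 2
  have hjm : Measurable fun q : RSpace d × ℝ => f (q.1 + q.2 • h) :=
    hfm.comp (Continuous.measurable (by fun_prop))
  have hshift : ∀ s ∈ Ioc (0 : ℝ) 1, ∫⁻ x in S, f (x + s • h) ≤ ∫⁻ x, f x ∂Ω.vol := by
    intro s hs
    rw [← lintegral_indicator hS, ← lintegral_indicator Ω.isOpen.measurableSet,
      ← lintegral_add_right_eq_self (Ω.carrier.indicator f) (s • h)]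
    refine lintegral_mono fun x => ?_
    by_cases hx : x ∈ S
    · rw [indicator_of_mem hx, indicator_of_mem (hSh x hx s hs)]
    · rw [indicator_of_notMem hx]
      exact zero_le
  calc ∫⁻ x in S, ‖φ (x + h) - φ x‖ₑ ^ 2
      ≤ ∫⁻ x in S, ‖h‖ₑ ^ 2 * ∫⁻ s in Ioc (0 : ℝ) 1, f (x + s • h) := by
        refine lintegral_mono fun x => ?_
        simpa using enorm_sub_sq_le_lintegral hφ x h zero_le_one
    _ = ‖h‖ₑ ^ 2 * ∫⁻ s in Ioc (0 : ℝ) 1, ∫⁻ x in S, f (x + s • h) := by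
        rw [lintegral_const_mul _ hjm.lintegral_prod_right', lintegral_lintegral_swap
          hjm.aemeasurable]
    _ ≤ ‖h‖ₑ ^ 2 * ∫⁻ s in Ioc (0 : ℝ) 1, ∫⁻ x, f x ∂Ω.vol := by
        exact mul_le_mul_right (setLIntegral_mono' measurableSet_Ioc hshift) _
    _ = _ := by simp

/-- On `s`, smooth functions differ in `L²` from the constants `c φ` by at most a multiple of the
`L²` norm of their gradient on `Ω`. -/
def PoincareOn (Ω : LipschitzDomain d) (c : (RSpace d → ℂ) → ℂ) (s : Set (RSpace d)) : Prop :=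
  ∃ C : ℝ≥0∞, C ≠ ⊤ ∧ ∀ φ : RSpace d → ℂ, ContDiff ℝ ∞ φ →
    ∫⁻ x in s, ‖φ x - c φ‖ₑ ^ 2 ≤ C * ∫⁻ x, ‖classicalGrad φ x‖ₑ ^ 2 ∂Ω.vol

namespace PoincareOn

variable {Ω : LipschitzDomain d} {c : (RSpace d → ℂ) → ℂ} {s t : Set (RSpace d)}

lemma empty : PoincareOn Ω c ∅ := ⟨0, ENNReal.zero_ne_top, fun φ _ => by simp⟩

lemma mono (h : PoincareOn Ω c t) (hst : s ⊆ t) : PoincareOn Ω c s := by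
  obtain ⟨C, hC, h⟩ := h
  exact ⟨C, hC, fun φ hφ => (lintegral_mono_set hst).trans (h φ hφ)⟩

/-- The same constant c φ serves on both sets; this is why c is a parameter independent of the set.
-/
lemma union (hs : PoincareOn Ω c s) (ht : PoincareOn Ω c t) : PoincareOn Ω c (s ∪ t) := by
  obtain ⟨C, hC, h⟩ := hs
  obtain ⟨C', hC', h'⟩ := ht
  refine ⟨C + C', ENNReal.add_ne_top.2 ⟨hC, hC'⟩, fun φ hφ => ?_⟩
  rw [add_mul]
  exact (lintegral_union_le _ _ _).trans (add_le_add (h φ hφ) (h' φ hφ))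

/-- This is how the inequality travels: φ(x) - c is split into φ(x+h) - c, controlled on t, and
φ(x+h) - φ(x), controlled by the gradient along a segment in Ω. -/
lemma of_translate (ht : PoincareOn Ω c t) (htm : MeasurableSet t) (hs : MeasurableSet s)
    {h : RSpace d} (hst : ∀ x ∈ s, x + h ∈ t)
    (hsΩ : ∀ x ∈ s, ∀ τ ∈ Ioc (0 : ℝ) 1, x + τ • h ∈ Ω.carrier) : PoincareOn Ω c s := by
  obtain ⟨C, hC, H⟩ := ht
  refine ⟨2 * C + 2 * ‖h‖ₑ ^ 2, by finiteness, fun φ hφ => ?_⟩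
  set D := ∫⁻ x, ‖classicalGrad φ x‖ₑ ^ 2 ∂Ω.vol
  have hm : Measurable fun x => ‖φ (x + h) - c φ‖ₑ ^ 2 :=
    ((hφ.continuous.comp (by fun_prop : Continuous fun x : RSpace d => x + h)).measurable.sub_const
      _).enorm.pow_const 2
  have hm' : Measurable fun x => ‖φ (x + h) - φ x‖ₑ ^ 2 :=
    ((hφ.continuous.comp (by fun_prop : Continuous fun x : RSpace d => x + h)).measurable.sub
      hφ.continuous.measurable).enorm.pow_const 2
  have h1 : ∫⁻ x in s, ‖φ (x + h) - c φ‖ₑ ^ 2 ≤ C * D := by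
    refine le_trans ?_ (H φ hφ)
    rw [← lintegral_indicator hs, ← lintegral_indicator htm,
      ← lintegral_add_right_eq_self (t.indicator fun x => ‖φ x - c φ‖ₑ ^ 2) h]
    refine lintegral_mono fun x => ?_
    by_cases hx : x ∈ s
    · rw [indicator_of_mem hx, indicator_of_mem (hst x hx)]
    · rw [indicator_of_notMem hx]
      exact zero_le
  calc ∫⁻ x in s, ‖φ x - c φ‖ₑ ^ 2
      ≤ ∫⁻ x in s, (2 * ‖φ (x + h) - c φ‖ₑ ^ 2 + 2 * ‖φ (x + h) - φ x‖ₑ ^ 2) := by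
        refine lintegral_mono fun x => ?_
        have := enorm_add_sq_le (φ (x + h) - c φ) (-(φ (x + h) - φ x))
        rw [enorm_neg] at this
        refine le_of_eq_of_le ?_ this
        congr 2
        ring
    _ = 2 * (∫⁻ x in s, ‖φ (x + h) - c φ‖ₑ ^ 2) + 2 * ∫⁻ x in s, ‖φ (x + h) - φ x‖ₑ ^ 2 := by
        rw [lintegral_add_left (hm.const_mul 2), lintegral_const_mul _ hm,
          lintegral_const_mul _ hm']
    _ ≤ 2 * (C * D) + 2 * (‖h‖ₑ ^ 2 * D) :=
        add_le_add (mul_le_mul_right h1 _)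
          (mul_le_mul_right (lintegral_translate_sub_le Ω hφ hs hsΩ) _)
    _ = _ := by ring

/-- The deviation from the mean is bounded by the mean of φ(y) - φ(x). In the variable z = y - x
each slice is a translation difference on the x with both x and x+z in the ball, and convexity keeps
the segments inside. Only |z| < 2R contributes. -/
lemma ball_average {x₀ : RSpace d} {R : ℝ} (hR : 0 < R)
    (hball : Metric.ball x₀ R ⊆ Ω.carrier) :
    PoincareOn Ω (fun φ => ⨍ y in Metric.ball x₀ R, φ y) (Metric.ball x₀ R) := by
  set B := Metric.ball x₀ R with hB
  have hBm : MeasurableSet B := Metric.isOpen_ball.measurableSet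
  have hB0 : volume B ≠ 0 := (Metric.measure_ball_pos volume x₀ hR).ne'
  have hBt : volume B ≠ ⊤ := measure_ball_lt_top.ne
  set Z := Metric.ball (0 : RSpace d) (2 * R) with hZ
  refine ⟨(volume B)⁻¹ * (ENNReal.ofReal (2 * R) ^ 2 * volume Z), ?_, fun φ hφ => ?_⟩
  · have : volume Z ≠ ⊤ := measure_ball_lt_top.ne
    finiteness
  set D := ∫⁻ x, ‖classicalGrad φ x‖ₑ ^ 2 ∂Ω.vol
  have hφi : IntegrableOn φ B :=
    (hφ.continuous.locallyIntegrable.integrableOn_isCompact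
      (isCompact_closedBall x₀ R)).mono_set Metric.ball_subset_closedBall
  have hpt : ∀ x, ‖φ x - ⨍ y in B, φ y‖ₑ ^ 2 ≤
      (volume B)⁻¹ * ∫⁻ y in B, ‖φ y - φ x‖ₑ ^ 2 := by
    intro x
    have e1 : φ x - ⨍ y in B, φ y = - ⨍ y in B, (φ y - φ x) := by
      rw [setAverage_eq, setAverage_eq, integral_sub hφi (integrableOn_const hBt),
        setIntegral_const, smul_sub, smul_smul, inv_mul_cancel₀, one_smul, neg_sub]
      rw [Measure.real, ENNReal.toReal_ne_zero]
      exact ⟨hB0, hBt⟩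
    rw [e1, enorm_neg, average_eq', Measure.restrict_apply_univ]
    set ν : Measure (RSpace d) := (volume B)⁻¹ • volume.restrict B
    have hν : ν univ = 1 := by
      simp only [ν, Measure.smul_apply, Measure.restrict_apply_univ, smul_eq_mul]
      exact ENNReal.inv_mul_cancel hB0 hBt
    calc _ ≤ (∫⁻ y, ‖φ y - φ x‖ₑ ∂ν) ^ 2 :=
          pow_le_pow_left' (enorm_integral_le_lintegral_enorm _) 2
      _ ≤ ν univ * ∫⁻ y, ‖φ y - φ x‖ₑ ^ 2 ∂ν :=
          sq_lintegral_le ν (hφ.continuous.measurable.sub_const _).enorm.aemeasurable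
      _ = _ := by rw [hν, one_mul, lintegral_smul_measure, smul_eq_mul]
  have hQm : Measurable fun q : RSpace d × RSpace d => ‖φ (q.1 + q.2) - φ q.1‖ₑ ^ 2 := by
    have h1 : Measurable fun q : RSpace d × RSpace d => φ (q.1 + q.2) :=
      (hφ.continuous.comp (continuous_fst.add continuous_snd)).measurable
    have h2 : Measurable fun q : RSpace d × RSpace d => φ q.1 :=
      (hφ.continuous.comp continuous_fst).measurable
    exact (h1.sub h2).enorm.pow_const 2
  have hindm : Measurable fun q : RSpace d × RSpace d =>
      {q : RSpace d × RSpace d | q.1 + q.2 ∈ B}.indicator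
        (fun q => ‖φ (q.1 + q.2) - φ q.1‖ₑ ^ 2) q :=
    hQm.indicator (hBm.preimage (measurable_fst.add measurable_snd))
  have hslice : ∀ z, ∫⁻ x in B, {q : RSpace d × RSpace d | q.1 + q.2 ∈ B}.indicator
        (fun q => ‖φ (q.1 + q.2) - φ q.1‖ₑ ^ 2) (x, z) ≤
      Z.indicator (fun _ => ENNReal.ofReal (2 * R) ^ 2 * D) z := by
    intro z
    have hpre : MeasurableSet ((fun x => x + z) ⁻¹' B) :=
      hBm.preimage (measurable_id.add_const z)
    have e1 : ∫⁻ x in B, {q : RSpace d × RSpace d | q.1 + q.2 ∈ B}.indicator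
        (fun q => ‖φ (q.1 + q.2) - φ q.1‖ₑ ^ 2) (x, z)
        = ∫⁻ x in ((fun x => x + z) ⁻¹' B) ∩ B, ‖φ (x + z) - φ x‖ₑ ^ 2 := by
      rw [← Measure.restrict_restrict hpre, ← lintegral_indicator hpre]
      rfl
    rw [e1]
    by_cases hz : z ∈ Z
    · rw [indicator_of_mem hz]
      refine (lintegral_translate_sub_le Ω hφ (hpre.inter hBm) ?_).trans ?_
      · rintro x ⟨hx1, hx2⟩ τ hτ
        apply hball
        have hcvx := convex_ball x₀ R hx2 hx1 (sub_nonneg.2 hτ.2) hτ.1.le (by ring)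
        have : x + τ • z = (1 - τ) • x + τ • (x + z) := by
          rw [sub_smul, one_smul, smul_add]; abel
        rw [this]
        exact hcvx
      · gcongr
        rw [← ofReal_norm]
        refine ENNReal.ofReal_le_ofReal ?_
        rw [hZ, mem_ball_zero_iff] at hz
        exact hz.le
    · rw [indicator_of_notMem hz]
      have hempty : ((fun x => x + z) ⁻¹' B) ∩ B = ∅ := by
        refine eq_empty_of_forall_notMem ?_
        rintro x ⟨hx1, hx2⟩
        apply hz
        rw [mem_preimage, hB, Metric.mem_ball] at hx1
        rw [hB, Metric.mem_ball] at hx2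
        rw [hZ, mem_ball_zero_iff]
        have := dist_triangle_right (x + z) x x₀
        rw [dist_eq_norm (x + z) x, add_sub_cancel_left] at this
        linarith
      rw [hempty]
      simp
  calc ∫⁻ x in B, ‖φ x - ⨍ y in B, φ y‖ₑ ^ 2
      ≤ ∫⁻ x in B, (volume B)⁻¹ * ∫⁻ y in B, ‖φ y - φ x‖ₑ ^ 2 := lintegral_mono hpt
    _ = (volume B)⁻¹ * ∫⁻ x in B, ∫⁻ y in B, ‖φ y - φ x‖ₑ ^ 2 := by
        rw [lintegral_const_mul' _ _ (ENNReal.inv_ne_top.2 hB0)]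
    _ = (volume B)⁻¹ * ∫⁻ x in B, ∫⁻ z, {q : RSpace d × RSpace d | q.1 + q.2 ∈ B}.indicator
        (fun q => ‖φ (q.1 + q.2) - φ q.1‖ₑ ^ 2) (x, z) := by
        congr 1
        refine lintegral_congr fun x => ?_
        rw [← lintegral_indicator hBm, ← lintegral_add_left_eq_self _ x]
        rfl
    _ = (volume B)⁻¹ * ∫⁻ z, ∫⁻ x in B, {q : RSpace d × RSpace d | q.1 + q.2 ∈ B}.indicator
        (fun q => ‖φ (q.1 + q.2) - φ q.1‖ₑ ^ 2) (x, z) := by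
        rw [lintegral_lintegral_swap hindm.aemeasurable]
    _ ≤ (volume B)⁻¹ * ∫⁻ z, Z.indicator (fun _ => ENNReal.ofReal (2 * R) ^ 2 * D) z := by
        exact mul_le_mul_right (lintegral_mono hslice) _
    _ = _ := by
        rw [lintegral_indicator Metric.isOpen_ball.measurableSet, setLIntegral_const]
        ring

/-- Connectedness: the points having a good ball form an open set that is also relatively closed in
Ω, as the inequality can be translated from a nearby good point. -/
lemma exists_ball {x₀ : RSpace d} (hx₀ : x₀ ∈ Ω.carrier) {R : ℝ} (hR : 0 < R)
    (h₀ : PoincareOn Ω c (Metric.ball x₀ R)) {x : RSpace d} (hx : x ∈ Ω.carrier) :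
    ∃ r > 0, PoincareOn Ω c (Metric.ball x r) := by
  set u : Set (RSpace d) := {x | ∃ r > 0, PoincareOn Ω c (Metric.ball x r)} with hu
  have huo : IsOpen u := by
    rw [Metric.isOpen_iff]
    rintro y ⟨r, hr, h⟩
    refine ⟨r, hr, fun z hz => ⟨r - dist z y, sub_pos.2 hz, h.mono ?_⟩⟩
    exact Metric.ball_subset_ball' (by linarith)
  have hsub : Ω.carrier ⊆ u := by
    refine Ω.isConnected.isPreconnected.subset_of_closure_inter_subset huo
      ⟨x₀, hx₀, R, hR, h₀⟩ ?_
    rintro y ⟨hyu, hyΩ⟩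
    obtain ⟨ρ, hρ, hball⟩ := Metric.isOpen_iff.1 Ω.isOpen y hyΩ
    obtain ⟨z, ⟨r, hr, hz⟩, hyz⟩ := Metric.mem_closure_iff.1 hyu (ρ / 2) (by positivity)
    -- Shifting by z - y carries the ball at y into the good ball at z. Both the radius and the
    -- shift are at most ρ/2, so the segments stay in the ball of radius ρ about y.
    refine ⟨min r (ρ / 2), by positivity, hz.of_translate Metric.isOpen_ball.measurableSet
      Metric.isOpen_ball.measurableSet (h := z - y) ?_ ?_⟩
    · intro w hw
      rw [Metric.mem_ball, dist_eq_norm] at *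
      rw [show w + (z - y) - z = w - y by abel]
      exact hw.trans_le (min_le_left _ _)
    · intro w hw τ hτ
      apply hball
      rw [Metric.mem_ball, dist_eq_norm] at *
      have h1 : ‖τ • (z - y)‖ < ρ / 2 := by
        rw [norm_smul, Real.norm_of_nonneg hτ.1.le, norm_sub_rev]
        have := norm_nonneg (y - z)
        nlinarith [hτ.2]
      have h2 := hw.trans_le (min_le_right _ _)
      calc ‖w + τ • (z - y) - y‖ = ‖(w - y) + τ • (z - y)‖ := by congr 1; abel
        _ ≤ ‖w - y‖ + ‖τ • (z - y)‖ := norm_add_le _ _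
        _ < ρ := by linarith
  exact hsub hx

lemma of_isCompact (h : ∀ x ∈ Ω.carrier, ∃ r > 0, PoincareOn Ω c (Metric.ball x r))
    {K : Set (RSpace d)} (hK : IsCompact K) (hKΩ : K ⊆ Ω.carrier) : PoincareOn Ω c K := by
  refine hK.induction_on empty (fun _ _ hst ht => ht.mono hst) (fun _ _ hs ht => hs.union ht) ?_
  intro x hx
  obtain ⟨r, hr, hr'⟩ := h x (hKΩ hx)
  exact ⟨_, mem_nhdsWithin_of_mem_nhds (Metric.ball_mem_nhds x hr), hr'⟩

/-- Covering only compact subsets of Ω would leave out a boundary layer. Near each point of the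
closure, the shift by ε₀e pushes Ω into a compact subset of Ω, where finitely many balls suffice,
and the inequality is translated back. -/
lemma of_forall_ball (h : ∀ x ∈ Ω.carrier, ∃ r > 0, PoincareOn Ω c (Metric.ball x r)) :
    PoincareOn Ω c Ω.carrier := by
  have key : PoincareOn Ω c (Ω.carrier ∩ closure Ω.carrier) := by
    refine Ω.isCompact_closure.induction_on (p := fun s => PoincareOn Ω c (Ω.carrier ∩ s)) ?_ ?_ ?_ ?_
    · rw [inter_empty]
      exact empty
    · exact fun s t hst ht => ht.mono (inter_subset_inter_right _ hst)
    · intro s t hs ht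
      rw [inter_union_distrib_left]
      exact hs.union ht
    · intro p hp
      obtain ⟨r, hr, e, δ, hδ, ε₀, hε₀, hcone⟩ := exists_cone Ω hp
      refine ⟨_, mem_nhdsWithin_of_mem_nhds (Metric.ball_mem_nhds p hr), ?_⟩
      -- The points at distance at least ε₀δ from the complement of Ω: the cone condition says
      -- precisely that the shift lands here.
      set K : Set (RSpace d) :=
        {x | ENNReal.ofReal (ε₀ * δ) ≤ Metric.infEDist x Ω.carrierᶜ} with hK
      have hKc : IsClosed K := isClosed_le continuous_const Metric.continuous_infEDist
      have hKΩ : K ⊆ Ω.carrier := by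
        intro x hx
        by_contra hxΩ
        rw [hK, mem_ofPred_eq, Metric.infEDist_zero_of_mem hxΩ, nonpos_iff_eq_zero,
          ENNReal.ofReal_eq_zero] at hx
        exact absurd hx (not_le.2 (mul_pos hε₀ hδ))
      have hKcpt : IsCompact K :=
        Metric.isCompact_of_isClosed_isBounded hKc (Ω.isBounded.subset hKΩ)
      refine (of_isCompact h hKcpt hKΩ).of_translate hKc.measurableSet
        (Ω.isOpen.measurableSet.inter Metric.isOpen_ball.measurableSet) (h := ε₀ • e) ?_ ?_
      · intro x hx
        rw [hK, mem_ofPred_eq, Metric.le_infEDist]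
        intro y hy
        by_contra hlt
        refine hy (hcone x hx ε₀ ⟨hε₀, le_rfl⟩ ?_)
        rw [not_le, edist_dist, ENNReal.ofReal_lt_ofReal_iff (mul_pos hε₀ hδ)] at hlt
        rw [Metric.mem_closedBall, dist_comm]
        exact hlt.le
      · intro x hx τ hτ
        refine hcone x hx (τ * ε₀) ⟨mul_pos hτ.1 hε₀, ?_⟩ ?_
        · nlinarith [hτ.2]
        · rw [smul_smul]
          exact Metric.mem_closedBall_self (mul_nonneg (mul_nonneg hτ.1.le hε₀.le) hδ.le)
  rwa [inter_eq_left.2 subset_closure] at key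

end PoincareOn

theorem exists_poincareOn (Ω : LipschitzDomain d) : ∃ c, PoincareOn Ω c Ω.carrier := by
  obtain ⟨x₀, hx₀⟩ := Ω.isConnected.nonempty
  obtain ⟨R, hR, hball⟩ := Metric.isOpen_iff.1 Ω.isOpen x₀ hx₀
  exact ⟨_, PoincareOn.of_forall_ball fun x hx =>
    PoincareOn.exists_ball hx₀ hR (PoincareOn.ball_average hR hball) hx⟩

/-- The Poincaré inequality on a bounded Lipschitz domain. -/
theorem exists_norm_sub_const_le (Ω : LipschitzDomain d) :
    ∃ C : ℝ, ∀ φ : Smooth d, ∃ c : ℂ,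
      ‖H1.val (ofSmooth Ω φ - c • H1.one Ω)‖ ≤ C * ‖H1.grad (ofSmooth Ω φ)‖ := by
  obtain ⟨c, C, hC, h⟩ := exists_poincareOn Ω
  refine ⟨√C.toReal, fun φ => ⟨c φ, norm_sq_le_of_enorm_sq_le hC ?_⟩⟩
  rw [enorm_sq_eq_lintegral, enorm_sq_eq_lintegral]
  have e1 : ofSmooth Ω φ - c φ • H1.one Ω = ofSmooth Ω (φ - c φ • Smooth.one d) := by
    rw [map_sub, map_smul, ofSmooth_one]
  have e2 : ∫⁻ x, ‖H1.val (ofSmooth Ω φ - c φ • H1.one Ω) x‖ₑ ^ 2 ∂Ω.vol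
      = ∫⁻ x in Ω.carrier, ‖(φ : RSpace d → ℂ) x - c φ‖ₑ ^ 2 := by
    rw [e1]
    refine lintegral_congr_ae ?_
    filter_upwards [val_ofSmooth Ω (φ - c φ • Smooth.one d)] with x hx
    rw [hx]
    simp [Smooth.one]
  have e3 : ∫⁻ x, ‖H1.grad (ofSmooth Ω φ) x‖ₑ ^ 2 ∂Ω.vol
      = ∫⁻ x, ‖classicalGrad φ x‖ₑ ^ 2 ∂Ω.vol := by
    refine lintegral_congr_ae ?_
    filter_upwards [grad_ofSmooth Ω φ] with x hx
    rw [hx]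
  rw [e2, e3]
  exact h φ (Smooth.contDiff φ)

/-! ### The energy norm on `𝓗` -/

lemma L2_norm_sq_eq_integral {α F : Type*} {mα : MeasurableSpace α} {μ : Measure α}
    [NormedAddCommGroup F] (f : Lp F 2 μ) : ‖f‖ ^ 2 = ∫ x, ‖f x‖ ^ 2 ∂μ := by
  have h := congrArg ENNReal.toReal (enorm_sq_eq_lintegral f)
  rw [ENNReal.toReal_pow, toReal_enorm] at h
  have hm : AEStronglyMeasurable (fun x => ‖f x‖ ^ 2) μ := (Lp.aestronglyMeasurable f).norm.pow 2
  rw [h, integral_eq_lintegral_of_nonneg_ae (ae_of_all _ fun x => by positivity) hm]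
  congr 1
  refine lintegral_congr fun x => ?_
  rw [ENNReal.ofReal_pow (norm_nonneg _), ofReal_norm]

/-- The pair `(1, 𝟏)`. -/
def onePair (Ω : LipschitzDomain d) (m : ℕ) : Pair Ω m := WithLp.toLp 2 (H1.one Ω, allOnes m)

lemma toH_smul_onePair {Ω : LipschitzDomain d} {m : ℕ} (c : ℂ) :
    toH (c • onePair Ω m) = 0 :=
  (Submodule.Quotient.mk_eq_zero _).2 (Submodule.mem_span_singleton.2 ⟨c, rfl⟩)

/-- The representative of a class of `𝓗` with mean free second component. -/
def sectionL (Ω : LipschitzDomain d) (m : ℕ) [NeZero m] : HSpace Ω m →L[ℂ] Pair Ω m :=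
  (WithLp.prodContinuousLinearEquiv 2 ℂ (H1 Ω) (CSpace m)).symm.toContinuousLinearMap.comp
    ((T1 Ω m).prod ((CDiamond m).subtypeL.comp (T2 Ω m)))

lemma sectionL_toH {Ω : LipschitzDomain d} {m : ℕ} [NeZero m] (w : Pair Ω m) :
    sectionL Ω m (toH w) = w - mean m w.snd • onePair Ω m := rfl

lemma toH_sectionL {Ω : LipschitzDomain d} {m : ℕ} [NeZero m] (x : HSpace Ω m) :
    toH (sectionL Ω m x) = x := by
  obtain ⟨w, rfl⟩ := Submodule.Quotient.mk_surjective _ x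
  have h : toH (w - mean m w.snd • onePair Ω m) = toH w - toH (mean m w.snd • onePair Ω m) :=
    Submodule.Quotient.mk_sub _
  change toH (sectionL Ω m (toH w)) = toH w
  rw [sectionL_toH, h, toH_smul_onePair, sub_zero]

namespace ElectrodeModel

variable {Ω : LipschitzDomain d} {m : ℕ} (M : ElectrodeModel Ω m)

lemma measurableSet_E (j : Fin m) : MeasurableSet (M.E j) := by
  obtain ⟨U, hU, h⟩ := M.E_relOpen j
  rw [h]
  exact hU.measurableSet.inter isClosed_frontier.measurableSet

lemma measurableSet_core (j : Fin m) : MeasurableSet (M.core j) := by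
  obtain ⟨U, hU, h⟩ := M.core_relOpen j
  rw [h]
  exact hU.measurableSet.inter isClosed_frontier.measurableSet

lemma measurableSet_iUnion_core : MeasurableSet (⋃ j, M.core j) :=
  MeasurableSet.iUnion M.measurableSet_core

lemma surface_core_pos (j : Fin m) : 0 < Ω.surface (M.core j) := by
  obtain ⟨U, hU, h⟩ := M.core_relOpen j
  have hne : (U ∩ frontier Ω.carrier).Nonempty := h ▸ M.core_nonempty j
  have := surface_pos_of_relOpen Ω hU hne
  rw [h, LipschitzDomain.surface, Measure.restrict_apply
    (hU.measurableSet.inter isClosed_frontier.measurableSet), inter_assoc, inter_self]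
  rwa [LipschitzDomain.surface, Measure.restrict_apply hU.measurableSet] at this

lemma piecewise_of_mem (V : CSpace m) {j : Fin m} {x : RSpace d} (hx : x ∈ M.E j) :
    M.piecewise V x = V j := by
  rw [piecewise, Finset.sum_eq_single j]
  · rw [indicator_of_mem hx]
  · intro i _ hij
    refine indicator_of_notMem (fun hxi => ?_) _
    exact Set.disjoint_left.1 (M.E_disjoint i j hij) (subset_closure hxi) (subset_closure hx)
  · simp

/-- `V ↦ ∑ V_j χ_{E_j}` as a bounded operator `ℂ^m → L²(∂Ω)`. -/
def piecewiseL : CSpace m →L[ℂ] Lp ℂ 2 Ω.surface :=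
  ∑ j, (EuclideanSpace.proj (𝕜 := ℂ) j : CSpace m →L[ℂ] ℂ).smulRight
    (indicatorConstLp 2 (M.measurableSet_E j) (measure_ne_top Ω.surface _) (1 : ℂ))

lemma piecewiseL_coe (V : CSpace m) : M.piecewiseL V =ᵐ[Ω.surface] M.piecewise V := by
  have e : M.piecewiseL V = ∑ j, V j •
      indicatorConstLp 2 (M.measurableSet_E j) (measure_ne_top Ω.surface _) (1 : ℂ) := by
    simp [piecewiseL]
  rw [e]
  have h1 := ae_all_iff.2 fun j : Fin m => Lp.coeFn_smul (V j)
    (indicatorConstLp 2 (M.measurableSet_E j) (measure_ne_top Ω.surface _) (1 : ℂ))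
  have h2 := ae_all_iff.2 fun j : Fin m => indicatorConstLp_coeFn (p := 2) (c := (1 : ℂ))
    (hs := M.measurableSet_E j) (hμs := measure_ne_top Ω.surface _)
  filter_upwards [h1, h2, Lp.coeFn_finsetSum Finset.univ fun j => V j •
    indicatorConstLp 2 (M.measurableSet_E j) (measure_ne_top Ω.surface _) (1 : ℂ)] with x h1 h2 h3
  rw [h3, Finset.sum_apply, piecewise]
  refine Finset.sum_congr rfl fun j _ => ?_
  rw [h1 j, Pi.smul_apply, h2 j]
  by_cases hx : x ∈ M.E j <;> simp [hx]

/-- `(v, V) ↦ T̃v - V` as a bounded operator. -/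
def jumpL : Pair Ω m →L[ℂ] Lp ℂ 2 Ω.surface :=
  (trace Ω).comp (WithLp.fstL 2 ℂ (H1 Ω) (CSpace m))
    - M.piecewiseL.comp (WithLp.sndL 2 ℂ (H1 Ω) (CSpace m))

lemma jumpL_coe (w : Pair Ω m) : M.jumpL w =ᵐ[Ω.surface] M.jump w := by
  have e : M.jumpL w = trace Ω w.fst - M.piecewiseL w.snd := rfl
  rw [e]
  filter_upwards [Lp.coeFn_sub (trace Ω w.fst) (M.piecewiseL w.snd), M.piecewiseL_coe w.snd]
    with x h1 h2
  rw [h1, Pi.sub_apply, h2]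
  rfl

/-- Off the electrodes the jump of (1, 𝟏) is 1, so the jump does not descend to the quotient as it
stands. The form and the energy norm do descend, because ζ vanishes off the electrodes and the
patches lie within them. -/
lemma jumpL_onePair : ∀ᵐ x ∂Ω.surface, x ∈ (⋃ j, M.E j) → M.jumpL (onePair Ω m) x = 0 := by
  filter_upwards [M.jumpL_coe (onePair Ω m), trace_one Ω] with x h1 h2 hx
  obtain ⟨j, hj⟩ := mem_iUnion.1 hx
  rw [h1, jump, M.piecewise_of_mem _ hj]
  change trace Ω (H1.one Ω) x - 1 = 0
  rw [h2, sub_self]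

/-! ### Multiplication operators and the form as an inner product -/

/-- Multiplication by `ζ` on `L²(∂Ω)`. -/
def mulζ : Lp ℂ 2 Ω.surface →L[ℂ] Lp ℂ 2 Ω.surface :=
  (ContinuousLinearMap.mul ℂ ℂ).holderL Ω.surface ∞ 2 2 M.ζ

lemma mulζ_coe (u : Lp ℂ 2 Ω.surface) : M.mulζ u =ᵐ[Ω.surface] fun x => M.ζ x * u x :=
  (ContinuousLinearMap.mul ℂ ℂ).coeFn_holder (r := 2) M.ζ u

/-- Multiplication of `L²` vector fields by matrix coefficients. -/
def mulMat (Ω : LipschitzDomain d) :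
    LInf Ω →L[ℂ] Lp (CSpace d) 2 Ω.vol →L[ℂ] Lp (CSpace d) 2 Ω.vol :=
  (ContinuousLinearMap.id ℂ (CMat d)).holderL Ω.vol ∞ 2 2

lemma mulMat_coe (A : LInf Ω) (u : Lp (CSpace d) 2 Ω.vol) :
    mulMat Ω A u =ᵐ[Ω.vol] fun x => A x (u x) :=
  (ContinuousLinearMap.id ℂ (CMat d)).coeFn_holder (r := 2) A u

lemma norm_mulMat_le (A : LInf Ω) (u : Lp (CSpace d) 2 Ω.vol) : ‖mulMat Ω A u‖ ≤ ‖A‖ * ‖u‖ := by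
  refine ((ContinuousLinearMap.id ℂ (CMat d)).norm_holder_apply_apply_le (r := 2) A u).trans ?_
  have := ContinuousLinearMap.norm_id_le (𝕜 := ℂ) (E := CMat d)
  gcongr
  exact mul_le_of_le_one_left (norm_nonneg _) this

lemma gradForm_eq_inner (A : LInf Ω) (w v : H1 Ω) :
    gradForm A w v = inner ℂ (H1.grad v) (mulMat Ω A (H1.grad w)) := by
  rw [L2.inner_def, gradForm]
  refine integral_congr_ae ?_
  filter_upwards [mulMat_coe A (H1.grad w)] with x hx
  rw [hx]

lemma form_eq_inner (A : LInf Ω) (w v : Pair Ω m) : M.form A w v =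
    inner ℂ (H1.grad v.fst) (mulMat Ω A (H1.grad w.fst))
      + inner ℂ (M.jumpL v) (M.mulζ (M.jumpL w)) := by
  rw [form, gradForm_eq_inner, L2.inner_def]
  congr 1
  refine integral_congr_ae ?_
  filter_upwards [M.mulζ_coe (M.jumpL w), M.jumpL_coe w, M.jumpL_coe v] with x h1 h2 h3
  rw [h1, h2, h3]
  simp

lemma mulζ_jumpL_onePair : M.mulζ (M.jumpL (onePair Ω m)) = 0 := by
  refine Lp.ext ?_
  filter_upwards [M.mulζ_coe (M.jumpL (onePair Ω m)), M.jumpL_onePair, M.ζ_eq_zero,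
    Lp.coeFn_zero ℂ 2 Ω.surface] with x h1 h2 h3 h4
  rw [h1, h4]
  by_cases hx : x ∈ ⋃ j, M.E j
  · simp [h2 hx]
  · simp [h3 hx]

lemma inner_jumpL_onePair_mulζ (u : Lp ℂ 2 Ω.surface) :
    inner ℂ (M.jumpL (onePair Ω m)) (M.mulζ u) = 0 := by
  rw [L2.inner_def, ← integral_zero (RSpace d) ℂ (μ := Ω.surface)]
  refine integral_congr_ae ?_
  filter_upwards [M.mulζ_coe u, M.jumpL_onePair, M.ζ_eq_zero] with x h1 h2 h3
  rw [h1]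
  by_cases hx : x ∈ ⋃ j, M.E j
  · simp [h2 hx]
  · simp [h3 hx]

/-- Restriction to `𝓔`. -/
def restrictCore : Lp ℂ 2 Ω.surface →L[ℂ] Lp ℂ 2 (Ω.surface.restrict (⋃ j, M.core j)) :=
  LpToLpRestrictCLM (RSpace d) ℂ ℂ Ω.surface 2 (⋃ j, M.core j)

/-! ### Descent to the quotient and equivalence of norms -/

variable [NeZero m]

/-- The gradient as an operator on `𝓗`. -/
def gradH (Ω : LipschitzDomain d) (m : ℕ) [NeZero m] : HSpace Ω m →L[ℂ] Lp (CSpace d) 2 Ω.vol :=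
  (H1.gradL Ω).comp (T1 Ω m)

lemma gradH_toH (w : Pair Ω m) : gradH Ω m (toH w) = H1.grad w.fst := by
  have e : T1 Ω m (toH w) = w.fst - mean m w.snd • H1.one Ω := rfl
  rw [gradH, ContinuousLinearMap.comp_apply, e, map_sub, map_smul, H1.gradL_apply, H1.gradL_apply,
    grad_one, smul_zero, sub_zero]

/-- The jump of the normalised representative of a class in `𝓗`. -/
def jumpH : HSpace Ω m →L[ℂ] Lp ℂ 2 Ω.surface := M.jumpL.comp (sectionL Ω m)

lemma jumpH_toH (w : Pair Ω m) :
    M.jumpH (toH w) = M.jumpL w - mean m w.snd • M.jumpL (onePair Ω m) := by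
  rw [jumpH, ContinuousLinearMap.comp_apply, sectionL_toH, map_sub, map_smul]

lemma form_eq (A : LInf Ω) (w v : Pair Ω m) : M.form A w v =
    inner ℂ (gradH Ω m (toH v)) (mulMat Ω A (gradH Ω m (toH w)))
      + inner ℂ (M.jumpH (toH v)) (M.mulζ (M.jumpH (toH w))) := by
  rw [form_eq_inner, gradH_toH, gradH_toH, jumpH_toH, jumpH_toH]
  congr 1
  rw [map_sub, map_smul, mulζ_jumpL_onePair, smul_zero, sub_zero, inner_sub_left, inner_smul_left,
    inner_jumpL_onePair_mulζ, mul_zero, sub_zero]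

/-- `(v, V) ↦ (∇v, (T̃v - V)|_𝓔)`, which turns `energyNorm` into a Hilbert space norm. -/
def energyMap : HSpace Ω m →L[ℂ]
    WithLp 2 (Lp (CSpace d) 2 Ω.vol × Lp ℂ 2 (Ω.surface.restrict (⋃ j, M.core j))) :=
  (WithLp.prodContinuousLinearEquiv 2 ℂ _ _).symm.toContinuousLinearMap.comp
    ((gradH Ω m).prod (M.restrictCore.comp M.jumpH))

lemma norm_energyMap_sq (x : HSpace Ω m) :
    ‖M.energyMap x‖ ^ 2 = ‖gradH Ω m x‖ ^ 2 + ‖M.restrictCore (M.jumpH x)‖ ^ 2 :=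
  WithLp.prod_norm_sq_eq_of_L2 (M.energyMap x)

lemma restrictCore_jumpH_toH (w : Pair Ω m) :
    M.restrictCore (M.jumpH (toH w)) =ᵐ[Ω.surface.restrict (⋃ j, M.core j)] M.jump w := by
  have hsub : (⋃ j, M.core j) ⊆ ⋃ j, M.E j := iUnion_mono M.core_subset
  rw [jumpH_toH]
  filter_upwards [LpToLpRestrictCLM_coeFn ℂ (⋃ j, M.core j)
      (M.jumpL w - mean m w.snd • M.jumpL (onePair Ω m)),
    ae_restrict_of_ae (Lp.coeFn_sub (M.jumpL w) (mean m w.snd • M.jumpL (onePair Ω m))),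
    ae_restrict_of_ae (Lp.coeFn_smul (mean m w.snd) (M.jumpL (onePair Ω m))),
    ae_restrict_of_ae (M.jumpL_coe w), ae_restrict_of_ae M.jumpL_onePair,
    ae_restrict_mem M.measurableSet_iUnion_core] with x h1 h2 h3 h4 h5 h6
  change (LpToLpRestrictCLM (RSpace d) ℂ ℂ Ω.surface 2 (⋃ j, M.core j) _ : RSpace d → ℂ) x = _
  rw [h1, h2, Pi.sub_apply, h3, Pi.smul_apply, h4, h5 (hsub h6), smul_zero, sub_zero]

lemma norm_energyMap_toH (w : Pair Ω m) : ‖M.energyMap (toH w)‖ = M.energyNorm w := by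
  rw [energyNorm, ← Real.sqrt_sq (norm_nonneg (M.energyMap (toH w))), norm_energyMap_sq,
    L2_norm_sq_eq_integral, L2_norm_sq_eq_integral, gradH_toH]
  congr 2
  refine integral_congr_ae ?_
  filter_upwards [M.restrictCore_jumpH_toH w] with x hx
  rw [hx]

/-- On the patch 𝓔_j the constant V_j equals T̃v minus the jump. Its L² norm there is |V_j| times
the square root of the patch area, which is positive and can be divided out. -/
lemma exists_norm_snd_apply_le (j : Fin m) : ∃ C : ℝ, 0 ≤ C ∧ ∀ w : Pair Ω m,
    ‖w.snd j‖ ≤ C * (‖w.fst‖ + ‖M.energyMap (toH w)‖) := by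
  set μj := Ω.surface.restrict (M.core j) with hμj
  have hpos : 0 < μj.real univ := by
    rw [hμj, Measure.real, Measure.restrict_apply_univ]
    exact ENNReal.toReal_pos (M.surface_core_pos j).ne' (measure_ne_top _ _)
  set a : ℝ := √(μj.real univ) with ha
  have ha0 : 0 < a := Real.sqrt_pos.2 hpos
  refine ⟨a⁻¹ * (‖trace Ω‖ + 1), by positivity, fun w => ?_⟩
  have hle : μj ≤ Ω.surface.restrict (⋃ j, M.core j) :=
    Measure.restrict_mono_set _ (subset_iUnion _ j)
  have hleS : μj ≤ Ω.surface := Measure.restrict_le_self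
  have hT : MemLp (trace Ω w.fst) 2 μj := (Lp.memLp _).mono_measure hleS
  have hJ : MemLp (M.restrictCore (M.jumpH (toH w))) 2 μj := (Lp.memLp _).mono_measure hle
  have hae : (fun _ => w.snd j) =ᵐ[μj]
      fun x => trace Ω w.fst x - M.restrictCore (M.jumpH (toH w)) x := by
    have h1 := (M.restrictCore_jumpH_toH w).filter_mono
      (Measure.absolutelyContinuous_of_le hle).ae_le
    filter_upwards [h1, ae_restrict_mem (M.measurableSet_core j)] with x h1 h2
    rw [h1, jump, M.piecewise_of_mem _ (M.core_subset j h2)]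
    ring
  have hE : eLpNorm (fun _ : RSpace d => w.snd j) 2 μj ≤
      ENNReal.ofReal (‖trace Ω w.fst‖ + ‖M.restrictCore (M.jumpH (toH w))‖) := by
    rw [eLpNorm_congr_ae hae, ENNReal.ofReal_add (norm_nonneg _) (norm_nonneg _), ofReal_norm,
      ofReal_norm, Lp.enorm_def, Lp.enorm_def]
    exact (eLpNorm_sub_le hT.1 hJ.1 (by norm_num)).trans
      (add_le_add (eLpNorm_mono_measure _ hleS) (eLpNorm_mono_measure _ hle))
  have hconst : eLpNorm (fun _ : RSpace d => w.snd j) 2 μj = ENNReal.ofReal (‖w.snd j‖ * a) := by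
    refine (ENNReal.pow_right_strictMono two_ne_zero).injective ?_
    simp only
    rw [eLpNorm_two_sq, lintegral_const, ← ENNReal.ofReal_pow (by positivity), mul_pow, ha,
      Real.sq_sqrt hpos.le, ENNReal.ofReal_mul (by positivity), ENNReal.ofReal_pow (norm_nonneg _),
      ofReal_norm, ofReal_measureReal]
  rw [hconst, ENNReal.ofReal_le_ofReal_iff (by positivity)] at hE
  have h1 : ‖trace Ω w.fst‖ ≤ ‖trace Ω‖ * ‖w.fst‖ := (trace Ω).le_opNorm _
  have h2 : ‖M.restrictCore (M.jumpH (toH w))‖ ≤ ‖M.energyMap (toH w)‖ := by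
    refine le_of_sq_le_sq ?_ (norm_nonneg _)
    rw [norm_energyMap_sq]
    exact le_add_of_nonneg_left (sq_nonneg _)
  rw [mul_assoc, ← div_eq_inv_mul, le_div_iff₀ ha0]
  refine hE.trans ?_
  have := norm_nonneg (M.energyMap (toH w))
  have := norm_nonneg (trace Ω)
  have := norm_nonneg w.fst
  nlinarith [mul_nonneg (norm_nonneg (trace Ω)) (norm_nonneg (M.energyMap (toH w)))]

/-- Among the representatives of a class, choose the one shifted by the Poincaré constant: its first
component is controlled by the gradient, and then its second by the patch estimate. The argument is
run for smooth v and extended by density, both sides being continuous. -/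
theorem exists_norm_le_energyMap :
    ∃ C : ℝ, 0 < C ∧ ∀ x : HSpace Ω m, ‖x‖ ≤ C * ‖M.energyMap x‖ := by
  obtain ⟨Cp, hCp⟩ := exists_norm_sub_const_le Ω
  choose Cj hCj0 hCj using M.exists_norm_snd_apply_le
  set S : ℝ := ∑ j, Cj j with hS
  have hS0 : 0 ≤ S := Finset.sum_nonneg fun j _ => hCj0 j
  -- The first summand bounds the H¹ component; the second sums the patch estimates, each of which
  -- sees that component and the energy once more.
  set K : ℝ := (|Cp| + 1) + S * ((|Cp| + 1) + 1) with hK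
  have hK0 : 0 < K := by positivity
  have hsmooth : ∀ (φ : Smooth d) (V : CSpace m),
      ‖toH (WithLp.toLp 2 (ofSmooth Ω φ, V) : Pair Ω m)‖ ≤
        K * ‖M.energyMap (toH (WithLp.toLp 2 (ofSmooth Ω φ, V) : Pair Ω m))‖ := by
    intro φ V
    obtain ⟨c, hc⟩ := hCp φ
    set w : Pair Ω m := WithLp.toLp 2 (ofSmooth Ω φ, V) with hw
    set w' : Pair Ω m := w - c • onePair Ω m with hw'
    have hH : toH w' = toH w := by
      have h : toH (w - c • onePair Ω m) = toH w - toH (c • onePair Ω m) :=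
        Submodule.Quotient.mk_sub _
      rw [hw', h, toH_smul_onePair, sub_zero]
    set e := ‖M.energyMap (toH w)‖ with he
    have hge : ‖H1.grad (ofSmooth Ω φ)‖ ≤ e := by
      have : gradH Ω m (toH w) = H1.grad (ofSmooth Ω φ) := gradH_toH w
      rw [← this]
      refine le_of_sq_le_sq ?_ (norm_nonneg _)
      rw [norm_energyMap_sq]
      exact le_add_of_nonneg_right (sq_nonneg _)
    have hf : ‖w'.fst‖ ≤ (|Cp| + 1) * e := by
      have e1 : w'.fst = ofSmooth Ω φ - c • H1.one Ω := rfl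
      have e2 : H1.grad (ofSmooth Ω φ - c • H1.one Ω) = H1.grad (ofSmooth Ω φ) := by
        rw [← H1.gradL_apply, map_sub, map_smul, H1.gradL_apply, H1.gradL_apply, grad_one,
          smul_zero, sub_zero]
      have e3 := H1.norm_sq (ofSmooth Ω φ - c • H1.one Ω)
      rw [e2] at e3
      have h4 : ‖H1.val (ofSmooth Ω φ - c • H1.one Ω)‖ ≤ |Cp| * e :=
        hc.trans (mul_le_mul (le_abs_self _) hge (norm_nonneg _) (abs_nonneg _))
      rw [e1]
      refine le_of_sq_le_sq ?_ (by positivity)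
      rw [e3]
      have := norm_nonneg (H1.val (ofSmooth Ω φ - c • H1.one Ω))
      have := norm_nonneg (H1.grad (ofSmooth Ω φ))
      have : 0 ≤ |Cp| * e := by positivity
      nlinarith
    have hs : ‖w'.snd‖ ≤ S * (((|Cp| + 1) + 1) * e) := by
      have e1 : w'.snd = ∑ j, w'.snd j • EuclideanSpace.single j (1 : ℂ) := by
        ext i
        simp [Finset.sum_apply, Pi.single_apply]
      rw [e1, hS, Finset.sum_mul]
      refine (norm_sum_le _ _).trans (Finset.sum_le_sum fun j _ => ?_)
      rw [norm_smul, PiLp.norm_single, norm_one, mul_one]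
      refine (hCj j w').trans (mul_le_mul_of_nonneg_left ?_ (hCj0 j))
      rw [hH]
      linarith
    calc ‖toH w‖ = ‖toH w'‖ := by rw [hH]
      _ ≤ ‖w'‖ := Submodule.Quotient.norm_mk_le _ _
      _ ≤ ‖w'.fst‖ + ‖w'.snd‖ := by
          refine le_of_sq_le_sq ?_ (by positivity)
          rw [WithLp.prod_norm_sq_eq_of_L2]
          nlinarith [norm_nonneg w'.fst, norm_nonneg w'.snd]
      _ ≤ K * e := by rw [hK]; linarith
  refine ⟨K, hK0, fun x => ?_⟩
  obtain ⟨w, rfl⟩ := Submodule.Quotient.mk_surjective _ x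
  have hcont : Continuous fun w : Pair Ω m => toH w := continuous_quotient_mk'
  have hdense : DenseRange fun q : Smooth d × CSpace m =>
      (WithLp.toLp 2 (ofSmooth Ω q.1, q.2) : Pair Ω m) := by
    have h1 : DenseRange (Prod.map (ofSmooth Ω) (id : CSpace m → CSpace m)) :=
      (denseRange_ofSmooth Ω).prodMap denseRange_id
    exact (WithLp.prodContinuousLinearEquiv 2 ℂ (H1 Ω) (CSpace m)).symm.surjective.denseRange.comp
      h1 (WithLp.prodContinuousLinearEquiv 2 ℂ (H1 Ω) (CSpace m)).symm.continuous
  exact hdense.induction_on (p := fun w => ‖toH w‖ ≤ K * ‖M.energyMap (toH w)‖) w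
    (isClosed_le hcont.norm (continuous_const.mul (M.energyMap.continuous.comp hcont).norm))
    fun q => hsmooth q.1 q.2

theorem energyNorm_equiv : ∃ C : ℝ, 0 < C ∧ ∀ w : Pair Ω m,
    M.energyNorm w ≤ C * ‖toH w‖ ∧ ‖toH w‖ ≤ C * M.energyNorm w := by
  obtain ⟨K, hK, h⟩ := M.exists_norm_le_energyMap
  refine ⟨max K ‖M.energyMap‖, lt_max_of_lt_left hK, fun w => ?_⟩
  rw [← M.norm_energyMap_toH]
  exact ⟨(M.energyMap.le_opNorm _).trans
    (mul_le_mul_of_nonneg_right (le_max_right _ _) (norm_nonneg _)),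
    (h _).trans (mul_le_mul_of_nonneg_right (le_max_left _ _) (norm_nonneg _))⟩

end ElectrodeModel

/-! ### Families of operators satisfying a resolvent identity -/

section Resolvent

variable {B W X R : Type*} [NormedAddCommGroup B] [NormedSpace ℂ B]
  [NormedAddCommGroup W] [NormedSpace ℂ W] [NormedAddCommGroup X] [NormedSpace ℂ X]
  [NormedAddCommGroup R] [NormedSpace ℂ R]

/-- The series `∑ P(b₁) ⋯ P(b_k) n`. -/
def resolventSeries (P : B →L[ℂ] X →L[ℂ] X) (n : W →L[ℂ] X) :
    FormalMultilinearSeries ℂ B (W →L[ℂ] X) :=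
  ((ContinuousLinearMap.compL ℂ W X X).flip n).compFormalMultilinearSeries
    ((formalMultilinearSeries_geometric ℂ (X →L[ℂ] X)).compContinuousLinearMap P)

lemma resolventSeries_apply (P : B →L[ℂ] X →L[ℂ] X) (n : W →L[ℂ] X) (k : ℕ) (b : Fin k → B) :
    resolventSeries P n k b = ((List.ofFn fun i => P (b i)).prod).comp n := by
  simp [resolventSeries, formalMultilinearSeries_geometric, Function.comp_def]

/-- Close to a the identity can be solved as N(a') = (1 - P(a' - a))⁻¹ N(a), the geometric series
composed with a continuous linear map. Completeness of X makes 1 - P(a' - a) invertible. -/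
lemma hasFPowerSeriesAt_of_resolvent_identity [CompleteSpace X]
    {N : B → W →L[ℂ] X} {P : B →L[ℂ] X →L[ℂ] X} {a : B}
    (h : ∀ᶠ a' in nhds a, N a' = N a + (P (a' - a)).comp (N a')) :
    HasFPowerSeriesAt N (resolventSeries P (N a)) a := by
  have h1 : HasFPowerSeriesAt (fun x : X →L[ℂ] X => Ring.inverse (1 - x))
      (formalMultilinearSeries_geometric ℂ (X →L[ℂ] X)) (P 0) := by
    rw [map_zero]
    exact ⟨1, hasFPowerSeriesOnBall_inverse_one_sub ℂ (X →L[ℂ] X)⟩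
  obtain ⟨r, h2⟩ := h1.compContinuousLinearMap
  have h3 : HasFPowerSeriesAt (fun a' => (Ring.inverse (1 - P (a' - a))).comp (N a))
      (resolventSeries P (N a)) a := by
    refine ⟨r, ?_⟩
    have := (((ContinuousLinearMap.compL ℂ W X X).flip (N a)).comp_hasFPowerSeriesOnBall
      h2).comp_sub a
    rw [zero_add] at this
    exact this
  refine h3.congr ?_
  have hcont : Continuous fun a' => ‖P (a' - a)‖ :=
    (P.continuous.comp (continuous_id.sub continuous_const)).norm
  have hsmall : ∀ᶠ a' in nhds a, ‖P (a' - a)‖ < 1 :=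
    hcont.continuousAt.eventually_lt continuousAt_const (by simp)
  filter_upwards [h, hsmall] with a' ha' hlt
  have hu : IsUnit (1 - P (a' - a)) := (Units.oneSub _ hlt).isUnit
  have e : N a = (1 - P (a' - a)).comp (N a') := by
    rw [ContinuousLinearMap.sub_comp, eq_sub_iff_add_eq, ← ha']
    rfl
  calc (Ring.inverse (1 - P (a' - a))).comp (N a)
      = (Ring.inverse (1 - P (a' - a)) * (1 - P (a' - a))).comp (N a') := by
        rw [e]; rfl
    _ = N a' := by
        rw [Ring.inverse_mul_cancel _ hu]; rfl

/-- Q is a contraction only in the norm of R, so the geometric series is summed for the conjugate of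
Q by Φ and pulled back. Convergence in operator norm is unaffected by the isomorphism, even if ‖Q‖ ≥
1 on X. -/
lemma hasSum_pow_comp_of_resolvent_identity [CompleteSpace R] {Q : X →L[ℂ] X} {n n' : W →L[ℂ] X}
    (h : n' = n + Q.comp n') (Φ : X ≃L[ℂ] R) {q : ℝ} (hq0 : 0 ≤ q) (hq : q < 1)
    (hQ : ∀ x, ‖Φ (Q x)‖ ≤ q * ‖Φ x‖) : HasSum (fun k : ℕ => (Q ^ k).comp n) n' := by
  set Q' : R →L[ℂ] R := Φ.toContinuousLinearMap ∘L Q ∘L Φ.symm.toContinuousLinearMap with hQ'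
  have hnorm : ‖Q'‖ < 1 := by
    refine (ContinuousLinearMap.opNorm_le_bound _ hq0 fun r => ?_).trans_lt hq
    simpa [hQ'] using hQ (Φ.symm r)
  have hpow : ∀ k : ℕ, Φ.symm.toContinuousLinearMap ∘L (Q' ^ k) ∘L Φ.toContinuousLinearMap
      = Q ^ k := by
    intro k
    induction k with
    | zero => ext x; simp
    | succ k ih =>
      rw [pow_succ, pow_succ, ← ih]
      ext x
      simp [hQ']
  have hs := (summable_geometric_of_norm_lt_one hnorm).hasSum
  set L : (R →L[ℂ] R) →L[ℂ] (X →L[ℂ] X) :=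
    (ContinuousLinearMap.compL ℂ X R X Φ.symm.toContinuousLinearMap) ∘L
      ((ContinuousLinearMap.compL ℂ X R R).flip Φ.toContinuousLinearMap) with hL
  have hLk : ∀ k : ℕ, L (Q' ^ k) = Q ^ k := hpow
  have hs2 : HasSum (fun k : ℕ => Q ^ k) (L (∑' k : ℕ, Q' ^ k)) := by
    simpa only [hLk] using L.hasSum hs
  have hinv : (∑' k : ℕ, Q ^ k) * (1 - Q) = 1 := hs2.summable.tsum_pow_mul_one_sub
  have e : n = (1 - Q).comp n' := by
    rw [ContinuousLinearMap.sub_comp, eq_sub_iff_add_eq, ← h]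
    rfl
  have e' : n' = (∑' k : ℕ, Q ^ k).comp n := by
    calc n' = ((∑' k : ℕ, Q ^ k) * (1 - Q)).comp n' := by rw [hinv]; rfl
      _ = (∑' k : ℕ, Q ^ k).comp n := by rw [e]; rfl
  rw [e']
  exact ((ContinuousLinearMap.compL ℂ W X X).flip n).hasSum hs2.summable.hasSum

/-! ### Derivatives and Taylor terms of a resolvent family -/

section Derivatives

variable {N : B → W →L[ℂ] X} {P : B →L[ℂ] X →L[ℂ] X} {a : B}

lemma analyticAt_of_resolvent_identity [CompleteSpace X]
    (h : ∀ᶠ a' in nhds a, N a' = N a + (P (a' - a)).comp (N a')) : AnalyticAt ℂ N a :=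
  (hasFPowerSeriesAt_of_resolvent_identity h).analyticAt

lemma iteratedFDeriv_of_resolvent_identity [CompleteSpace X]
    (h : ∀ᶠ a' in nhds a, N a' = N a + (P (a' - a)).comp (N a')) (k : ℕ) (b : Fin k → B) :
    iteratedFDeriv ℂ k N a b =
      (∑ α : Equiv.Perm (Fin k), (List.ofFn fun i => P (b (α i))).prod).comp (N a) := by
  obtain ⟨r, hr⟩ := hasFPowerSeriesAt_of_resolvent_identity h
  -- The terms of the power series are not symmetric in their arguments; the derivative is their sum
  -- over all reorderings.
  rw [hr.iteratedFDeriv_eq_sum_of_completeSpace]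
  simp only [resolventSeries_apply]
  ext I
  simp

/-- With equal directions the k! permutations give the same product, which cancels the factorial. -/
lemma iteratedFDeriv_const_of_resolvent_identity [CompleteSpace X]
    (h : ∀ᶠ a' in nhds a, N a' = N a + (P (a' - a)).comp (N a')) (k : ℕ) (b : B) :
    ((k.factorial : ℂ)⁻¹ • iteratedFDeriv ℂ k N a fun _ => b) = (P b ^ k).comp (N a) := by
  rw [iteratedFDeriv_of_resolvent_identity h]
  have hk : (k.factorial : ℂ) ≠ 0 := by exact_mod_cast k.factorial_ne_zero
  simp only [List.ofFn_const, List.prod_replicate, Finset.sum_const, Finset.card_univ,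
    Fintype.card_perm, Fintype.card_fin]
  rw [← Nat.cast_smul_eq_nsmul ℂ, ContinuousLinearMap.smul_comp, smul_smul, inv_mul_cancel₀ hk,
    one_smul]

lemma analyticOnNhd_comp_left {s : Set B} (T : X →L[ℂ] R) (h : AnalyticOnNhd ℂ N s) :
    AnalyticOnNhd ℂ (fun a => T.comp (N a)) s :=
  (ContinuousLinearMap.compL ℂ W X R T).comp_analyticOnNhd h

lemma iteratedFDeriv_comp_left (T : X →L[ℂ] R) [CompleteSpace X] (h : AnalyticAt ℂ N a) (k : ℕ)
    (b : Fin k → B) :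
    iteratedFDeriv ℂ k (fun a => T.comp (N a)) a b = T.comp (iteratedFDeriv ℂ k N a b) := by
  have := (ContinuousLinearMap.compL ℂ W X R T).iteratedFDeriv_comp_left
    (h.contDiffAt (n := k)) le_rfl
  exact congrArg (fun F => F b) this

lemma hasSum_iteratedFDeriv_comp_left (T : X →L[ℂ] R) [CompleteSpace X] (h : AnalyticAt ℂ N a)
    {b : B} {n : W →L[ℂ] X}
    (hs : HasSum (fun k : ℕ => (k.factorial : ℂ)⁻¹ • iteratedFDeriv ℂ k N a fun _ => b) n) :
    HasSum (fun k : ℕ => (k.factorial : ℂ)⁻¹ •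
      iteratedFDeriv ℂ k (fun a => T.comp (N a)) a fun _ => b) (T.comp n) := by
  have h1 := (ContinuousLinearMap.compL ℂ W X R T).hasSum hs
  simp only [iteratedFDeriv_comp_left T h, ← ContinuousLinearMap.comp_smul]
  exact h1

lemma comp_eq_comp_tsum (T : X →L[ℂ] R) {f : ℕ → W →L[ℂ] X} {n : W →L[ℂ] X} (h : HasSum f n) :
    T.comp n = T.comp (∑' k : ℕ, f k) := by
  rw [h.tsum_eq]

end Derivatives

end Resolvent

/-! ### Ellipticity -/

/-- The exceptional null set in the hypothesis depends on ξ. A countable dense set of ξ gives one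
common null set, and continuity in ξ does the rest. -/
lemma IsEllipticConst.ae_forall {Ω : LipschitzDomain d} {A : LInf Ω} {c : ℝ}
    (h : IsEllipticConst Ω A c) :
    ∀ᵐ x ∂Ω.vol, ∀ ξ : CSpace d, c * ‖ξ‖ ^ 2 ≤ (inner ℂ ξ (A x ξ)).re := by
  have hd := ae_all_iff.2 fun n : ℕ => h.2 (TopologicalSpace.denseSeq (CSpace d) n)
  filter_upwards [hd] with x hx ξ
  refine (TopologicalSpace.denseRange_denseSeq (CSpace d)).induction_on
    (p := fun ξ => c * ‖ξ‖ ^ 2 ≤ (inner ℂ ξ (A x ξ)).re) ξ (isClosed_le ?_ ?_) hx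
  · fun_prop
  · exact Complex.continuous_re.comp (continuous_id.inner (A x).continuous)

lemma LInf.ae_norm_le {Ω : LipschitzDomain d} (B : LInf Ω) : ∀ᵐ x ∂Ω.vol, ‖B x‖ ≤ ‖B‖ := by
  filter_upwards [ae_le_eLpNormEssSup (f := B) (μ := Ω.vol)] with x hx
  rw [← eLpNorm_exponent_top, ← Lp.enorm_def] at hx
  rw [← toReal_enorm, ← toReal_enorm]
  exact ENNReal.toReal_mono enorm_ne_top hx

lemma IsEllipticConst.add {Ω : LipschitzDomain d} {A B : LInf Ω} {c : ℝ}
    (h : IsEllipticConst Ω A c) (hB : ‖B‖ < c) : IsEllipticConst Ω (A + B) (c - ‖B‖) := by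
  refine ⟨sub_pos.2 hB, fun ξ => ?_⟩
  filter_upwards [h.2 ξ, LInf.ae_norm_le B, Lp.coeFn_add A B] with x h1 h2 h3
  rw [h3, Pi.add_apply, add_apply, inner_add_right, Complex.add_re]
  have h4 : -(‖B‖ * ‖ξ‖ ^ 2) ≤ (inner ℂ ξ (B x ξ)).re := by
    refine (neg_le_neg ?_).trans (neg_abs_le _)
    refine (Complex.abs_re_le_norm _).trans ((norm_inner_le_norm _ _).trans ?_)
    have h5 : ‖B x ξ‖ ≤ ‖B‖ * ‖ξ‖ := ((B x).le_opNorm ξ).trans (by gcongr)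
    nlinarith [norm_nonneg ξ]
  linarith

/-- An ellipticity constant is itself an admissible radius, since a perturbation lowers it by at
most its norm. -/
lemma isOpen_LInfPos (Ω : LipschitzDomain d) : IsOpen (LInfPos Ω) := by
  rw [Metric.isOpen_iff]
  rintro A ⟨c, hc⟩
  refine ⟨c, hc.1, fun A' hA' => ?_⟩
  rw [Metric.mem_ball, dist_eq_norm] at hA'
  have := hc.add hA'
  rw [add_sub_cancel] at this
  exact ⟨_, this⟩

/-! ### Coercive operators on Hilbert spaces -/

lemma isUnit_of_coercive {R : Type*} [NormedAddCommGroup R] [InnerProductSpace ℂ R]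
    [CompleteSpace R] {S : R →L[ℂ] R} {c : ℝ} (hc : 0 < c)
    (h : ∀ r, c * ‖r‖ ^ 2 ≤ (inner ℂ r (S r)).re) : IsUnit S := by
  refine ContinuousLinearMap.isUnit_of_forall_le_norm_inner_map S (c := ⟨c, hc.le⟩) hc fun r => ?_
  rw [mul_comm, norm_inner_symm]
  exact (h r).trans (Complex.re_le_norm _)

lemma norm_le_of_coercive {R : Type*} [NormedAddCommGroup R] [InnerProductSpace ℂ R]
    {S : R →L[ℂ] R} {c : ℝ}
    (h : ∀ r, c * ‖r‖ ^ 2 ≤ (inner ℂ r (S r)).re) (r : R) : c * ‖r‖ ≤ ‖S r‖ := by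
  by_cases hr : ‖r‖ = 0
  · rw [hr, mul_zero]
    exact norm_nonneg _
  · have hr' : 0 < ‖r‖ := lt_of_le_of_ne (norm_nonneg _) (Ne.symm hr)
    have h1 := (h r).trans ((Complex.re_le_norm _).trans (norm_inner_le_norm _ _))
    refine le_of_mul_le_mul_left ?_ hr'
    linarith

lemma norm_adjoint_apply_le {R L : Type*} [NormedAddCommGroup R] [InnerProductSpace ℂ R]
    [CompleteSpace R] [NormedAddCommGroup L] [InnerProductSpace ℂ L] [CompleteSpace L]
    {G : R →L[ℂ] L} (h : ∀ r, ‖G r‖ ≤ ‖r‖) (u : L) :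
    ‖ContinuousLinearMap.adjoint G u‖ ≤ ‖u‖ := by
  have hG : ‖G‖ ≤ 1 := G.opNorm_le_bound zero_le_one fun r => by rw [one_mul]; exact h r
  refine ((ContinuousLinearMap.adjoint G).le_opNorm u).trans ?_
  rw [LinearIsometryEquiv.norm_map]
  exact mul_le_of_le_one_left (norm_nonneg u) hG

/-- The family `b ↦ S ∘ Q(b) ∘ T`. -/
def sandwich {B X Y Z U : Type*} [NormedAddCommGroup B] [NormedSpace ℂ B]
    [NormedAddCommGroup X] [NormedSpace ℂ X] [NormedAddCommGroup Y] [NormedSpace ℂ Y]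
    [NormedAddCommGroup Z] [NormedSpace ℂ Z] [NormedAddCommGroup U] [NormedSpace ℂ U]
    (S : Z →L[ℂ] U) (T : X →L[ℂ] Y) (Q : B →L[ℂ] Y →L[ℂ] Z) : B →L[ℂ] X →L[ℂ] U :=
  (ContinuousLinearMap.compL ℂ X Z U S) ∘L ((ContinuousLinearMap.compL ℂ X Y Z).flip T) ∘L Q

namespace ElectrodeModel

variable {Ω : LipschitzDomain d} {m : ℕ} (M : ElectrodeModel Ω m)

/-! ### Coercivity of the multiplication operators -/

lemma re_inner_mulMat_ge {A : LInf Ω} {c : ℝ} (h : IsEllipticConst Ω A c)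
    (u : Lp (CSpace d) 2 Ω.vol) : c * ‖u‖ ^ 2 ≤ (inner ℂ u (mulMat Ω A u)).re := by
  have hi : Integrable (fun x => inner ℂ (u x) (mulMat Ω A u x)) Ω.vol := L2.integrable_inner u _
  have e := integral_re hi
  rw [L2.inner_def, L2_norm_sq_eq_integral, ← integral_const_mul]
  change _ ≤ RCLike.re (∫ x, inner ℂ (u x) (mulMat Ω A u x) ∂Ω.vol)
  rw [← e]
  refine integral_mono_ae ((Lp.memLp u).norm.integrable_sq.const_mul c) hi.re ?_
  filter_upwards [h.ae_forall, mulMat_coe A u] with x h1 h2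
  rw [h2]
  exact h1 (u x)

/-- Off the patches the integrand Re ζ |u|² is nonnegative and is dropped; on them Re ζ ≥ c_ζ. -/
lemma re_inner_mulζ_ge (u : Lp ℂ 2 Ω.surface) :
    M.cζ * ‖M.restrictCore u‖ ^ 2 ≤ (inner ℂ u (M.mulζ u)).re := by
  have hi : Integrable (fun x => inner ℂ (u x) (M.mulζ u x)) Ω.surface := L2.integrable_inner u _
  have e := integral_re hi
  have hpt : ∀ᵐ x ∂Ω.surface, RCLike.re (inner ℂ (u x) (M.mulζ u x))
      = (M.ζ x).re * ‖u x‖ ^ 2 := by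
    filter_upwards [M.mulζ_coe u] with x hx
    rw [hx]
    simp only [RCLike.inner_apply, mul_assoc, RCLike.mul_conj]
    simp [← Complex.ofReal_pow]
  have hc : ∀ᵐ x ∂Ω.surface.restrict (⋃ j, M.core j), M.restrictCore u x = u x :=
    LpToLpRestrictCLM_coeFn ℂ (⋃ j, M.core j) u
  rw [L2.inner_def, L2_norm_sq_eq_integral, ← integral_const_mul]
  change _ ≤ RCLike.re (∫ x, inner ℂ (u x) (M.mulζ u x) ∂Ω.surface)
  rw [← e]
  refine le_trans ?_ (setIntegral_le_integral (s := ⋃ j, M.core j) hi.re ?_)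
  · refine integral_mono_ae ((Lp.memLp (M.restrictCore u)).norm.integrable_sq.const_mul _)
      hi.re.integrableOn ?_
    filter_upwards [hc, ae_restrict_of_ae hpt, ae_restrict_of_ae M.cζ_le,
      ae_restrict_mem M.measurableSet_iUnion_core] with x h1 h2 h3 h4
    rw [h1, h2]
    exact mul_le_mul_of_nonneg_right (h3 h4) (sq_nonneg _)
  · filter_upwards [hpt, M.ζ_re_nonneg] with x h1 h2
    rw [h1]
    exact mul_nonneg h2 (sq_nonneg _)

variable [NeZero m]

/-! ### The Hilbert space realisation of `𝓗` -/

/-- The lower bound makes the range closed, hence a Hilbert space isomorphic to 𝓗; on it coercivity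
and adjoints become available. -/
lemma antilipschitz_energyMap : ∃ K, AntilipschitzWith K M.energyMap := by
  obtain ⟨C, hC, h⟩ := M.exists_norm_le_energyMap
  exact ⟨⟨C, hC.le⟩, M.energyMap.antilipschitz_of_bound h⟩

lemma injective_energyMap : Function.Injective M.energyMap :=
  M.antilipschitz_energyMap.choose_spec.injective

lemma isClosed_range_energyMap : IsClosed (range M.energyMap) :=
  M.antilipschitz_energyMap.choose_spec.isClosed_range M.energyMap.uniformContinuous

/-- `𝓗` with the energy norm, as a Hilbert space. -/
def EnergySpace : Type := M.energyMap.range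

instance : NormedAddCommGroup M.EnergySpace :=
  inferInstanceAs (NormedAddCommGroup M.energyMap.range)

instance : InnerProductSpace ℂ M.EnergySpace :=
  inferInstanceAs (InnerProductSpace ℂ M.energyMap.range)

instance : CompleteSpace M.EnergySpace :=
  M.isClosed_range_energyMap.completeSpace_coe

/-- `𝓗` is isomorphic to its realisation with the energy norm. -/
def energyEquiv : HSpace Ω m ≃L[ℂ] M.EnergySpace :=
  M.energyMap.equivRange M.injective_energyMap M.isClosed_range_energyMap

lemma norm_energyEquiv (x : HSpace Ω m) : ‖M.energyEquiv x‖ = ‖M.energyMap x‖ := rfl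

/-- The gradient on the energy space. -/
def gradE : M.EnergySpace →L[ℂ] Lp (CSpace d) 2 Ω.vol :=
  (gradH Ω m).comp M.energyEquiv.symm.toContinuousLinearMap

/-- The jump on the energy space. -/
def jumpE : M.EnergySpace →L[ℂ] Lp ℂ 2 Ω.surface :=
  M.jumpH.comp M.energyEquiv.symm.toContinuousLinearMap

lemma norm_sq_energySpace (r : M.EnergySpace) :
    ‖r‖ ^ 2 = ‖M.gradE r‖ ^ 2 + ‖M.restrictCore (M.jumpE r)‖ ^ 2 := by
  obtain ⟨x, rfl⟩ := M.energyEquiv.surjective r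
  rw [norm_energyEquiv, norm_energyMap_sq]
  simp [gradE, jumpE]

lemma norm_gradE_le (r : M.EnergySpace) : ‖M.gradE r‖ ≤ ‖r‖ := by
  refine le_of_sq_le_sq ?_ (norm_nonneg _)
  rw [norm_sq_energySpace]
  exact le_add_of_nonneg_right (sq_nonneg _)

/-- The operator of the form `⟨·, ·⟩_B` on the energy space. -/
def gradOp : LInf Ω →L[ℂ] M.EnergySpace →L[ℂ] M.EnergySpace :=
  sandwich (ContinuousLinearMap.adjoint M.gradE) M.gradE (mulMat Ω)

lemma inner_gradOp (B : LInf Ω) (r s : M.EnergySpace) :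
    inner ℂ s (M.gradOp B r) = inner ℂ (M.gradE s) (mulMat Ω B (M.gradE r)) :=
  ContinuousLinearMap.adjoint_inner_right M.gradE s (mulMat Ω B (M.gradE r))

/-- The gradient has norm at most 1 for the energy norm, so no constant beyond ‖B‖ appears. This is
what makes the radius of the Taylor series explicit. -/
lemma norm_gradOp_le (B : LInf Ω) (r : M.EnergySpace) : ‖M.gradOp B r‖ ≤ ‖B‖ * ‖r‖ :=
  (norm_adjoint_apply_le M.norm_gradE_le _).trans
    ((norm_mulMat_le B _).trans (mul_le_mul_of_nonneg_left (M.norm_gradE_le r) (norm_nonneg B)))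

/-- The operator of the form `a_A` on the energy space. -/
def formOp (A : LInf Ω) : M.EnergySpace →L[ℂ] M.EnergySpace :=
  M.gradOp A + (ContinuousLinearMap.adjoint M.jumpE) ∘L M.mulζ ∘L M.jumpE

lemma formOp_add (A B : LInf Ω) : M.formOp (A + B) = M.formOp A + M.gradOp B := by
  rw [formOp, formOp, map_add]
  abel

lemma inner_formOp (A : LInf Ω) (r s : M.EnergySpace) : inner ℂ s (M.formOp A r) =
    inner ℂ (M.gradE s) (mulMat Ω A (M.gradE r))
      + inner ℂ (M.jumpE s) (M.mulζ (M.jumpE r)) := by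
  rw [formOp, add_apply, inner_add_right, inner_gradOp]
  congr 1
  exact ContinuousLinearMap.adjoint_inner_right M.jumpE s (M.mulζ (M.jumpE r))

lemma form_eq_inner_formOp (A : LInf Ω) (w v : Pair Ω m) : M.form A w v =
    inner ℂ (M.energyEquiv (toH v)) (M.formOp A (M.energyEquiv (toH w))) := by
  rw [form_eq, inner_formOp]
  simp [gradE, jumpE]

lemma gradForm_eq_inner_gradOp (B : LInf Ω) (w v : Pair Ω m) : gradForm B w.fst v.fst =
    inner ℂ (M.energyEquiv (toH v)) (M.gradOp B (M.energyEquiv (toH w))) := by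
  rw [gradForm_eq_inner, inner_gradOp, ← gradH_toH, ← gradH_toH]
  simp [gradE]

/-- The two squares making up the energy norm are matched with the two terms of the form: the
gradient with A, the jump on the patches with ζ. -/
lemma formOp_coercive {A : LInf Ω} {c : ℝ} (h : IsEllipticConst Ω A c) (r : M.EnergySpace) :
    min c M.cζ * ‖r‖ ^ 2 ≤ (inner ℂ r (M.formOp A r)).re := by
  rw [inner_formOp, Complex.add_re, norm_sq_energySpace, mul_add]
  refine add_le_add ?_ ?_
  · exact (mul_le_mul_of_nonneg_right (min_le_left _ _) (sq_nonneg _)).trans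
      (re_inner_mulMat_ge h _)
  · exact (mul_le_mul_of_nonneg_right (min_le_right _ _) (sq_nonneg _)).trans
      (M.re_inner_mulζ_ge _)

lemma isUnit_formOp {A : LInf Ω} (hA : A ∈ LInfPos Ω) : IsUnit (M.formOp A) := by
  obtain ⟨c, hc⟩ := hA
  exact isUnit_of_coercive (lt_min hc.1 M.cζ_pos) (M.formOp_coercive hc)

lemma formOp_injective {A : LInf Ω} (hA : A ∈ LInfPos Ω) {r s : M.EnergySpace}
    (h : M.formOp A r = M.formOp A s) : r = s :=
  (ContinuousLinearMap.isUnit_iff_bijective.1 (M.isUnit_formOp hA)).1 h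

lemma formOp_inverse_apply {A : LInf Ω} (hA : A ∈ LInfPos Ω) (r : M.EnergySpace) :
    M.formOp A (Ring.inverse (M.formOp A) r) = r := by
  have h := Ring.mul_inverse_cancel _ (M.isUnit_formOp hA)
  exact congrArg (fun T : M.EnergySpace →L[ℂ] M.EnergySpace => T r) h

/-! ### The solution operators -/

/-- The current pattern `I` as an element of the energy space. -/
def load : CDiamond m →L[ℂ] M.EnergySpace :=
  ContinuousLinearMap.adjoint (𝕜 := ℂ) (E := M.EnergySpace) (F := CDiamond m)
    ((T2 Ω m).comp M.energyEquiv.symm.toContinuousLinearMap)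

/-- I is orthogonal to 𝟏, so V may be replaced by its mean free part and the load becomes a
functional on classes. -/
lemma sum_mul_conj_eq_inner (I : CDiamond m) (v : Pair Ω m) :
    ∑ j, (I : CSpace m) j * (starRingEnd ℂ) (v.snd j)
      = inner ℂ (M.energyEquiv (toH v)) (M.load I) := by
  have hI : ∑ j, (I : CSpace m) j = 0 := I.2
  rw [load, ContinuousLinearMap.adjoint_inner_right, ContinuousLinearMap.comp_apply]
  have e : (T2 Ω m) (M.energyEquiv.symm.toContinuousLinearMap (M.energyEquiv (toH v)))
      = T2 Ω m (toH v) := by simp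
  rw [e, Submodule.coe_inner]
  have e2 : ((T2 Ω m (toH v) : CDiamond m) : CSpace m) = v.snd - mean m v.snd • allOnes m := rfl
  have e3 : inner ℂ (allOnes m) (I : CSpace m) = 0 := by
    simp [PiLp.inner_apply, allOnes, hI]
  rw [e2, inner_sub_left, inner_smul_left, e3, mul_zero, sub_zero, PiLp.inner_apply]
  simp

/-- Inner products against all of the energy space detect equality, and `sectionL` supplies a
representative of every class for testing. -/
lemma isSolution_iff (A : LInf Ω) (I : CDiamond m) (x : HSpace Ω m) :
    M.IsSolution A I x ↔ M.formOp A (M.energyEquiv x) = M.load I := by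
  constructor
  · intro h
    refine ext_inner_left ℂ fun s => ?_
    obtain ⟨y, rfl⟩ := M.energyEquiv.surjective s
    have := h (sectionL Ω m x) (toH_sectionL x) (sectionL Ω m y)
    rwa [form_eq_inner_formOp, sum_mul_conj_eq_inner, toH_sectionL, toH_sectionL] at this
  · rintro h w rfl v
    rw [form_eq_inner_formOp, sum_mul_conj_eq_inner, h]

lemma isPerturbation_iff (A B : LInf Ω) (y x : HSpace Ω m) :
    M.IsPerturbation A B y x ↔
      M.formOp A (M.energyEquiv x) = - M.gradOp B (M.energyEquiv y) := by
  constructor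
  · intro h
    refine ext_inner_left ℂ fun s => ?_
    obtain ⟨v, rfl⟩ := M.energyEquiv.surjective s
    have := h (sectionL Ω m x) (sectionL Ω m y) (toH_sectionL x) (toH_sectionL y) (sectionL Ω m v)
    rwa [form_eq_inner_formOp, gradForm_eq_inner_gradOp, toH_sectionL, toH_sectionL, toH_sectionL,
      ← inner_neg_right] at this
  · rintro h w z rfl rfl v
    rw [form_eq_inner_formOp, gradForm_eq_inner_gradOp, h, inner_neg_right]

lemma isSolution_N {A : LInf Ω} (hA : A ∈ LInfPos Ω) (I : CDiamond m) :
    M.IsSolution A I (M.N A I) := by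
  have h : ∃ S : CDiamond m →L[ℂ] HSpace Ω m, ∀ I, M.IsSolution A I (S I) := by
    -- Existence of some solution operator suffices here, as `N` is a choice among them; uniqueness
    -- of solutions later makes the choice immaterial.
    refine ⟨M.energyEquiv.symm.toContinuousLinearMap ∘L Ring.inverse (M.formOp A) ∘L M.load,
      fun I => (M.isSolution_iff A I _).2 ?_⟩
    change M.formOp A (M.energyEquiv
      (M.energyEquiv.symm (Ring.inverse (M.formOp A) (M.load I)))) = _
    rw [ContinuousLinearEquiv.apply_symm_apply, M.formOp_inverse_apply hA]
  rw [N, dif_pos h]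
  exact h.choose_spec I

lemma isPerturbation_P {A : LInf Ω} (hA : A ∈ LInfPos Ω) (B : LInf Ω) (y : HSpace Ω m) :
    M.IsPerturbation A B y (M.P A B y) := by
  have h : ∃ S : LInf Ω →L[ℂ] (HSpace Ω m →L[ℂ] HSpace Ω m),
      ∀ B y, M.IsPerturbation A B y (S B y) := by
    refine ⟨sandwich (-(M.energyEquiv.symm.toContinuousLinearMap ∘L Ring.inverse (M.formOp A)))
      M.energyEquiv.toContinuousLinearMap M.gradOp,
      fun B y => (M.isPerturbation_iff A B y _).2 ?_⟩
    change M.formOp A (M.energyEquiv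
      (-(M.energyEquiv.symm (Ring.inverse (M.formOp A) (M.gradOp B (M.energyEquiv y)))))) = _
    rw [map_neg, ContinuousLinearEquiv.apply_symm_apply, map_neg, M.formOp_inverse_apply hA]
  rw [P, dif_pos h]
  exact h.choose_spec B y

theorem isSolution_iff_eq_N {A : LInf Ω} (hA : A ∈ LInfPos Ω) (I : CDiamond m) (x : HSpace Ω m) :
    M.IsSolution A I x ↔ x = M.N A I := by
  constructor
  · intro h
    have h1 := (M.isSolution_iff A I x).1 h
    have h2 := (M.isSolution_iff A I _).1 (M.isSolution_N hA I)
    exact M.energyEquiv.injective (M.formOp_injective hA (h1.trans h2.symm))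
  · rintro rfl
    exact M.isSolution_N hA I

theorem isPerturbation_iff_eq_P {A : LInf Ω} (hA : A ∈ LInfPos Ω) (B : LInf Ω)
    (y x : HSpace Ω m) : M.IsPerturbation A B y x ↔ x = M.P A B y := by
  constructor
  · intro h
    have h1 := (M.isPerturbation_iff A B y x).1 h
    have h2 := (M.isPerturbation_iff A B y _).1 (M.isPerturbation_P hA B y)
    exact M.energyEquiv.injective (M.formOp_injective hA (h1.trans h2.symm))
  · rintro rfl
    exact M.isPerturbation_P hA B y

/-- If x solves the problem for A+B, subtracting the problem for A leaves a_A[x - N(A)I, ·] = -⟨x,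
·⟩_B, which characterises x - N(A)I as P_A(B)x. -/
lemma resolvent_identity {A B : LInf Ω} (hA : A ∈ LInfPos Ω) (hAB : A + B ∈ LInfPos Ω) :
    M.N (A + B) = M.N A + (M.P A B).comp (M.N (A + B)) := by
  ext1 I
  have h1 := (M.isSolution_iff A I _).1 (M.isSolution_N hA I)
  have h2 := (M.isSolution_iff (A + B) I _).1 (M.isSolution_N hAB I)
  have h3 := (M.isPerturbation_iff_eq_P hA B (M.N (A + B) I) (M.N (A + B) I - M.N A I)).1
    ((M.isPerturbation_iff A B _ _).2 (by
      rw [map_sub, map_sub, h1, ← h2, formOp_add, add_apply]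
      abel))
  rw [add_apply, ContinuousLinearMap.comp_apply, ← h3, add_sub_cancel]

/-- Coercivity bounds the inverse of the form operator by 1/min(c, c_ζ), and the right-hand side
costs at most ‖B‖. -/
lemma norm_energyEquiv_P_le {A : LInf Ω} {c : ℝ} (h : IsEllipticConst Ω A c) (B : LInf Ω)
    (y : HSpace Ω m) : ‖M.energyEquiv (M.P A B y)‖ ≤ ‖B‖ / min c M.cζ * ‖M.energyEquiv y‖ := by
  have hpos : 0 < min c M.cζ := lt_min h.1 M.cζ_pos
  have h1 := (M.isPerturbation_iff A B y _).1 (M.isPerturbation_P ⟨c, h⟩ B y)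
  have h2 := norm_le_of_coercive (M.formOp_coercive h) (M.energyEquiv (M.P A B y))
  rw [h1, norm_neg] at h2
  rw [div_mul_eq_mul_div, le_div_iff₀ hpos, mul_comm]
  exact h2.trans (M.norm_gradOp_le B _)

/-! ### Analyticity and the Taylor series -/

lemma eventually_resolvent_identity {A : LInf Ω} (hA : A ∈ LInfPos Ω) :
    ∀ᶠ A' in nhds A, M.N A' = M.N A + (M.P A (A' - A)).comp (M.N A') := by
  filter_upwards [(isOpen_LInfPos Ω).mem_nhds hA] with A' hA'
  have := M.resolvent_identity (B := A' - A) hA (by rwa [add_sub_cancel])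
  rwa [add_sub_cancel] at this

theorem analyticOnNhd_N : AnalyticOnNhd ℂ M.N (LInfPos Ω) :=
  fun A hA => analyticAt_of_resolvent_identity (B := LInf Ω) (W := CDiamond m) (X := HSpace Ω m)
    (P := M.P A) (M.eventually_resolvent_identity hA)

theorem iteratedFDeriv_N {A : LInf Ω} (hA : A ∈ LInfPos Ω) (k : ℕ) (B : Fin k → LInf Ω) :
    iteratedFDeriv ℂ k M.N A B =
      (∑ α : Equiv.Perm (Fin k), (List.ofFn fun i => M.P A (B (α i))).prod).comp (M.N A) :=
  iteratedFDeriv_of_resolvent_identity (B := LInf Ω) (W := CDiamond m) (X := HSpace Ω m)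
    (M.eventually_resolvent_identity hA) k B

theorem iteratedFDeriv_const_N {A : LInf Ω} (hA : A ∈ LInfPos Ω) (k : ℕ) (B : LInf Ω) :
    ((k.factorial : ℂ)⁻¹ • iteratedFDeriv ℂ k M.N A fun _ => B) = (M.P A B ^ k).comp (M.N A) :=
  iteratedFDeriv_const_of_resolvent_identity (B := LInf Ω) (W := CDiamond m) (X := HSpace Ω m)
    (M.eventually_resolvent_identity hA) k B

theorem hasSum_P_pow {A : LInf Ω} {c : ℝ} (h : IsEllipticConst Ω A c) {B : LInf Ω}
    (hB : ‖B‖ < min c M.cζ) : HasSum (fun k : ℕ => (M.P A B ^ k).comp (M.N A)) (M.N (A + B)) := by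
  have hpos : 0 < min c M.cζ := lt_min h.1 M.cζ_pos
  exact hasSum_pow_comp_of_resolvent_identity
    (M.resolvent_identity ⟨c, h⟩ ⟨_, h.add (hB.trans_le (min_le_left _ _))⟩) M.energyEquiv
    (by positivity) ((div_lt_one hpos).2 hB) (M.norm_energyEquiv_P_le h B)

end ElectrodeModel

end

end SCEM

theorem mainTheorem2 {d m : ℕ} (hd : 2 ≤ d) [NeZero m] (Ω : SCEM.LipschitzDomain d)
    (M : SCEM.ElectrodeModel Ω m) :
    -- the objects are well defined
    (∃! T, SCEM.IsTraceOp Ω T) ∧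
    (∃ C : ℝ, 0 < C ∧ ∀ w : SCEM.Pair Ω m,
      M.energyNorm w ≤ C * ‖SCEM.toH w‖ ∧ ‖SCEM.toH w‖ ≤ C * M.energyNorm w) ∧
    (∀ A ∈ SCEM.LInfPos Ω, ∀ I x, M.IsSolution A I x ↔ x = M.N A I) ∧
    (∀ A ∈ SCEM.LInfPos Ω, ∀ B y x, M.IsPerturbation A B y x ↔ x = M.P A B y) ∧
    -- smoothness and analyticity on the open set of admissible coefficients
    IsOpen (SCEM.LInfPos Ω) ∧
    ContDiffOn ℂ ∞ M.N (SCEM.LInfPos Ω) ∧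
    ContDiffOn ℂ ∞ M.F (SCEM.LInfPos Ω) ∧
    ContDiffOn ℂ ∞ M.Lam (SCEM.LInfPos Ω) ∧
    AnalyticOnNhd ℂ M.N (SCEM.LInfPos Ω) ∧
    AnalyticOnNhd ℂ M.F (SCEM.LInfPos Ω) ∧
    AnalyticOnNhd ℂ M.Lam (SCEM.LInfPos Ω) ∧
    -- formulas for the derivatives
    (∀ A ∈ SCEM.LInfPos Ω, ∀ (k : ℕ) (B : Fin k → SCEM.LInf Ω),
      iteratedFDeriv ℂ k M.N A B =
        (∑ α : Equiv.Perm (Fin k), (List.ofFn fun i => M.P A (B (α i))).prod).comp (M.N A) ∧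
      iteratedFDeriv ℂ k M.F A B = (SCEM.T1 Ω m).comp (iteratedFDeriv ℂ k M.N A B) ∧
      iteratedFDeriv ℂ k M.Lam A B = (SCEM.T2 Ω m).comp (iteratedFDeriv ℂ k M.N A B)) ∧
    -- Taylor series
    (∀ (A : SCEM.LInf Ω) (cA : ℝ), SCEM.IsEllipticConst Ω A cA →
      ∀ B : SCEM.LInf Ω, ‖B‖ < min cA M.cζ →
        A + B ∈ SCEM.LInfPos Ω ∧
        HasSum (fun k : ℕ => (k.factorial : ℂ)⁻¹ • iteratedFDeriv ℂ k M.N A fun _ => B)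
          (M.N (A + B)) ∧
        HasSum (fun k : ℕ => (M.P A B ^ k).comp (M.N A)) (M.N (A + B)) ∧
        HasSum (fun k : ℕ => (k.factorial : ℂ)⁻¹ • iteratedFDeriv ℂ k M.F A fun _ => B)
          (M.F (A + B)) ∧
        M.F (A + B) = (SCEM.T1 Ω m).comp (∑' k : ℕ, (M.P A B ^ k).comp (M.N A)) ∧
        HasSum (fun k : ℕ => (k.factorial : ℂ)⁻¹ • iteratedFDeriv ℂ k M.Lam A fun _ => B)
          (M.Lam (A + B)) ∧
        M.Lam (A + B) = (SCEM.T2 Ω m).comp (∑' k : ℕ, (M.P A B ^ k).comp (M.N A))) := by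
  have hN := M.analyticOnNhd_N
  have hFa : AnalyticOnNhd ℂ M.F (SCEM.LInfPos Ω) :=
    SCEM.analyticOnNhd_comp_left (W := SCEM.CDiamond m) (X := SCEM.HSpace Ω m) (R := SCEM.H1 Ω)
      (SCEM.T1 Ω m) hN
  have hLa : AnalyticOnNhd ℂ M.Lam (SCEM.LInfPos Ω) :=
    SCEM.analyticOnNhd_comp_left (W := SCEM.CDiamond m) (X := SCEM.HSpace Ω m)
      (R := SCEM.CDiamond m) (SCEM.T2 Ω m) hN
  refine ⟨SCEM.existsUnique_isTraceOp Ω, M.energyNorm_equiv,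
    fun A hA I x => M.isSolution_iff_eq_N hA I x,
    fun A hA B y x => M.isPerturbation_iff_eq_P hA B y x, SCEM.isOpen_LInfPos Ω,
    hN.contDiffOn (SCEM.isOpen_LInfPos Ω).uniqueDiffOn,
    hFa.contDiffOn (SCEM.isOpen_LInfPos Ω).uniqueDiffOn,
    hLa.contDiffOn (SCEM.isOpen_LInfPos Ω).uniqueDiffOn, hN, hFa, hLa,
    fun A hA k B => ⟨M.iteratedFDeriv_N hA k B,
      SCEM.iteratedFDeriv_comp_left (W := SCEM.CDiamond m) (X := SCEM.HSpace Ω m) (R := SCEM.H1 Ω)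
        (SCEM.T1 Ω m) (hN A hA) k B,
      SCEM.iteratedFDeriv_comp_left (W := SCEM.CDiamond m) (X := SCEM.HSpace Ω m)
        (R := SCEM.CDiamond m) (SCEM.T2 Ω m) (hN A hA) k B⟩, ?_⟩
  intro A cA hA B hB
  have hApos : A ∈ SCEM.LInfPos Ω := ⟨cA, hA⟩
  have hsum := M.hasSum_P_pow hA hB
  have hT : HasSum (fun k : ℕ => (k.factorial : ℂ)⁻¹ • iteratedFDeriv ℂ k M.N A fun _ => B)
      (M.N (A + B)) := by
    -- The Taylor terms coincide with the Neumann terms, so the series converges throughout the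
    -- explicit ball and not merely near A.
    simpa only [M.iteratedFDeriv_const_N hApos] using hsum
  refine ⟨⟨_, hA.add (hB.trans_le (min_le_left _ _))⟩, hT, hsum, ?_, ?_, ?_, ?_⟩
  · exact SCEM.hasSum_iteratedFDeriv_comp_left (W := SCEM.CDiamond m) (X := SCEM.HSpace Ω m)
      (R := SCEM.H1 Ω) (SCEM.T1 Ω m) (hN A hApos) hT
  · exact SCEM.comp_eq_comp_tsum (W := SCEM.CDiamond m) (X := SCEM.HSpace Ω m) (R := SCEM.H1 Ω)
      (SCEM.T1 Ω m) hsum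
  · exact SCEM.hasSum_iteratedFDeriv_comp_left (W := SCEM.CDiamond m) (X := SCEM.HSpace Ω m)
      (R := SCEM.CDiamond m) (SCEM.T2 Ω m) (hN A hApos) hT
  · exact SCEM.comp_eq_comp_tsum (W := SCEM.CDiamond m) (X := SCEM.HSpace Ω m)
      (R := SCEM.CDiamond m) (SCEM.T2 Ω m) hsum
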